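/- For every real $c>0$ there is a real $C>0$ such that the following holds. Let $G$ be a finite simple bipartite graph, embedded in a closed (compact, without boundary) surface $M$, orientable or not, so that every connected component (face) $U$ of $M\setminus G$ is an open disk whose boundary is a cycle of $G$. Here the cycle of $U$ is a closed walk $w_U=(v_0,v_1,\dots,v_{L-1},v_L=v_0)$ of length $L=L_U\ge 1$ in $G$, possibly with repeated vertices and edges and with indices read modulo $L$, such that some continuous map from the closed unit disk to $M$ carries the open disk homeomorphically onto $U$ and carries the unit circle, divided into $L$ equal arcs, successively along the edges $v_0v_1,\dots,v_{L-1}v_L$. Suppose that: (I) the faces can be partitioned into "odd" and "even" ones such that, for any vertices $j,k$, three consecutive vertices of the form $j,?,k$ or $k,?,j$ (with an arbitrary vertex in place of $?$) occur at most once in total (counting all faces and all positions) in the cycles of the even faces, and at most once in total in the cycles of the odd faces; (II) every subpath with at most $10$ edges of any cycle (with fewer edges than the cycle itself) is simple, i.e. does not visit any vertex more than once; (III) the cycles can be split into simple paths, at most $c\,|V(G)|$ paths in total. Then the embedding can be refined to a cube complex with at most $(1+C)\,|V(G)|$ vertices: there are finitely many topological squares (embedded copies of $[0,1]^2$) in $M$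 with union $M$, such that the intersection of any two of them is a (possibly empty) face of both, every vertex of $G$ is a vertex of a square, every edge of $G$ is a union of edges of squares, and the squares have at most $(1+C)\,|V(G)|$ vertices altogether. -/

import Mathlib

open Set Topology

/-- An embedding of a graph `G` in a topological space `M`: distinct vertices go to distinct points,
each edge `uv` goes to a simple arc joining the images of `u` and `v` (traversed backwards when the
edge is read as `vu`), and arcs meet the vertices and each other only at common end points. -/
structure GraphEmbedding {V : Type*} (G : SimpleGraph V) (M : Type*) [TopologicalSpace M] where
  vert : V → M
  vert_injective : Function.Injective vert
  arc : ∀ {u v : V}, G.Adj u v → Path (vert u) (vert v)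
  arc_symm : ∀ {u v : V} (h : G.Adj u v), arc h.symm = (arc h).symm
  arc_injective : ∀ {u v : V} (h : G.Adj u v), Function.Injective (arc h)
  arc_ne_vert : ∀ {u v : V} (h : G.Adj u v) (t : unitInterval) (x : V),
    t ≠ 0 → t ≠ 1 → arc h t ≠ vert x
  arc_ne_arc : ∀ {u v u' v' : V} (h : G.Adj u v) (h' : G.Adj u' v') (s t : unitInterval),
    s(u, v) ≠ s(u', v') → s ≠ 0 → s ≠ 1 → arc h s ≠ arc h' t

/-- A closed walk of positive length in `G`, as a cyclic sequence of vertices. Vertices and edges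
may be repeated. -/
structure ClosedWalk {V : Type*} (G : SimpleGraph V) where
  len : ℕ
  len_pos : 0 < len
  vertex : ZMod len → V
  adj : ∀ i, G.Adj (vertex i) (vertex (i + 1))

namespace ClosedWalk

variable {V : Type*} {G : SimpleGraph V}

/-- The subpath with `m` edges of the closed walk that starts at position `i` is simple: its
`m + 1` successive vertices are pairwise distinct. -/
def SimpleSubpath (w : ClosedWalk G) (i : ZMod w.len) (m : ℕ) : Prop :=
  InjOn (fun l : ℕ => w.vertex (i + (l : ZMod w.len))) (Iic m)

/-- Cutting the closed walk at the positions in `T` splits it into simple paths; their number is the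
number of cut positions. The path that starts at `i ∈ T` ends at the next position in `T`. -/
def SplitsAt (w : ClosedWalk G) (T : Set (ZMod w.len)) : Prop :=
  T.Nonempty ∧ ∀ i ∈ T, ∀ m : ℕ,
    (∀ l : ℕ, 0 < l → l < m → i + (l : ZMod w.len) ∉ T) → w.SimpleSubpath i m

/-- The unordered pair `{j, k}` of the outer vertices of the three consecutive vertices `j, ?, k`
that start at position `i`. -/
def outerPair (w : ClosedWalk G) (i : ZMod w.len) : Sym2 V :=
  s(w.vertex i, w.vertex (i + 2))

end ClosedWalk

namespace GraphEmbedding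

variable {V : Type*} {G : SimpleGraph V} {M : Type*} [TopologicalSpace M]

/-- The embedded graph as a subset of `M`. -/
def image (E : GraphEmbedding G M) : Set M :=
  range E.vert ∪ {x | ∃ (u v : V) (h : G.Adj u v), x ∈ range (E.arc h)}

/-- The faces: the connected components of the complement of the embedded graph. -/
def Face (E : GraphEmbedding G M) : Type _ :=
  {U : Set M // ∃ x ∈ E.imageᶜ, U = connectedComponentIn E.imageᶜ x}

/-- `U` is an open disk and `w` is its boundary cycle: there is a map `φ` of the closed unit disk
into `M` that carries the open disk homeomorphically onto `U`, and that carries the unit circle,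
divided into `w.len` equal arcs, successively along the edges of `w`. -/
def IsBoundaryCycle (E : GraphEmbedding G M) (U : Set M) (w : ClosedWalk G) : Prop :=
  ∃ φ : ℂ → M, ContinuousOn φ (Metric.closedBall 0 1) ∧
    IsEmbedding ((Metric.ball (0 : ℂ) 1).domRestrict φ) ∧
    φ '' Metric.ball 0 1 = U ∧
    ∀ (i : ZMod w.len) (t : unitInterval),
      φ (Complex.exp
        (2 * (Real.pi : ℂ) * Complex.I * (((i.val : ℝ) + (t : ℝ)) / (w.len : ℝ) : ℝ))) =
        E.arc (w.adj i) t

end GraphEmbedding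

/-- `p` is a vertex of the standard cube `[0,1]^d`. -/
def IsCubeVertex {d : ℕ} (p : Fin d → unitInterval) : Prop :=
  ∀ k, p k = 0 ∨ p k = 1

/-- The faces of the standard cube `[0,1]^d` (the empty one included): fix the coordinates in a set
`S` to the values 0 or 1 prescribed by a vertex `p`. -/
def IsCubeFace {d : ℕ} (F : Set (Fin d → unitInterval)) : Prop :=
  F = ∅ ∨ ∃ (S : Set (Fin d)) (p : Fin d → unitInterval),
    IsCubeVertex p ∧ F = {x | ∀ k ∈ S, x k = p k}

/-- A finite cube complex in `X`, pure of dimension `d`, given by its facets: topological `d`-cubes,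
distinct ones being distinct as sets, such that the intersection of any two of them is a face of
both. (The lower-dimensional cubes are the faces of the facets; as two faces of the standard cube
meet in a face, the intersection of any two of these is then a face of both as well.) -/
structure CubeComplex (d : ℕ) (X : Type*) [TopologicalSpace X] where
  facets : Set ((Fin d → unitInterval) → X)
  finite : facets.Finite
  isEmbedding : ∀ q ∈ facets, IsEmbedding q
  eq_of_range_eq : ∀ q ∈ facets, ∀ q' ∈ facets, range q = range q' → q = q'
  inter : ∀ q ∈ facets, ∀ q' ∈ facets, ∃ F F' : Set (Fin d → unitInterval),
    IsCubeFace F ∧ IsCubeFace F' ∧ range q ∩ range q' = q '' F ∧ range q ∩ range q' = q' '' F'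

namespace CubeComplex

variable {d : ℕ} {X : Type*} [TopologicalSpace X]

/-- The union of the cubes. -/
def space (K : CubeComplex d X) : Set X :=
  {x | ∃ q ∈ K.facets, x ∈ range q}

/-- The vertices of the complex, as points of `X`. -/
def vertices (K : CubeComplex d X) : Set X :=
  {x | ∃ q ∈ K.facets, ∃ p, IsCubeVertex p ∧ q p = x}

/-- The edges of the complex, as subsets of `X`. -/
def edges (K : CubeComplex d X) : Set (Set X) :=
  {e | ∃ q ∈ K.facets, ∃ (k : Fin d) (p : Fin d → unitInterval),
    IsCubeVertex p ∧ e = q '' {x | ∀ k', k' ≠ k → x k' = p k'}}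

/-- The cube complex is all of `X` and refines the embedded graph: vertices of the graph are vertices
of the complex, and every edge of the graph is a union of edges of the complex. -/
def Refines {V : Type*} {G : SimpleGraph V} (K : CubeComplex d X) (E : GraphEmbedding G X) : Prop :=
  K.space = univ ∧ (∀ v, E.vert v ∈ K.vertices) ∧
    ∀ (u v : V) (h : G.Adj u v), ∃ S ⊆ K.edges, range (E.arc h) = ⋃₀ S

end CubeComplex

/-! Every face is subdivided on its own, and the pieces are glued along the graph. Fix a proper
two-colouring of `G` and assign one colour `κ` to the even faces and the other to the odd ones. A
boundary cycle of length at least 6 is cut at vertices of colour `κ` into `k ≥ 3` simple paths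
("slots"), all of even length. Each slot gets an apex in the face; the apex and three consecutive
vertices `p, p + 1, p + 2` of the slot, with `p` of colour `κ`, span a fan square. The middle of the
face is filled by one kite at each cut, one core square for each slot, `k` inner vertices and a
centre, so there are `2 * k + 1` new vertices. Cycles of length 4 contradict (I). A cycle of length
2 runs along one edge and back; its face closes up to a sphere and is subdivided like the surface of
a 3-cube (`GraphEmbedding.exists_cubeFaceQuad`).

That squares meet in common faces is reduced to labels (`exists_cubeComplex_of_squares`). A point of
one square lies in another exactly when the second has all corner labels of the smallest face of the
first through that point, so it suffices that no two squares share a diagonal. Diagonals with a new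
end stay within one face and are told apart by `k ≥ 3` and the simplicity of the slots. A diagonal
with two old ends is a pair `{p, p + 2}` of colour `κ`: faces of different parity use different
colours, and for equal parity (I) says that the pair determines the face and the position.

To obtain the slots, each given cut at a vertex of the wrong colour is replaced by cuts at its two
neighbours, and three cuts are added (`ClosedWalk.exists_cutSeq`). A slot is then part of a given
simple path or has two edges around an old cut, where (II) applies. With `n ≥ 1` given cuts in a
face, `k ≤ 2 * n + 3` and `2 * k + 1 ≤ 11 * n`; summing over the faces and using (III) gives `C = 11
* c`.

The squares cover `M` because the closures of the faces do: an arc has empty interior in a surface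
(`Path.dense_compl_range`). -/

/-! ### The graph has empty interior, so the closed faces cover the surface. -/

/-- One-dimensional Borsuk–Ulam: the difference of the values of `f` at antipodal points is an odd
function on a connected circle, so it vanishes somewhere. -/
theorem not_injOn_sphere_of_continuousOn {f : EuclideanSpace ℝ (Fin 2) → ℝ}
    {c : EuclideanSpace ℝ (Fin 2)} {r : ℝ} (hr : 0 < r)
    (hf : ContinuousOn f (Metric.sphere c r)) : ¬ InjOn f (Metric.sphere c r) := by
  intro hinj
  have hrank : 1 < Module.rank ℝ (EuclideanSpace ℝ (Fin 2)) := by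
    rw [← Module.finrank_eq_rank, finrank_euclideanSpace_fin]; norm_num
  have hS := isConnected_sphere hrank (0 : EuclideanSpace ℝ (Fin 2)) hr.le
  have h1 : MapsTo (fun x => c + x) (Metric.sphere 0 r) (Metric.sphere c r) := by
    intro x hx; simpa using hx
  have h2 : MapsTo (fun x => c - x) (Metric.sphere 0 r) (Metric.sphere c r) := by
    intro x hx; simpa [Metric.mem_sphere, dist_eq_norm] using hx
  have hg : ContinuousOn (fun x => f (c + x) - f (c - x)) (Metric.sphere 0 r) :=
    (hf.comp (by fun_prop) h1).sub (hf.comp (by fun_prop) h2)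
  obtain ⟨x, hx⟩ := hS.nonempty
  have hx' : -x ∈ Metric.sphere (0 : EuclideanSpace ℝ (Fin 2)) r := by simpa using hx
  have hzero : ∃ y ∈ Metric.sphere (0 : EuclideanSpace ℝ (Fin 2)) r,
      f (c + y) - f (c - y) = 0 := by
    have hpre := hS.isPreconnected.image _ hg
    have hord := hpre.ordConnected
    have ha : f (c + x) - f (c - x) ∈ (fun x => f (c + x) - f (c - x)) '' Metric.sphere 0 r :=
      ⟨x, hx, rfl⟩
    have hb : -(f (c + x) - f (c - x)) ∈
        (fun x => f (c + x) - f (c - x)) '' Metric.sphere 0 r :=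
      ⟨-x, hx', by simp only [sub_neg_eq_add, ← sub_eq_add_neg]; ring⟩
    rcases le_total 0 (f (c + x) - f (c - x)) with h | h
    · obtain ⟨y, hy, hy'⟩ := hord.out hb ha ⟨by linarith, h⟩
      exact ⟨y, hy, hy'⟩
    · obtain ⟨y, hy, hy'⟩ := hord.out ha hb ⟨h, by linarith⟩
      exact ⟨y, hy, hy'⟩
  obtain ⟨y, hy, hy0⟩ := hzero
  have := hinj (h1 hy) (h2 hy) (sub_eq_zero.1 hy0)
  have hyy : y = -y := by
    have h3 : c + y = c - y := this
    rw [sub_eq_add_neg] at h3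
    exact add_left_cancel h3
  have : y = 0 := by
    have h4 : (2 : ℝ) • y = 0 := by rw [two_smul]; nth_rewrite 1 [hyy]; exact neg_add_cancel y
    exact (smul_eq_zero.1 h4).resolve_left two_ne_zero
  rw [this] at hy
  simp at hy
  exact hr.ne hy

/-- A nonempty open set contains the image of a small circle under an inverse chart, and no
continuous real function is injective on it. This does the work of invariance of domain for arcs in
a surface. -/
theorem eq_empty_of_isOpen_of_injOn_real {M : Type*} [TopologicalSpace M]
    [ChartedSpace (EuclideanSpace ℝ (Fin 2)) M] {W : Set M} (hW : IsOpen W) {g : M → ℝ}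
    (hg : ContinuousOn g W) (hinj : InjOn g W) : W = ∅ := by
  by_contra hne
  obtain ⟨x, hx⟩ := nonempty_iff_ne_empty.2 hne
  set e := chartAt (EuclideanSpace ℝ (Fin 2)) x
  have hxe : x ∈ e.source := mem_chart_source _ x
  have hopen : IsOpen (e.target ∩ e.symm ⁻¹' W) := e.isOpen_inter_preimage_symm hW
  have hmem : e x ∈ e.target ∩ e.symm ⁻¹' W := by
    refine ⟨e.map_source hxe, ?_⟩
    simpa [e.left_inv hxe] using hx
  obtain ⟨ε, hε, hball⟩ := Metric.isOpen_iff.1 hopen _ hmem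
  have hsub : Metric.sphere (e x) (ε / 2) ⊆ e.target ∩ e.symm ⁻¹' W := fun y hy =>
    hball (by rw [Metric.mem_ball]; rw [Metric.mem_sphere] at hy; linarith)
  refine not_injOn_sphere_of_continuousOn (f := g ∘ e.symm) (c := e x) (half_pos hε) ?_ ?_
  · exact hg.comp (e.continuousOn_symm.mono fun y hy => (hsub hy).1) fun y hy => (hsub hy).2
  · exact hinj.comp (e.symm.injOn.mono fun y hy => (hsub hy).1) fun y hy => (hsub hy).2

/-- The inverse of a simple arc is a continuous injective real function on the arc, hence on its
interior, which must therefore be empty. -/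
theorem Path.dense_compl_range {M : Type*} [TopologicalSpace M] [T2Space M]
    [ChartedSpace (EuclideanSpace ℝ (Fin 2)) M] {x y : M} (γ : Path x y)
    (hγ : Function.Injective γ) : Dense (range γ)ᶜ := by
  rw [← interior_eq_empty_iff_dense_compl]
  have hemb : IsEmbedding γ := (γ.continuous.isClosedEmbedding hγ).isEmbedding
  have hinv : ∀ z ∈ range γ, γ (Function.invFun (⇑γ : unitInterval → M) z) = z :=
    fun z hz => Function.invFun_eq hz
  refine eq_empty_of_isOpen_of_injOn_real isOpen_interior
    (g := fun z => ((Function.invFun (⇑γ : unitInterval → M) z : unitInterval) : ℝ)) ?_ ?_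
  · refine ContinuousOn.mono ?_ interior_subset
    refine continuous_subtype_val.comp_continuousOn ?_
    rw [hemb.isInducing.continuousOn_iff]
    exact continuousOn_id.congr hinv
  · intro z hz z' hz' h
    rw [← hinv z (interior_subset hz), ← hinv z' (interior_subset hz'), Subtype.ext h]

theorem dense_compl_singleton_of_surface {M : Type*} [TopologicalSpace M]
    [ChartedSpace (EuclideanSpace ℝ (Fin 2)) M] (x : M) : Dense ({x}ᶜ : Set M) := by
  rw [← interior_eq_empty_iff_dense_compl]
  refine eq_empty_of_isOpen_of_injOn_real isOpen_interior (g := fun _ => (0 : ℝ))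
    continuousOn_const ?_
  intro z hz z' hz' _
  rw [mem_singleton_iff.1 (interior_subset hz), mem_singleton_iff.1 (interior_subset hz')]

namespace GraphEmbedding

variable {V : Type*} {G : SimpleGraph V} {M : Type*} [TopologicalSpace M]

theorem dense_compl_image [Finite V] [T2Space M] [CompactSpace M]
    [ChartedSpace (EuclideanSpace ℝ (Fin 2)) M] (E : GraphEmbedding G M) : Dense E.imageᶜ := by
  have h1 : Dense (⋂ v : V, ({E.vert v}ᶜ : Set M)) :=
    dense_iInter_of_isOpen (fun v => isOpen_compl_singleton)
      fun v => dense_compl_singleton_of_surface _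
  have h2 : Dense (⋂ p : {p : V × V // G.Adj p.1 p.2}, (range (E.arc p.2))ᶜ) :=
    dense_iInter_of_isOpen
      (fun p => (isCompact_range (E.arc p.2).continuous).isClosed.isOpen_compl)
      fun p => (E.arc p.2).dense_compl_range (E.arc_injective p.2)
  have hopen : IsOpen (⋂ v : V, ({E.vert v}ᶜ : Set M)) :=
    isOpen_iInter_of_finite fun v => isOpen_compl_singleton
  refine (h1.inter_of_isOpen_left h2 hopen).mono ?_
  rintro x ⟨hx1, hx2⟩ hx
  rcases hx with ⟨v, rfl⟩ | ⟨u, v, h, hx⟩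
  · exact mem_iInter.1 hx1 v rfl
  · exact mem_iInter.1 hx2 ⟨(u, v), h⟩ hx

/-- With finitely many faces the union of the closures is the closure of the union, and the union is
the dense complement of the graph. -/
theorem iUnion_closure_face [Finite V] [T2Space M] [CompactSpace M]
    [ChartedSpace (EuclideanSpace ℝ (Fin 2)) M] (E : GraphEmbedding G M) [Finite E.Face] :
    ⋃ U : E.Face, closure U.1 = univ := by
  rw [← closure_iUnion_of_finite, ← E.dense_compl_image.closure_eq]
  refine Subset.antisymm ?_ (closure_mono fun x hx => ?_)
  · rw [E.dense_compl_image.closure_eq]; exact subset_univ _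
  · exact mem_iUnion.2 ⟨⟨_, x, hx, rfl⟩, mem_connectedComponentIn hx⟩

theorem Face.disjoint_image {E : GraphEmbedding G M} (U : E.Face) {x : M} (hx : x ∈ U.1) :
    x ∉ E.image := by
  obtain ⟨_, y, _, rfl⟩ := U
  exact connectedComponentIn_subset _ _ hx

theorem Face.eq_of_mem {E : GraphEmbedding G M} {U U' : E.Face} {x : M} (hx : x ∈ U.1)
    (hx' : x ∈ U'.1) : U = U' := by
  obtain ⟨_, y, _, rfl⟩ := U
  obtain ⟨_, y', _, rfl⟩ := U'
  exact Subtype.ext ((connectedComponentIn_eq hx).trans (connectedComponentIn_eq hx').symm)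

end GraphEmbedding

/-! ### Labelled squares: carriers, faces of the square and two-colourings of corners. -/

/-- The end point of the unit interval named by a Boolean. -/
def endpt (β : Bool) : unitInterval := bif β then 1 else 0

/-- The end point `β` belongs to the smallest face of the unit interval that contains `a`. -/
def Near (a : unitInterval) (β : Bool) : Prop := a ≠ endpt (!β)

/-- The labels of the corners of the smallest face of a labelled square that contains `(a, b)`. -/
def carrier {Λ : Type*} (lab : Bool → Bool → Λ) (a b : unitInterval) : Set Λ :=
  {l | ∃ β γ, Near a β ∧ Near b γ ∧ lab β γ = l}

theorem endpt_ne (β : Bool) : endpt β ≠ endpt (!β) := by cases β <;> simp [endpt]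

theorem near_endpt_iff {β γ : Bool} : Near (endpt β) γ ↔ γ = β := by
  cases β <;> cases γ <;> simp [Near, endpt]

theorem near_or_near (a : unitInterval) (β : Bool) : Near a β ∨ Near a (!β) := by
  by_contra h
  simp only [Near, not_or, not_not, Bool.not_not] at h
  exact endpt_ne β (h.2.symm.trans h.1)

theorem exists_near (a : unitInterval) : ∃ β, Near a β :=
  (near_or_near a true).elim (fun h => ⟨_, h⟩) fun h => ⟨_, h⟩

theorem eq_endpt_of_not_near {a : unitInterval} {β : Bool} (h : ¬ Near a β) : a = endpt (!β) :=
  not_not.1 h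

theorem near_all_or_eq_endpt (a : unitInterval) : (∀ β, Near a β) ∨ ∃ β, a = endpt β := by
  by_cases h : ∀ β, Near a β
  · exact Or.inl h
  · push Not at h
    obtain ⟨β, hβ⟩ := h
    exact Or.inr ⟨_, eq_endpt_of_not_near hβ⟩

theorem carrier_endpt {Λ : Type*} (lab : Bool → Bool → Λ) (β γ : Bool) :
    carrier lab (endpt β) (endpt γ) = {lab β γ} := by
  ext l
  simp only [carrier, near_endpt_iff, mem_ofPred_eq, mem_singleton_iff]
  constructor
  · rintro ⟨_, _, rfl, rfl, rfl⟩; rfl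
  · rintro rfl; exact ⟨_, _, rfl, rfl, rfl⟩

/-- A set of corners of a square without a diagonal pair is empty, one corner or the two ends of a
side, hence the corner set of a face. The points whose smallest face has all corners in the set form
exactly that face. -/
theorem isCubeFace_setOf_near {C : Bool → Bool → Prop}
    (hC : ∀ β γ, C β γ → ¬ C (!β) (!γ)) :
    IsCubeFace {x : Fin 2 → unitInterval | ∀ β γ, Near (x 0) β → Near (x 1) γ → C β γ} := by
  by_cases h0 : ∀ β γ, ¬ C β γ
  · left
    refine eq_empty_of_forall_notMem fun x hx => ?_
    obtain ⟨β, hβ⟩ := exists_near (x 0)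
    obtain ⟨γ, hγ⟩ := exists_near (x 1)
    exact h0 _ _ (hx β γ hβ hγ)
  · push Not at h0
    obtain ⟨β, γ, hβγ⟩ := h0
    have hopp := hC _ _ hβγ
    right
    have hv : IsCubeVertex (![endpt β, endpt γ] : Fin 2 → unitInterval) := by
      intro k
      fin_cases k
      · cases β <;> simp [endpt]
      · cases γ <;> simp [endpt]
    -- A point near the value `!β` has one of the corners `(!β, γ)`, `(!β, !γ)` in its carrier, and
    -- neither belongs to `C`.
    have key0 : ∀ x : Fin 2 → unitInterval,
        (∀ β γ, Near (x 0) β → Near (x 1) γ → C β γ) → ¬ C (!β) γ → x 0 = endpt β := by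
      intro x hx h
      by_contra hne
      have hn : Near (x 0) (!β) := by simpa [Near] using hne
      rcases near_or_near (x 1) γ with h1 | h1
      · exact h (hx _ _ hn h1)
      · exact hopp (hx _ _ hn h1)
    have key1 : ∀ x : Fin 2 → unitInterval,
        (∀ β γ, Near (x 0) β → Near (x 1) γ → C β γ) → ¬ C β (!γ) → x 1 = endpt γ := by
      intro x hx h
      by_contra hne
      have hn : Near (x 1) (!γ) := by simpa [Near] using hne
      rcases near_or_near (x 0) β with h1 | h1
      · exact h (hx _ _ h1 hn)
      · exact hopp (hx _ _ h1 hn)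
    by_cases h1 : C (!β) γ
    · have h2 : ¬ C β (!γ) := by simpa using hC _ _ h1
      refine ⟨{1}, _, hv, ?_⟩
      ext x
      simp only [mem_ofPred_eq, mem_singleton_iff, forall_eq]
      refine ⟨fun hx => key1 x hx h2, fun hx β' γ' _ hγ' => ?_⟩
      rw [hx] at hγ'
      obtain rfl := near_endpt_iff.1 hγ'
      rcases Bool.eq_or_eq_not β' β with rfl | rfl
      exacts [hβγ, h1]
    · by_cases h2 : C β (!γ)
      · refine ⟨{0}, _, hv, ?_⟩
        ext x
        simp only [mem_ofPred_eq, mem_singleton_iff, forall_eq]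
        refine ⟨fun hx => key0 x hx h1, fun hx β' γ' hβ' _ => ?_⟩
        rw [hx] at hβ'
        obtain rfl := near_endpt_iff.1 hβ'
        rcases Bool.eq_or_eq_not γ' γ with rfl | rfl
        exacts [hβγ, h2]
      · refine ⟨univ, _, hv, ?_⟩
        ext x
        simp only [mem_ofPred_eq, mem_univ, true_imp_iff, Fin.forall_fin_two]
        refine ⟨fun hx => ⟨key0 x hx h1, key1 x hx h2⟩, fun hx β' γ' hβ' hγ' => ?_⟩
        rw [hx.1] at hβ'
        rw [hx.2] at hγ'
        obtain rfl := near_endpt_iff.1 hβ'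
        obtain rfl := near_endpt_iff.1 hγ'
        exact hβγ

/-- The corners of a labelled square are properly two-coloured. -/
def Alternates {Λ : Type*} (col : Λ → Bool) (lab : Bool → Bool → Λ) : Prop :=
  ∀ β γ, col (lab (!β) γ) = !col (lab β γ) ∧ col (lab β (!γ)) = !col (lab β γ)

/-- The colouring recovers relative position from labels: corners of equal colour are equal or
opposite, so distinct labels force them to be opposite. -/
theorem Alternates.eq_opp {Λ : Type*} {col : Λ → Bool} {lab : Bool → Bool → Λ}
    (h : Alternates col lab) {β γ β' γ' : Bool}
    (hcol : col (lab β γ) = col (lab β' γ')) (hne : lab β γ ≠ lab β' γ') :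
    β' = !β ∧ γ' = !γ := by
  rcases Bool.eq_or_eq_not β' β with rfl | rfl <;> rcases Bool.eq_or_eq_not γ' γ with rfl | rfl
  · exact absurd rfl hne
  · rw [(h _ _).2] at hcol; simp at hcol
  · rw [(h _ _).1] at hcol; simp at hcol
  · exact ⟨rfl, rfl⟩

theorem Alternates.eq_adj {Λ : Type*} {col : Λ → Bool} {lab : Bool → Bool → Λ}
    (h : Alternates col lab) {β γ β' γ' : Bool}
    (hcol : col (lab β γ) ≠ col (lab β' γ')) :
    (β' = !β ∧ γ' = γ) ∨ (β' = β ∧ γ' = !γ) := by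
  rcases Bool.eq_or_eq_not β' β with rfl | rfl <;> rcases Bool.eq_or_eq_not γ' γ with rfl | rfl
  · exact absurd rfl hcol
  · exact Or.inr ⟨rfl, rfl⟩
  · exact Or.inl ⟨rfl, rfl⟩
  · rw [(h _ _).1, (h _ _).2] at hcol; simp at hcol

theorem Alternates.col_opp {Λ : Type*} {col : Λ → Bool} {lab : Bool → Bool → Λ}
    (h : Alternates col lab) (β γ : Bool) : col (lab (!β) (!γ)) = col (lab β γ) := by
  rw [(h _ _).1, (h _ _).2, Bool.not_not]

/-! ### Gluing labelled squares to a cube complex. -/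

section Gluing

variable {M : Type*} [TopologicalSpace M] [T2Space M] {ι Λ : Type*}

/-- Opposite corners of square `i` have the same colour and different labels. If both labels occur
in square `j`, they are again at opposite corners, and a diagonal determines its square. -/
theorem not_opp_mem_range {lab : ι → Bool → Bool → Λ} {col : Λ → Bool}
    (hcol : ∀ i, Alternates col (lab i)) (hne : ∀ i β γ, lab i β γ ≠ lab i (!β) (!γ))
    (hdiag : ∀ i j β γ β' γ', lab i β γ = lab j β' γ' →
      lab i (!β) (!γ) = lab j (!β') (!γ') → i = j)
    {i j : ι} (hij : i ≠ j) (β γ : Bool)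
    (h : ∃ β' γ', lab j β' γ' = lab i β γ) : ¬ ∃ β' γ', lab j β' γ' = lab i (!β) (!γ) := by
  rintro ⟨β₂, γ₂, h₂⟩
  obtain ⟨β₁, γ₁, h₁⟩ := h
  obtain ⟨rfl, rfl⟩ := (hcol j).eq_opp (β := β₁) (γ := γ₁) (β' := β₂) (γ' := γ₂)
    (by rw [h₁, h₂, (hcol i).col_opp]) (by rw [h₁, h₂]; exact hne i β γ)
  exact hij (hdiag i j β γ β₁ γ₁ h₁.symm h₂.symm)

/-- By `hmem` the intersection of squares `i` and `j` is cut out in square `i` by the condition that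
all labels of the carrier occur in `j`. The labels shared by both contain no diagonal of either, so
`isCubeFace_setOf_near` makes the intersection a face of each. -/
theorem exists_cubeComplex_of_squares [Finite ι] (q : ι → unitInterval → unitInterval → M)
    (lab : ι → Bool → Bool → Λ) (col : Λ → Bool)
    (hcont : ∀ i, Continuous fun x : unitInterval × unitInterval => q i x.1 x.2)
    (hinj : ∀ i a b a' b', q i a b = q i a' b' → a = a' ∧ b = b')
    (hcol : ∀ i, Alternates col (lab i)) (hne : ∀ i β γ, lab i β γ ≠ lab i (!β) (!γ))
    (hdiag : ∀ i j β γ β' γ', lab i β γ = lab j β' γ' →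
      lab i (!β) (!γ) = lab j (!β') (!γ') → i = j)
    (hmem : ∀ i j, i ≠ j → ∀ a b, (∃ a' b', q j a' b' = q i a b) ↔
      ∀ l ∈ carrier (lab i) a b, ∃ β γ, lab j β γ = l) :
    ∃ K : CubeComplex 2 M, K.facets = range fun i x => q i (x 0) (x 1) := by
  have hrange : ∀ i (y : M), y ∈ range (fun x : Fin 2 → unitInterval => q i (x 0) (x 1)) ↔
      ∃ a b, q i a b = y := fun i y =>
    ⟨fun ⟨x, hx⟩ => ⟨_, _, hx⟩, fun ⟨a, b, h⟩ => ⟨![a, b], h⟩⟩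
  have hopp := fun i j => not_opp_mem_range (i := i) (j := j) hcol hne hdiag
  have hface : ∀ i j, i ≠ j → range (fun x : Fin 2 → unitInterval => q i (x 0) (x 1)) ∩
      range (fun x : Fin 2 → unitInterval => q j (x 0) (x 1)) =
      (fun x : Fin 2 → unitInterval => q i (x 0) (x 1)) ''
        {x | ∀ β γ, Near (x 0) β → Near (x 1) γ → ∃ β' γ', lab j β' γ' = lab i β γ} := by
    intro i j hij
    ext y
    constructor
    · rintro ⟨⟨x, rfl⟩, hy⟩
      rw [hrange] at hy
      refine ⟨x, fun β γ hβ hγ => ?_, rfl⟩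
      exact (hmem i j hij _ _).1 hy _ ⟨β, γ, hβ, hγ, rfl⟩
    · rintro ⟨x, hx, rfl⟩
      refine ⟨⟨x, rfl⟩, ?_⟩
      rw [hrange]
      refine (hmem i j hij _ _).2 ?_
      rintro l ⟨β, γ, hβ, hγ, rfl⟩
      exact hx β γ hβ hγ
  refine ⟨⟨range fun i x => q i (x 0) (x 1), finite_range _, ?_, ?_, ?_⟩, rfl⟩
  · rintro _ ⟨i, rfl⟩
    have hc : Continuous fun x : Fin 2 → unitInterval => q i (x 0) (x 1) :=
      (hcont i).comp (f := fun x : Fin 2 → unitInterval => (x 0, x 1)) (by fun_prop)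
    refine (hc.isClosedEmbedding ?_).isEmbedding
    intro x y hxy
    obtain ⟨h0, h1⟩ := hinj i _ _ _ _ hxy
    funext k
    fin_cases k
    exacts [h0, h1]
  · rintro _ ⟨i, rfl⟩ _ ⟨j, rfl⟩ h
    by_cases hij : i = j
    · rw [hij]
    · exfalso
      -- Squares with the same range would share all labels, in particular a diagonal.
      have hall : ∀ β γ, ∃ β' γ', lab j β' γ' = lab i β γ := by
        intro β γ
        refine (hmem i j hij (endpt β) (endpt γ)).1 ?_ _ (by rw [carrier_endpt]; rfl)
        rw [← hrange, ← h]
        exact ⟨![endpt β, endpt γ], rfl⟩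
      exact hopp i j hij true true (hall _ _) (hall _ _)
  · rintro _ ⟨i, rfl⟩ _ ⟨j, rfl⟩
    by_cases hij : i = j
    · subst hij
      refine ⟨univ, univ, ?_, ?_, by simp, by simp⟩ <;>
        exact Or.inr ⟨∅, fun _ => 0, fun _ => Or.inl rfl, by simp⟩
    · refine ⟨_, _, ?_, ?_, hface i j hij, by rw [inter_comm]; exact hface j i (Ne.symm hij)⟩
      · exact isCubeFace_setOf_near fun β γ => hopp i j hij β γ
      · exact isCubeFace_setOf_near fun β γ => hopp j i (Ne.symm hij) β γ

end Gluing

/-! ### Gluing the subdivisions of the faces along the graph. -/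

namespace GraphEmbedding

variable {V : Type*} {G : SimpleGraph V} {M : Type*} [TopologicalSpace M]

/-- `S` is the set of end points of the smallest cell of the embedded graph that contains `x`. -/
def IsCarrier (E : GraphEmbedding G M) (x : M) (S : Set V) : Prop :=
  (∃ v, x = E.vert v ∧ S = {v}) ∨
    ∃ (u v : V) (h : G.Adj u v) (t : unitInterval), t ≠ 0 ∧ t ≠ 1 ∧ x = E.arc h t ∧ S = {u, v}

theorem IsCarrier.unique {E : GraphEmbedding G M} {x : M} {S S' : Set V} (h : E.IsCarrier x S)
    (h' : E.IsCarrier x S') : S = S' := by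
  rcases h with ⟨v, rfl, rfl⟩ | ⟨u, v, h, t, h0, h1, rfl, rfl⟩ <;>
    rcases h' with ⟨v', hx, rfl⟩ | ⟨u', v', h', t', h0', h1', hx, rfl⟩
  · rw [E.vert_injective hx]
  · exact absurd hx.symm (E.arc_ne_vert h' t' v h0' h1')
  · exact absurd hx (E.arc_ne_vert h t v' h0 h1)
  · by_cases he : s(u, v) = s(u', v')
    · rcases Sym2.eq_iff.1 he with ⟨rfl, rfl⟩ | ⟨rfl, rfl⟩
      · rfl
      · exact pair_comm _ _
    · exact absurd hx (E.arc_ne_arc h h' t t' he h0 h1)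

theorem IsCarrier.mem_image {E : GraphEmbedding G M} {x : M} {S : Set V}
    (h : E.IsCarrier x S) : x ∈ E.image := by
  rcases h with ⟨v, rfl, rfl⟩ | ⟨u, v, h, t, h0, h1, rfl, rfl⟩
  · exact Or.inl ⟨v, rfl⟩
  · exact Or.inr ⟨u, v, h, t, rfl⟩

theorem isCarrier_vert (E : GraphEmbedding G M) (v : V) : E.IsCarrier (E.vert v) {v} :=
  Or.inl ⟨v, rfl, rfl⟩

theorem range_arc_eq {E : GraphEmbedding G M} {u v u' v' : V} (h : G.Adj u v) (h' : G.Adj u' v')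
    (he : s(u, v) = s(u', v')) : range (E.arc h) = range (E.arc h') := by
  rcases Sym2.eq_iff.1 he with ⟨rfl, rfl⟩ | ⟨rfl, rfl⟩
  · rfl
  · rw [E.arc_symm h', Path.symm_range]

/-- A subdivision into labelled squares of the closure of a face `U` with boundary cycle `w`. The
corners are labelled by vertices of `G` and by new labels from `N`; two opposite corners that are
both vertices of `G` have the colour `κ` and are at distance two along `w`. -/
structure FaceQuad (E : GraphEmbedding G M) (col : V → Bool) (κ : Bool) (U : Set M)
    (w : ClosedWalk G) where
  ι : Type
  N : Type
  finite_ι : Finite ι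
  fintype_N : Fintype N
  q : ι → unitInterval → unitInterval → M
  lab : ι → Bool → Bool → V ⊕ N
  npos : N → M
  ncol : N → Bool
  pos : ι → ZMod w.len
  cont : ∀ i, Continuous fun x : unitInterval × unitInterval => q i x.1 x.2
  inj : ∀ i a b a' b', q i a b = q i a' b' → a = a' ∧ b = b'
  corner : ∀ i β γ, q i (endpt β) (endpt γ) = Sum.elim E.vert npos (lab i β γ)
  alternates : ∀ i, Alternates (Sum.elim col ncol) (lab i)
  lab_ne : ∀ i β γ, lab i β γ ≠ lab i (!β) (!γ)
  -- A diagonal with a new end can be controlled within the face. One with two old ends might recur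
  -- in another face; `diag_old` and `diag_pos` translate that case to positions on the boundary
  -- cycle, where condition (I) applies.
  diag : ∀ i j β γ β' γ', (∀ u v, lab i β γ = Sum.inl u → lab i (!β) (!γ) ≠ Sum.inl v) →
    lab i β γ = lab j β' γ' → lab i (!β) (!γ) = lab j (!β') (!γ') → i = j
  diag_old : ∀ i β γ u v, lab i β γ = Sum.inl u → lab i (!β) (!γ) = Sum.inl v →
    col u = κ ∧ s(u, v) = w.outerPair (pos i)
  diag_pos : ∀ i j β γ u v β' γ' u' v', lab i β γ = Sum.inl u → lab i (!β) (!γ) = Sum.inl v →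
    lab j β' γ' = Sum.inl u' → lab j (!β') (!γ') = Sum.inl v' → pos i = pos j → i = j
  loc : ∀ i a b, (q i a b ∈ U ∧ ∃ n, Sum.inr n ∈ carrier (lab i) a b) ∨
    ∃ S, E.IsCarrier (q i a b) S ∧ carrier (lab i) a b = Sum.inl '' S
  -- Only points of the open face are treated here. For points on the graph the same criterion
  -- follows from `loc` and the two edge conditions, also between squares of different faces.
  mem : ∀ i j, i ≠ j → ∀ a b, q i a b ∈ U → ((∃ a' b', q j a' b' = q i a b) ↔
      ∀ l ∈ carrier (lab i) a b, ∃ β γ, lab j β γ = l)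
  edge_fst : ∀ i γ u v, lab i false γ = Sum.inl u → lab i true γ = Sum.inl v →
    ∃ h : G.Adj u v, range (E.arc h) = range fun a => q i a (endpt γ)
  edge_snd : ∀ i β u v, lab i β false = Sum.inl u → lab i β true = Sum.inl v →
    ∃ h : G.Adj u v, range (E.arc h) = range fun b => q i (endpt β) b
  cover : ∀ x ∈ closure U, ∃ i a b, q i a b = x

namespace FaceQuad

variable {E : GraphEmbedding G M} {col : V → Bool} {κ : Bool} {U : Set M} {w : ClosedWalk G}

/-- Adjacent vertices differ in colour, so as labels of one square they sit at the ends of a side,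
and that side is the arc between them. -/
theorem range_arc_of_labels (Q : FaceQuad E col κ U w) (hcolG : ∀ u v, G.Adj u v → col u ≠ col v)
    {i : Q.ι} {β γ β' γ' : Bool} {u v : V} (h : G.Adj u v) (hu : Q.lab i β γ = Sum.inl u)
    (hv : Q.lab i β' γ' = Sum.inl v) :
    (∃ δ, range (E.arc h) = range fun a => Q.q i a (endpt δ)) ∨
      ∃ δ, range (E.arc h) = range fun b => Q.q i (endpt δ) b := by
  have hne : Sum.elim col Q.ncol (Q.lab i β γ) ≠ Sum.elim col Q.ncol (Q.lab i β' γ') := by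
    rw [hu, hv]; exact hcolG u v h
  rcases (Q.alternates i).eq_adj hne with ⟨rfl, rfl⟩ | ⟨rfl, rfl⟩
  · left
    refine ⟨γ', ?_⟩
    cases β
    · obtain ⟨h', e⟩ := Q.edge_fst i γ' u v hu hv
      rw [← e]
    · obtain ⟨h', e⟩ := Q.edge_fst i γ' v u hv hu
      rw [← e]; exact range_arc_eq _ _ Sym2.eq_swap
  · right
    refine ⟨β', ?_⟩
    cases γ
    · obtain ⟨h', e⟩ := Q.edge_snd i β' u v hu hv
      rw [← e]
    · obtain ⟨h', e⟩ := Q.edge_snd i β' v u hv hu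
      rw [← e]; exact range_arc_eq _ _ Sym2.eq_swap

theorem mem_range_of_isCarrier (Q : FaceQuad E col κ U w)
    (hcolG : ∀ u v, G.Adj u v → col u ≠ col v) {i : Q.ι} {x : M} {S : Set V}
    (hx : E.IsCarrier x S) (hS : ∀ v ∈ S, ∃ β γ, Q.lab i β γ = Sum.inl v) :
    ∃ a b, Q.q i a b = x := by
  rcases hx with ⟨v, rfl, rfl⟩ | ⟨u, v, h, t, h0, h1, rfl, rfl⟩
  · obtain ⟨β, γ, hl⟩ := hS v rfl
    exact ⟨endpt β, endpt γ, by rw [Q.corner, hl]; rfl⟩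
  · obtain ⟨β, γ, hu⟩ := hS u (Or.inl rfl)
    obtain ⟨β', γ', hv⟩ := hS v (Or.inr rfl)
    have hmem : E.arc h t ∈ range (E.arc h) := ⟨t, rfl⟩
    rcases Q.range_arc_of_labels hcolG h hu hv with ⟨δ, e⟩ | ⟨δ, e⟩
    · rw [e] at hmem
      obtain ⟨a, ha⟩ := hmem
      exact ⟨_, _, ha⟩
    · rw [e] at hmem
      obtain ⟨a, ha⟩ := hmem
      exact ⟨_, _, ha⟩

end FaceQuad

end GraphEmbedding

/-- The labels of the corners of all squares: vertices of `G` and, for each face, new labels. -/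
def glueLabel {V : Type*} {F : Type*} {N : F → Type} (U : F) : V ⊕ N U → V ⊕ (Σ U, N U) :=
  Sum.map id fun n => ⟨U, n⟩

theorem glueLabel_injective {V : Type*} {F : Type*} {N : F → Type} (U : F) :
    Function.Injective (glueLabel (V := V) (N := N) U) :=
  Sum.map_injective.2 ⟨Function.injective_id, sigma_mk_injective⟩

theorem glueLabel_eq {V : Type*} {F : Type*} {N : F → Type} {U U' : F} {l : V ⊕ N U}
    {l' : V ⊕ N U'} (h : glueLabel U l = glueLabel U' l') :
    (∃ v, l = Sum.inl v ∧ l' = Sum.inl v) ∨ U = U' := by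
  rcases l with v | n <;> rcases l' with v' | n' <;> simp [glueLabel] at h
  · exact Or.inl ⟨v, rfl, by rw [h]⟩
  · exact Or.inr h.1

theorem carrier_comp {Λ Λ' : Type*} (f : Λ → Λ') (lab : Bool → Bool → Λ) (a b : unitInterval) :
    carrier (fun β γ => f (lab β γ)) a b = f '' carrier lab a b := by
  ext l
  constructor
  · rintro ⟨β, γ, hβ, hγ, rfl⟩; exact ⟨_, ⟨β, γ, hβ, hγ, rfl⟩, rfl⟩
  · rintro ⟨_, ⟨β, γ, hβ, hγ, rfl⟩, rfl⟩; exact ⟨β, γ, hβ, hγ, rfl⟩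

namespace GraphEmbedding

variable {V : Type*} {G : SimpleGraph V} {M : Type*} [TopologicalSpace M]

/-- Squares of different faces can meet only on the graph, where the carrier of a point consists of
the ends of its vertex or edge and so does not depend on the face from which it is seen. It remains
to exclude common diagonals with two old ends, which is the role of `hpair`. -/
theorem exists_cubeComplex_of_faceQuad [Fintype V] [T2Space M] (E : GraphEmbedding G M)
    [Fintype E.Face] (hU : ⋃ U : E.Face, closure U.1 = univ) (w : E.Face → ClosedWalk G)
    (col : V → Bool) (hcolG : ∀ u v, G.Adj u v → col u ≠ col v) (κ : E.Face → Bool)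
    (Q : ∀ U : E.Face, FaceQuad E col (κ U) U.1 (w U))
    (hpair : ∀ (U U' : E.Face) (i : ZMod (w U).len) (i' : ZMod (w U').len), κ U = κ U' →
      (w U).outerPair i = (w U').outerPair i' →
      (⟨U, i⟩ : (U : E.Face) × ZMod (w U).len) = ⟨U', i'⟩) :
    ∃ K : CubeComplex 2 M, K.Refines E ∧
      K.vertices.ncard ≤ Fintype.card V +
        ∑ U, letI := (Q U).fintype_N; Fintype.card (Q U).N := by
  classical
  let := fun U => (Q U).fintype_N
  have := fun U => (Q U).finite_ι
  let q : (Σ U, (Q U).ι) → unitInterval → unitInterval → M := fun i => (Q i.1).q i.2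
  let lab : (Σ U, (Q U).ι) → Bool → Bool → V ⊕ (Σ U, (Q U).N) :=
    fun i β γ => glueLabel i.1 ((Q i.1).lab i.2 β γ)
  let gcol : V ⊕ (Σ U, (Q U).N) → Bool := Sum.elim col fun n => (Q n.1).ncol n.2
  let gpos : V ⊕ (Σ U, (Q U).N) → M := Sum.elim E.vert fun n => (Q n.1).npos n.2
  have hgcol : ∀ U (l : V ⊕ (Q U).N), gcol (glueLabel U l) = Sum.elim col (Q U).ncol l := by
    rintro U (v | n) <;> rfl
  have hgpos : ∀ U (l : V ⊕ (Q U).N), gpos (glueLabel U l) = Sum.elim E.vert (Q U).npos l := by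
    rintro U (v | n) <;> rfl
  have hginj : ∀ U : E.Face,
      Function.Injective (glueLabel (V := V) (N := fun U : E.Face => (Q U).N) U) :=
    fun U => glueLabel_injective U
  have hcorner : ∀ i β γ, q i (endpt β) (endpt γ) = gpos (lab i β γ) := by
    intro i β γ
    rw [hgpos]; exact (Q i.1).corner i.2 β γ
  have hloc : ∀ i a b, (q i a b ∈ i.1.1 ∧ ∃ n, Sum.inr ⟨i.1, n⟩ ∈ carrier (lab i) a b) ∨
      ∃ S, E.IsCarrier (q i a b) S ∧ carrier (lab i) a b = Sum.inl '' S := by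
    intro i a b
    have hc : carrier (lab i) a b = glueLabel i.1 '' carrier ((Q i.1).lab i.2) a b :=
      carrier_comp _ _ _ _
    rcases (Q i.1).loc i.2 a b with ⟨h1, n, hn⟩ | ⟨S, hS, h⟩
    · exact Or.inl ⟨h1, n, by rw [hc]; exact ⟨_, hn, rfl⟩⟩
    · refine Or.inr ⟨S, hS, ?_⟩
      rw [hc, h, image_image]; rfl
  obtain ⟨K, hK⟩ := exists_cubeComplex_of_squares q lab gcol
    (fun i => (Q i.1).cont i.2) (fun i => (Q i.1).inj i.2)
    (fun i β γ => by
      simp only [lab, hgcol]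
      exact (Q i.1).alternates i.2 β γ)
    (fun i β γ h => (Q i.1).lab_ne i.2 β γ (hginj _ h))
    (by
      rintro ⟨U, i⟩ ⟨U', j⟩ β γ β' γ' h1 h2
      by_cases hold : ∃ u v, (Q U).lab i β γ = Sum.inl u ∧ (Q U).lab i (!β) (!γ) = Sum.inl v
      · obtain ⟨u, v, hu, hv⟩ := hold
        have hu' : (Q U').lab j β' γ' = Sum.inl u := by
          simp only [lab, hu] at h1
          rcases hl : (Q U').lab j β' γ' with v' | n <;> rw [hl] at h1 <;>
            simp [glueLabel] at h1
          rw [h1]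
        have hv' : (Q U').lab j (!β') (!γ') = Sum.inl v := by
          simp only [lab, hv] at h2
          rcases hl : (Q U').lab j (!β') (!γ') with v' | n <;> rw [hl] at h2 <;>
            simp [glueLabel] at h2
          rw [h2]
        obtain ⟨k1, e1⟩ := (Q U).diag_old i β γ u v hu hv
        obtain ⟨k2, e2⟩ := (Q U').diag_old j β' γ' u v hu' hv'
        -- Both faces assign to `u` their own colour, so a common old diagonal forces `κ U = κ U'`,
        -- and the pair then fixes the face and the position.
        have := hpair U U' _ _ (k1.symm.trans k2) (e1.symm.trans e2)
        obtain ⟨rfl, h4⟩ := Sigma.mk.inj_iff.1 this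
        rw [(Q U).diag_pos i j β γ u v β' γ' u v hu hv hu' hv' (eq_of_heq h4)]
      · have hold' : ∀ u v, (Q U).lab i β γ = Sum.inl u →
            (Q U).lab i (!β) (!γ) ≠ Sum.inl v := fun u v hu hv => hold ⟨u, v, hu, hv⟩
        have hUU : U = U' := by
          rcases glueLabel_eq h1 with ⟨u, hu, -⟩ | h
          · rcases glueLabel_eq h2 with ⟨v, hv, -⟩ | h
            · exact absurd hv (hold' u v hu)
            · exact h
          · exact h
        subst hUU
        rw [(Q U).diag i j β γ β' γ' hold' (hginj _ h1)
          (hginj _ h2)])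
    (by
      rintro ⟨U, i⟩ ⟨U', j⟩ hij a b
      -- A point of an open face meets only squares of that face, and a new label of its carrier
      -- names the face. A point of the graph is handled by the uniqueness of its carrier.
      rcases hloc ⟨U, i⟩ a b with ⟨hqU, n, hn⟩ | ⟨S, hS, hc⟩
      · by_cases hUU : U = U'
        · subst hUU
          have hij' : i ≠ j := fun h => hij (by rw [h])
          refine ((Q U).mem i j hij' a b hqU).trans ?_
          have hc : carrier (lab ⟨U, i⟩) a b = glueLabel U '' carrier ((Q U).lab i) a b :=
            carrier_comp _ _ _ _
          rw [hc, forall_mem_image]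
          refine forall₂_congr fun l _ => exists₂_congr fun β γ => ?_
          exact (hginj U).eq_iff.symm
        · constructor
          · rintro ⟨a', b', h⟩
            exfalso
            rcases hloc ⟨U', j⟩ a' b' with ⟨h', -⟩ | ⟨S, hS, -⟩
            · rw [h] at h'
              exact hUU (Face.eq_of_mem hqU h')
            · rw [h] at hS
              exact U.disjoint_image hqU hS.mem_image
          · intro h
            exfalso
            obtain ⟨β, γ, hl⟩ := h _ hn
            rcases hlj : (Q U').lab j β γ with v | m <;> simp [lab, glueLabel, hlj] at hl
            exact hUU hl.1.symm
      · rw [hc, forall_mem_image]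
        constructor
        · rintro ⟨a', b', h⟩ v hv
          rcases hloc ⟨U', j⟩ a' b' with ⟨h', -⟩ | ⟨S', hS', hc'⟩
          · rw [h] at h'
            exact absurd hS.mem_image (U'.disjoint_image h')
          · rw [h] at hS'
            obtain rfl := hS.unique hS'
            have : Sum.inl v ∈ carrier (lab ⟨U', j⟩) a' b' := by rw [hc']; exact ⟨v, hv, rfl⟩
            obtain ⟨β, γ, -, -, e⟩ := this
            exact ⟨β, γ, e⟩
        · intro h
          refine (Q U').mem_range_of_isCarrier hcolG hS fun v hv => ?_
          obtain ⟨β, γ, e⟩ := h hv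
          refine ⟨β, γ, ?_⟩
          rcases hl : (Q U').lab j β γ with v' | n <;> simp [lab, glueLabel, hl] at e
          rw [e])
  have hcov : ∀ x : M, ∃ i a b, q i a b = x := by
    intro x
    obtain ⟨U, hx⟩ := mem_iUnion.1 (hU.symm ▸ mem_univ x : x ∈ ⋃ U : E.Face, closure U.1)
    obtain ⟨i, a, b, h⟩ := (Q U).cover x hx
    exact ⟨⟨U, i⟩, a, b, h⟩
  have hcovG : ∀ (x : M) (S : Set V), E.IsCarrier x S →
      ∃ i : Σ U, (Q U).ι, ∀ v ∈ S, ∃ β γ, (Q i.1).lab i.2 β γ = Sum.inl v := by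
    intro x S hx
    obtain ⟨⟨U, i⟩, a, b, rfl⟩ := hcov x
    rcases (Q U).loc i a b with ⟨h, -⟩ | ⟨S', hS', hc'⟩
    · exact absurd hx.mem_image (U.disjoint_image h)
    · obtain rfl := hx.unique hS'
      refine ⟨⟨U, i⟩, fun v hv => ?_⟩
      have : Sum.inl v ∈ carrier ((Q U).lab i) a b := by rw [hc']; exact ⟨v, hv, rfl⟩
      obtain ⟨β, γ, -, -, e⟩ := this
      exact ⟨β, γ, e⟩
  have hfacet : ∀ i, (fun x : Fin 2 → unitInterval => q i (x 0) (x 1)) ∈ K.facets := by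
    intro i; rw [hK]; exact ⟨i, rfl⟩
  have hcubeV : ∀ β γ, IsCubeVertex (![endpt β, endpt γ] : Fin 2 → unitInterval) := by
    intro β γ k
    fin_cases k
    · cases β <;> simp [endpt]
    · cases γ <;> simp [endpt]
  refine ⟨K, ⟨?_, ?_, ?_⟩, ?_⟩
  · refine eq_univ_of_forall fun x => ?_
    obtain ⟨i, a, b, h⟩ := hcov x
    exact ⟨_, hfacet i, ![a, b], h⟩
  · intro v
    obtain ⟨i, hi⟩ := hcovG _ _ (E.isCarrier_vert v)
    obtain ⟨β, γ, h⟩ := hi v rfl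
    refine ⟨_, hfacet i, ![endpt β, endpt γ], hcubeV β γ, ?_⟩
    exact ((Q i.1).corner i.2 β γ).trans (by rw [h]; rfl)
  · intro u v h
    -- Any square through the midpoint of the arc has both ends as corners, hence the whole arc as a
    -- side.
    have hmid : E.IsCarrier (E.arc h ⟨1 / 2, by norm_num, by norm_num⟩) {u, v} :=
      Or.inr ⟨u, v, h, _, fun e => by simpa using congrArg Subtype.val e,
        fun e => by simpa using congrArg Subtype.val e, rfl, rfl⟩
    obtain ⟨i, hi⟩ := hcovG _ _ hmid
    obtain ⟨β, γ, hu⟩ := hi u (Or.inl rfl)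
    obtain ⟨β', γ', hv⟩ := hi v (Or.inr rfl)
    refine ⟨{range (E.arc h)}, singleton_subset_iff.2 ?_, by simp⟩
    rcases (Q i.1).range_arc_of_labels hcolG h hu hv with ⟨δ, e⟩ | ⟨δ, e⟩
    · refine ⟨_, hfacet i, 0, ![endpt δ, endpt δ], hcubeV δ δ, ?_⟩
      rw [e]
      ext y
      constructor
      · rintro ⟨a, rfl⟩
        exact ⟨![a, endpt δ], by simp, rfl⟩
      · rintro ⟨x, hx, rfl⟩
        have : x 1 = endpt δ := hx 1 (by simp)
        exact ⟨x 0, by simp [q, this]⟩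
    · refine ⟨_, hfacet i, 1, ![endpt δ, endpt δ], hcubeV δ δ, ?_⟩
      rw [e]
      ext y
      constructor
      · rintro ⟨a, rfl⟩
        exact ⟨![endpt δ, a], by simp, rfl⟩
      · rintro ⟨x, hx, rfl⟩
        have : x 0 = endpt δ := hx 0 (by simp)
        exact ⟨x 1, by simp [q, this]⟩
  -- Every vertex of the complex is the position of a label, so counting labels bounds the vertices,
  -- whether or not all labels occur at corners.
  · have hsub : K.vertices ⊆ range gpos := by
      rintro x ⟨p, hp, y, hy, rfl⟩
      rw [hK] at hp
      obtain ⟨i, rfl⟩ := hp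
      have hend : ∀ k, ∃ β, y k = endpt β := fun k =>
        (hy k).elim (fun h => ⟨false, h⟩) fun h => ⟨true, h⟩
      obtain ⟨β, hβ⟩ := hend 0
      obtain ⟨γ, hγ⟩ := hend 1
      exact ⟨lab i β γ, by rw [← hcorner, ← hβ, ← hγ]⟩
    calc K.vertices.ncard ≤ (range gpos).ncard := ncard_le_ncard hsub (finite_range _)
      _ ≤ Nat.card (V ⊕ (Σ U, (Q U).N)) := by
          rw [← image_univ]
          exact (ncard_image_le finite_univ).trans (by rw [ncard_univ])
      _ = _ := by
          rw [Nat.card_eq_fintype_card, Fintype.card_sum, Fintype.card_sigma]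

end GraphEmbedding

/-! ### Polar coordinates on a closed face. -/

theorem ClosedWalk.len_cast_pos {V : Type*} {G : SimpleGraph V} (w : ClosedWalk G) :
    (0 : ℝ) < w.len := Nat.cast_pos.2 w.len_pos

namespace GraphEmbedding

variable {V : Type*} {G : SimpleGraph V} {M : Type*} [TopologicalSpace M]

/-- Polar coordinates on the closure of a face: the angle is measured in edges of the boundary
cycle, and the boundary is at radius 1. -/
structure PolarFace (E : GraphEmbedding G M) (U : Set M) (w : ClosedWalk G) where
  Φ : ℝ → ℝ → M
  -- The angle may be discontinuous where the radius vanishes; the core squares need this, since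
  -- their angle is a quotient 0/0 at the centre.
  cont : ∀ f g : unitInterval × unitInterval → ℝ, Continuous g → (∀ x, 0 ≤ g x ∧ g x ≤ 1) →
    (∀ x, g x ≠ 0 → ContinuousAt f x) → Continuous fun x => Φ (f x) (g x)
  mem : ∀ {θ r : ℝ}, 0 ≤ r → r < 1 → Φ θ r ∈ U
  inj : ∀ {θ r θ' r' : ℝ}, 0 ≤ r → r < 1 → 0 ≤ r' → r' < 1 → Φ θ r = Φ θ' r' →
    r = r' ∧ (r = 0 ∨ ∃ n : ℤ, θ' = θ + n * w.len)
  zero : ∀ θ θ' : ℝ, Φ θ 0 = Φ θ' 0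
  period : ∀ (θ r : ℝ) (n : ℤ), Φ (θ + n * w.len) r = Φ θ r
  bdry : ∀ (n : ℤ) (t : unitInterval), Φ (n + t) 1 = E.arc (w.adj (n : ZMod w.len)) t
  cover : ∀ x ∈ closure U, ∃ θ r : ℝ, 0 ≤ r ∧ r ≤ 1 ∧ Φ θ r = x

theorem closure_subset_image_closedBall [T2Space M] {φ : ℂ → M}
    (hφ : ContinuousOn φ (Metric.closedBall 0 1)) :
    closure (φ '' Metric.ball 0 1) ⊆ φ '' Metric.closedBall 0 1 :=
  closure_minimal (image_mono Metric.ball_subset_closedBall)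
    ((isCompact_closedBall 0 1).image_of_continuousOn hφ).isClosed

theorem injOn_ball_of_isEmbedding {φ : ℂ → M}
    (h : IsEmbedding ((Metric.ball (0 : ℂ) 1).domRestrict φ)) : InjOn φ (Metric.ball 0 1) :=
  fun x hx y hy hxy => congrArg Subtype.val (@h.injective ⟨x, hx⟩ ⟨y, hy⟩ hxy)

theorem exists_int_cast_val {n : ℕ} (hn : 0 < n) (m : ℤ) :
    ∃ j : ℤ, m = ((m : ZMod n).val : ℤ) + j * n := by
  have : NeZero n := ⟨hn.ne'⟩
  have h : (((m : ZMod n).val : ℤ) : ZMod n) = (m : ZMod n) := by simp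
  obtain ⟨j, hj⟩ := (ZMod.intCast_eq_intCast_iff_dvd_sub _ _ _).1 h
  exact ⟨j, by linarith⟩

theorem nonempty_polarFace [T2Space M] {E : GraphEmbedding G M} {U : Set M} {w : ClosedWalk G}
    (h : E.IsBoundaryCycle U w) : Nonempty (PolarFace E U w) := by
  obtain ⟨φ, hφ, hemb, rfl, hb⟩ := h
  have hinj := injOn_ball_of_isEmbedding hemb
  have hL := w.len_cast_pos
  -- One full turn has length `w.len`, so that the unit interval of angles starting at `n` traces
  -- the edge at position `n`.
  let e : ℝ → ℂ := fun θ => Complex.exp ((2 * Real.pi * θ / w.len : ℝ) * Complex.I)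
  have he : ∀ θ, ‖e θ‖ = 1 := fun θ => Complex.norm_exp_ofReal_mul_I _
  have hec : Continuous e := by fun_prop
  have hnorm : ∀ θ r : ℝ, 0 ≤ r → ‖(r : ℂ) * e θ‖ = r := by
    intro θ r hr
    rw [norm_mul, he, mul_one, Complex.norm_of_nonneg hr]
  have heq : ∀ θ θ', e θ = e θ' → ∃ n : ℤ, θ' = θ + n * w.len := by
    intro θ θ' h
    obtain ⟨n, hn⟩ := Complex.exp_eq_exp_iff_exists_int.1 h.symm
    refine ⟨n, ?_⟩
    have h2 : ((2 * Real.pi * θ' / w.len : ℝ) : ℂ) = ((2 * Real.pi * θ / w.len +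
        n * (2 * Real.pi) : ℝ) : ℂ) := by
      apply mul_right_cancel₀ Complex.I_ne_zero
      rw [hn]; push_cast; ring
    have h3 := Complex.ofReal_injective h2
    have hpi := Real.pi_pos
    field_simp at h3
    linarith
  have hper : ∀ (θ : ℝ) (n : ℤ), e (θ + n * w.len) = e θ := by
    intro θ n
    refine Complex.exp_eq_exp_iff_exists_int.2 ⟨n, ?_⟩
    have h1 : 2 * Real.pi * (θ + n * w.len) / w.len =
        2 * Real.pi * θ / w.len + n * (2 * Real.pi) := by field_simp
    rw [h1]; push_cast; ring
  refine ⟨⟨fun θ r => φ (r * e θ), ?_, ?_, ?_, ?_, ?_, ?_, ?_⟩⟩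
  · intro f g hg hg01 hf
    refine hφ.comp_continuous ?_ fun x => ?_
    · rw [continuous_iff_continuousAt]
      intro x
      by_cases hx : g x = 0
      -- At radius zero the product tends to zero by its norm alone, whatever the angle does.
      · have h1 : Filter.Tendsto (fun y => ((g y : ℝ) : ℂ)) (𝓝 x) (𝓝 0) := by
          have := (Complex.continuous_ofReal.comp hg).tendsto x
          simpa [hx, Function.comp_def] using this
        rw [ContinuousAt, hx, Complex.ofReal_zero, zero_mul]
        rw [tendsto_zero_iff_norm_tendsto_zero] at h1 ⊢
        refine h1.congr fun y => ?_
        rw [norm_mul, he, mul_one]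
      · exact (Complex.continuous_ofReal.comp hg).continuousAt.mul
          (hec.continuousAt.comp (hf x hx))
    · rw [mem_closedBall_zero_iff, hnorm _ _ (hg01 x).1]; exact (hg01 x).2
  · intro θ r h0 h1
    exact ⟨_, by rwa [mem_ball_zero_iff, hnorm _ _ h0], rfl⟩
  · intro θ r θ' r' h0 h1 h0' h1' h
    have h2 : (r : ℂ) * e θ = r' * e θ' := hinj (by rwa [mem_ball_zero_iff, hnorm _ _ h0])
      (by rwa [mem_ball_zero_iff, hnorm _ _ h0']) h
    have h3 : r = r' := by rw [← hnorm θ r h0, h2, hnorm _ _ h0']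
    subst h3
    refine ⟨rfl, ?_⟩
    by_cases hr : r = 0
    · exact Or.inl hr
    · exact Or.inr (heq _ _ (mul_left_cancel₀ (Complex.ofReal_ne_zero.2 hr) h2))
  · intro θ θ'; simp
  · intro θ r n; simp only [hper]
  · intro n t
    rw [← hb (n : ZMod w.len) t]
    obtain ⟨j, hj⟩ := exists_int_cast_val w.len_pos n
    have h1 : (n : ℝ) + t = (((n : ZMod w.len).val : ℝ) + t) + j * w.len := by
      conv_lhs => rw [hj]
      push_cast; ring
    have h2 : e (n + t) = e ((n : ZMod w.len).val + t) := by rw [h1, hper]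
    simp only [h2, Complex.ofReal_one, one_mul]
    congr 1
    change Complex.exp _ = _
    congr 1
    push_cast
    ring
  · intro x hx
    obtain ⟨z, hz, rfl⟩ := closure_subset_image_closedBall hφ hx
    refine ⟨w.len * Complex.arg z / (2 * Real.pi), ‖z‖, norm_nonneg z,
      mem_closedBall_zero_iff.1 hz, ?_⟩
    have h1 : 2 * Real.pi * (w.len * Complex.arg z / (2 * Real.pi)) / w.len = Complex.arg z := by
      have := Real.pi_pos
      field_simp
    simp only [e, h1, Complex.norm_mul_exp_arg_mul_I]

end GraphEmbedding

/-! ### Cut sequences and explicit coordinates of fans, kites and core squares. -/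

/-- A bi-infinite sequence of cut positions, periodic modulo `L` with `k ≥ 3` cuts per period. -/
structure CutSeq (L k : ℕ) where
  s : ℤ → ℤ
  mono : StrictMono s
  per : ∀ i, s (i + k) = s i + L
  three_le : 3 ≤ k

namespace CutSeq

variable {L k : ℕ} (c : CutSeq L k)

/-- The middle of the `i`-th slot. -/
noncomputable def mid (i : ℤ) : ℝ := (c.s i + c.s (i + 1)) / 2

/-- Half the width of the `i`-th slot. -/
noncomputable def half (i : ℤ) : ℝ := (c.s (i + 1) - c.s i) / 2

theorem lt_succ (i : ℤ) : (c.s i : ℝ) < c.s (i + 1) := Int.cast_lt.2 (c.mono (lt_add_one i))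

theorem half_pos (i : ℤ) : 0 < c.half i := by
  have := c.lt_succ i
  unfold half; linarith

theorem mid_sub_half (i : ℤ) : c.mid i - c.half i = c.s i := by unfold mid half; ring

theorem mid_add_half (i : ℤ) : c.mid i + c.half i = c.s (i + 1) := by unfold mid half; ring

theorem s_add_mul (i n : ℤ) : c.s (i + n * k) = c.s i + n * L := by
  induction n using Int.induction_on with
  | zero => simp
  | succ n ih =>
    rw [show i + ((n : ℤ) + 1) * k = (i + n * k) + k by ring, c.per, ih]; ring
  | pred n ih =>
    have h := c.per (i + (-(n : ℤ) - 1) * k)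
    rw [show i + (-(n : ℤ) - 1) * k + k = i + -(n : ℤ) * k by ring, ih] at h
    linarith

theorem mid_add_mul (i n : ℤ) : c.mid (i + n * k) = c.mid i + n * L := by
  unfold mid
  rw [show i + n * k + 1 = (i + 1) + n * k by ring, s_add_mul, s_add_mul]; push_cast; ring

theorem half_add_mul (i n : ℤ) : c.half (i + n * k) = c.half i := by
  unfold half
  rw [show i + n * k + 1 = (i + 1) + n * k by ring, s_add_mul, s_add_mul]; push_cast; ring

theorem slot_cases {i j : ℤ} {θ : ℝ} (h1 : c.s i ≤ θ) (h2 : θ ≤ c.s (i + 1))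
    (h3 : c.s j ≤ θ) (h4 : θ ≤ c.s (j + 1)) :
    i = j ∨ (j = i + 1 ∧ θ = c.s (i + 1)) ∨ (i = j + 1 ∧ θ = c.s i) := by
  rcases lt_trichotomy i j with h | h | h
  · right; left
    have h5 : (c.s (i + 1) : ℝ) ≤ c.s j := Int.cast_le.2 (c.mono.monotone h)
    have h6 : θ = c.s (i + 1) := by linarith
    have h7 : (c.s j : ℝ) = c.s (i + 1) := by linarith
    exact ⟨c.mono.injective (Int.cast_injective h7), h6⟩
  · exact Or.inl h
  · right; right
    have h5 : (c.s (j + 1) : ℝ) ≤ c.s i := Int.cast_le.2 (c.mono.monotone h)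
    have h6 : θ = c.s i := by linarith
    have h7 : (c.s i : ℝ) = c.s (j + 1) := by linarith
    exact ⟨c.mono.injective (Int.cast_injective h7), h6⟩

theorem slot_unique {i j : ℤ} {θ : ℝ} (h1 : c.s i < θ) (h2 : θ < c.s (i + 1))
    (h3 : c.s j ≤ θ) (h4 : θ ≤ c.s (j + 1)) : i = j := by
  rcases c.slot_cases h1.le h2.le h3 h4 with h | ⟨-, h⟩ | ⟨-, h⟩
  · exact h
  · exact absurd h h2.ne
  · exact absurd h h1.ne'

theorem exists_slot (θ : ℝ) : ∃ i, c.s i ≤ θ ∧ θ < c.s (i + 1) := by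
  have hmono : ∀ n : ℕ, (n : ℤ) ≤ c.s n - c.s 0 ∧ (n : ℤ) ≤ c.s 0 - c.s (-n) := by
    intro n
    induction n with
    | zero => simp
    | succ n ih =>
      have h1 := c.mono (lt_add_one (n : ℤ))
      have h2 := c.mono (show -((n : ℤ) + 1) < -n by linarith)
      push_cast
      omega
  obtain ⟨i, hi, hmax⟩ := Int.exists_greatest_of_bdd (P := fun i => (c.s i : ℝ) ≤ θ)
    (by
      obtain ⟨n, hn⟩ := exists_nat_gt (θ - c.s 0)
      refine ⟨n, fun z hz => ?_⟩
      by_contra! hlt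
      have h1 : (c.s n : ℝ) ≤ c.s z := Int.cast_le.2 (c.mono.monotone hlt.le)
      have h2 : ((n : ℤ) : ℝ) ≤ ((c.s n - c.s 0 : ℤ) : ℝ) := Int.cast_le.2 (hmono n).1
      push_cast at h2
      linarith)
    (by
      obtain ⟨n, hn⟩ := exists_nat_gt (c.s 0 - θ)
      refine ⟨-n, ?_⟩
      have h2 : ((n : ℤ) : ℝ) ≤ ((c.s 0 - c.s (-n) : ℤ) : ℝ) := Int.cast_le.2 (hmono n).2
      push_cast at h2
      linarith)
  refine ⟨i, hi, ?_⟩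
  by_contra! h
  have := hmax (i + 1) h
  omega

/-- `p, p + 1, p + 2` are three consecutive positions in the slot `i`, at even distance from its
ends. -/
structure InSlot (i p : ℤ) : Prop where
  le : c.s i ≤ p
  le' : p + 2 ≤ c.s (i + 1)
  even : Even (p - c.s i)

/-- Angle on the square with corners at the apex of slot `i` and at the positions `p`, `p + 2`,
`p + 1`. -/
noncomputable def fanAngle (i p : ℤ) (a b : ℝ) : ℝ :=
  c.mid i + max a b * (p + 1 - c.mid i) + (b - a)

/-- Radius on the square with corners at the apex of a slot and three boundary positions. -/
noncomputable def fanRadius (a b : ℝ) : ℝ := 2 / 3 + max a b / 3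

/-- Angle on the square at the cut `i`, with corners at the cut and at two apices. -/
noncomputable def kiteAngle (i : ℤ) (a b : ℝ) : ℝ :=
  c.s i + c.half i * max (a - b) 0 + c.half (i - 1) * min (a - b) 0

/-- Radius on the square at a cut. -/
noncomputable def kiteRadius (a b : ℝ) : ℝ := 1 - (a + b) / 3

/-- Angle on the square with corners at the centre and at the apex of slot `i`. -/
noncomputable def coreAngle (i : ℤ) (a b : ℝ) : ℝ := c.mid i + c.half i * (b - a) / max a b

/-- Radius on the square with corners at the centre and at an apex. -/
noncomputable def coreRadius (a b : ℝ) : ℝ := (a + b) / 3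

/-! ### Where two cells have equal polar coordinates. -/

variable {c}

/-- At height `t = max a b` above the apex the fan of a slot stays within `t * half` of the middle
angle: it widens linearly from a point to the whole slot. -/
theorem fanAngle_bounds {i p : ℤ} (hp : c.InSlot i p) {a b : ℝ} (ha : 0 ≤ a) (hb : 0 ≤ b) :
    c.mid i - max a b * c.half i ≤ c.fanAngle i p a b ∧
      c.fanAngle i p a b ≤ c.mid i + max a b * c.half i := by
  have h1 : (c.s i : ℝ) ≤ p := Int.cast_le.2 hp.le
  have h2 : (p : ℝ) + 2 ≤ c.s (i + 1) := by exact_mod_cast hp.le'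
  rw [← c.mid_sub_half] at h1
  rw [← c.mid_add_half] at h2
  unfold fanAngle
  rcases le_total a b with h | h
  · rw [max_eq_right h]; constructor <;> nlinarith
  · rw [max_eq_left h]; constructor <;> nlinarith

theorem fanAngle_mem_slot {i p : ℤ} (hp : c.InSlot i p) {a b : ℝ} (ha : 0 ≤ a) (hb : 0 ≤ b)
    (hr : fanRadius a b < 1) :
    c.s i < c.fanAngle i p a b ∧ c.fanAngle i p a b < c.s (i + 1) := by
  obtain ⟨h1, h2⟩ := fanAngle_bounds hp ha hb
  have h3 := c.half_pos i
  have h4 : max a b < 1 := by unfold fanRadius at hr; linarith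
  rw [← c.mid_sub_half, ← c.mid_add_half]
  constructor <;> nlinarith

theorem kiteAngle_of_le {i : ℤ} {a b : ℝ} (h : b ≤ a) :
    c.kiteAngle i a b = c.s i + c.half i * (a - b) := by
  unfold kiteAngle
  rw [max_eq_left (by linarith), min_eq_right (by linarith)]; ring

theorem kiteAngle_of_ge {i : ℤ} {a b : ℝ} (h : a ≤ b) :
    c.kiteAngle i a b = c.s i - c.half (i - 1) * (b - a) := by
  unfold kiteAngle
  rw [max_eq_right (by linarith), min_eq_left (by linarith)]; ring

theorem coreAngle_mem_slot {i : ℤ} {a b : ℝ} (ha : 0 ≤ a) (hb : 0 ≤ b) :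
    c.s i ≤ c.coreAngle i a b ∧ c.coreAngle i a b ≤ c.s (i + 1) := by
  have h3 := c.half_pos i
  rw [← c.mid_sub_half, ← c.mid_add_half]
  unfold coreAngle
  rcases eq_or_lt_of_le (ha.trans (le_max_left a b)) with h | h
  · rw [← h]; simp; exact h3.le
  · have h1 : -c.half i ≤ c.half i * (b - a) / max a b := by
      rw [le_div_iff₀ h]
      nlinarith [le_max_left a b, le_max_right a b]
    have h2 : c.half i * (b - a) / max a b ≤ c.half i := by
      rw [div_le_iff₀ h]
      nlinarith [le_max_left a b, le_max_right a b]
    constructor <;> linarith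

/-- Equal radius means equal `t = max a b`. A fan square then occupies an angular interval of width
`2 * t`, run through by `b - a`, and the intervals for positions `2 * d` apart have centres `2 * d *
t` apart. So distinct squares meet only for `d = ±1` at the ends of their intervals, along the
common spoke, or at the apex where `t = 0`. -/
theorem fan_fan {i j p p' : ℤ} (hp : c.InSlot i p) (hp' : c.InSlot j p') {a b a' b' : ℝ}
    (ha : 0 ≤ a) (hb : 0 ≤ b) (ha' : 0 ≤ a') (hb' : 0 ≤ b') (hr : fanRadius a b = fanRadius a' b')
    (hr1 : fanRadius a b < 1) (hθ : c.fanAngle i p a b = c.fanAngle j p' a' b') :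
    i = j ∧ ((p = p' ∧ a = a' ∧ b = b') ∨ (a = 0 ∧ b = 0 ∧ a' = 0 ∧ b' = 0) ∨
      (p' = p + 2 ∧ a = 0 ∧ b' = 0 ∧ b = a') ∨ (p = p' + 2 ∧ b = 0 ∧ a' = 0 ∧ a = b')) := by
  have hs := fanAngle_mem_slot hp ha hb hr1
  have hs' := fanAngle_mem_slot hp' ha' hb' (hr ▸ hr1)
  rw [← hθ] at hs'
  obtain rfl := c.slot_unique hs.1 hs.2 hs'.1.le hs'.2.le
  refine ⟨rfl, ?_⟩
  have ht : max a b = max a' b' := by unfold fanRadius at hr; linarith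
  unfold fanAngle at hθ
  have h1 : max a b * ((p' : ℝ) - p) = (b - a) - (b' - a') := by
    rw [← ht] at hθ; linarith
  have hev : Even (p' - p) := by
    have := hp'.even.sub hp.even
    simpa using this
  obtain ⟨d, hd⟩ := hev
  have hd' : (p' : ℝ) - p = 2 * d := by
    have := congrArg (Int.cast (R := ℝ)) hd
    push_cast at this; linarith
  rw [hd'] at h1
  have hd0 : d = 0 ∨ 1 ≤ d ∨ d ≤ -1 := by omega
  rcases hd0 with rfl | hd0 | hd0
  · left
    refine ⟨by omega, ?_⟩
    simp at h1
    rcases le_total a b with h | h <;> rcases le_total a' b' with h' | h' <;>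
      simp only [max_eq_left, max_eq_right, h, h'] at ht <;> constructor <;> linarith
  · have hd1 : (1 : ℝ) ≤ d := by exact_mod_cast hd0
    by_cases hz : max a b = 0
    · right; left
      rw [hz] at ht
      have := le_max_left a b; have := le_max_right a b
      have := le_max_left a' b'; have := le_max_right a' b'
      refine ⟨?_, ?_, ?_, ?_⟩ <;> linarith
    · right; right; left
      have hpos : 0 < max a b := lt_of_le_of_ne (ha.trans (le_max_left _ _)) (Ne.symm hz)
      have h2 : 2 * max a b ≤ max a b * (2 * d) := by nlinarith
      have e1 := le_max_left a b; have e2 := le_max_right a b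
      have e3 := le_max_left a' b'; have e4 := le_max_right a' b'
      have h3 : b = max a b ∧ a = 0 ∧ b' = 0 ∧ a' = max a b := by
        refine ⟨?_, ?_, ?_, ?_⟩ <;> linarith
      obtain ⟨g1, g2, g3, g4⟩ := h3
      have h5 : max a b * (2 * d - 2) = 0 := by linarith
      have h6 : (d : ℝ) = 1 := by
        rcases mul_eq_zero.1 h5 with h | h
        · exact absurd h hz
        · linarith
      have h7 : d = 1 := by exact_mod_cast h6
      refine ⟨by omega, g2, g3, by rw [g4, ← g1]⟩
  · have hd1 : (d : ℝ) ≤ -1 := by exact_mod_cast hd0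
    by_cases hz : max a b = 0
    · right; left
      rw [hz] at ht
      have := le_max_left a b; have := le_max_right a b
      have := le_max_left a' b'; have := le_max_right a' b'
      refine ⟨?_, ?_, ?_, ?_⟩ <;> linarith
    · right; right; right
      have hpos : 0 < max a b := lt_of_le_of_ne (ha.trans (le_max_left _ _)) (Ne.symm hz)
      have h2 : max a b * (2 * d) ≤ -(2 * max a b) := by nlinarith
      have e1 := le_max_left a b; have e2 := le_max_right a b
      have e3 := le_max_left a' b'; have e4 := le_max_right a' b'
      have h3 : a = max a b ∧ b = 0 ∧ a' = 0 ∧ b' = max a b := by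
        refine ⟨?_, ?_, ?_, ?_⟩ <;> linarith
      obtain ⟨g1, g2, g3, g4⟩ := h3
      have h5 : max a b * (2 * d + 2) = 0 := by linarith
      have h6 : (d : ℝ) = -1 := by
        rcases mul_eq_zero.1 h5 with h | h
        · exact absurd h hz
        · linarith
      have h7 : d = -1 := by exact_mod_cast h6
      refine ⟨by omega, g2, g3, by rw [g4, ← g1]⟩

/-- At equal radius `max a b = 1 - (a' + b')`, so on the right of the cut the fan begins at distance
`(a' + b') * half` from it, whereas the kite point is at distance `(a' - b') * half`. Contact forces
`b' = 0`, the spoke from the apex to the cut. The left side is symmetric. -/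
theorem fan_kite {i j p : ℤ} (hp : c.InSlot i p) {a b a' b' : ℝ}
    (ha : 0 ≤ a) (hb : 0 ≤ b) (ha' : 0 ≤ a') (hb' : 0 ≤ b')
    (ha1' : a' ≤ 1) (hb1' : b' ≤ 1) (hr : fanRadius a b = kiteRadius a' b')
    (hr1 : fanRadius a b < 1) (hθ : c.fanAngle i p a b = c.kiteAngle j a' b') :
    (j = i ∧ b' = 0 ∧ ((a = 0 ∧ b = 0 ∧ a' = 1) ∨ (p = c.s i ∧ b = 0 ∧ a = 1 - a'))) ∨
    (j = i + 1 ∧ a' = 0 ∧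
      ((a = 0 ∧ b = 0 ∧ b' = 1) ∨ (p + 2 = c.s (i + 1) ∧ a = 0 ∧ b = 1 - b'))) := by
  have hs := fanAngle_mem_slot hp ha hb hr1
  obtain ⟨B1, B2⟩ := fanAngle_bounds hp ha hb
  have ht : max a b = 1 - (a' + b') := by unfold fanRadius kiteRadius at hr; linarith
  have ht0 : 0 ≤ max a b := ha.trans (le_max_left _ _)
  have q1 : (c.s i : ℝ) ≤ p := Int.cast_le.2 hp.le
  have q2 : (p : ℝ) + 2 ≤ c.s (i + 1) := by exact_mod_cast hp.le'
  have e1 := le_max_left a b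
  have e2 := le_max_right a b
  rcases le_total b' a' with h | h
  · left
    rw [kiteAngle_of_le h] at hθ
    have hj := c.half_pos j
    have hij : i = j := by
      refine c.slot_unique hs.1 hs.2 ?_ ?_
      · rw [hθ]; nlinarith
      · rw [hθ, ← c.mid_add_half, ← c.mid_sub_half]; nlinarith
    subst hij
    have hm := c.mid_sub_half i
    rw [hθ, ht] at B1
    have hb0 : b' = 0 := by
      have : c.half i * b' ≤ 0 := by nlinarith
      nlinarith
    subst hb0
    refine ⟨rfl, rfl, ?_⟩
    have hthe : max a b * (p - c.s i) + (max a b + (b - a)) = 0 := by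
      unfold fanAngle at hθ
      have h9 : a' = 1 - max a b := by linarith
      rw [h9] at hθ
      have h10 : c.mid i = c.s i + c.half i := by linarith
      rw [h10] at hθ
      linarith
    have h3 : 0 ≤ max a b * (p - c.s i) := mul_nonneg ht0 (by linarith)
    have h4 : 0 ≤ max a b + (b - a) := by linarith
    have h5 : max a b * (p - c.s i) = 0 := by linarith
    have h6 : b = 0 := by linarith
    have h7 : a = max a b := by linarith
    rcases mul_eq_zero.1 h5 with h8 | h8
    · left; refine ⟨?_, h6, ?_⟩ <;> linarith
    · right
      refine ⟨?_, h6, by linarith⟩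
      have : (p : ℝ) = c.s i := by linarith
      exact_mod_cast this
  · right
    rw [kiteAngle_of_ge h] at hθ
    have hj := c.half_pos (j - 1)
    have hm1 := c.mid_sub_half (j - 1)
    have hm2 := c.mid_add_half (j - 1)
    rw [sub_add_cancel] at hm2
    have hij : i = j - 1 := by
      refine c.slot_unique hs.1 hs.2 ?_ ?_
      · rw [hθ, ← hm1, ← hm2]; nlinarith
      · rw [hθ, sub_add_cancel]; nlinarith
    obtain rfl : j = i + 1 := by omega
    rw [add_sub_cancel_right] at hj hm1 hm2 hθ
    rw [hθ, ht] at B2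
    have hb0 : a' = 0 := by
      have : c.half i * a' ≤ 0 := by nlinarith
      nlinarith
    subst hb0
    refine ⟨rfl, rfl, ?_⟩
    have hthe : max a b * (c.s (i + 1) - (p + 2)) + (max a b - (b - a)) = 0 := by
      unfold fanAngle at hθ
      have h9 : b' = 1 - max a b := by linarith
      rw [h9] at hθ
      have h10 : c.mid i = c.s (i + 1) - c.half i := by linarith
      rw [h10] at hθ
      linarith
    have h3 : 0 ≤ max a b * (c.s (i + 1) - (p + 2)) := mul_nonneg ht0 (by linarith)
    have h4 : 0 ≤ max a b - (b - a) := by linarith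
    have h5 : max a b * (c.s (i + 1) - (p + 2)) = 0 := by linarith
    have h6 : a = 0 := by linarith
    have h7 : b = max a b := by linarith
    rcases mul_eq_zero.1 h5 with h8 | h8
    · left; refine ⟨h6, ?_, ?_⟩ <;> linarith
    · right
      refine ⟨?_, h6, by linarith⟩
      have : (p : ℝ) + 2 = c.s (i + 1) := by linarith
      exact_mod_cast this

/-- Fan radii are at least `2 / 3` and core radii at most `2 / 3`, so contact occurs at the apex. -/
theorem fan_core {i j p : ℤ} (hp : c.InSlot i p) {a b a' b' : ℝ}
    (ha : 0 ≤ a) (hb : 0 ≤ b) (ha1 : a ≤ 1) (hb1 : b ≤ 1)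
    (ha1' : a' ≤ 1) (hb1' : b' ≤ 1) (hr : fanRadius a b = coreRadius a' b')
    (hθ : c.fanAngle i p a b = c.coreAngle j a' b') :
    i = j ∧ a = 0 ∧ b = 0 ∧ a' = 1 ∧ b' = 1 := by
  have e1 := le_max_left a b
  have e2 := le_max_right a b
  unfold fanRadius coreRadius at hr
  have h1 : a' = 1 := by linarith
  have h2 : b' = 1 := by linarith
  have h3 : a = 0 := by linarith
  have h4 : b = 0 := by linarith
  subst h1 h2 h3 h4
  refine ⟨?_, rfl, rfl, rfl, rfl⟩
  have hs := fanAngle_mem_slot hp ha hb (by unfold fanRadius; norm_num)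
  have hs' := c.coreAngle_mem_slot (i := j) (zero_le_one (α := ℝ)) zero_le_one
  rw [← hθ] at hs'
  exact c.slot_unique hs.1 hs.2 hs'.1 hs'.2

/-- A kite stays between the middles of the two slots next to its cut. Consecutive kites can share
only a middle angle, which each of them reaches only at its apex corner. -/
theorem kite_kite_of_lt {i j : ℤ} {a b a' b' : ℝ}
    (hb : 0 ≤ b) (ha1 : a ≤ 1) (ha' : 0 ≤ a') (hb1' : b' ≤ 1) (hθ : c.kiteAngle i a b = c.kiteAngle j a' b') (hij : i < j) :
    j = i + 1 ∧ a = 1 ∧ b = 0 ∧ a' = 0 ∧ b' = 1 := by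
  have hi := c.half_pos i
  have hi' := c.half_pos (i - 1)
  have hj := c.half_pos j
  have hj' := c.half_pos (j - 1)
  have m1 := c.mid_sub_half i
  have m2 := c.mid_add_half (j - 1)
  rw [sub_add_cancel] at m2
  have u1 : c.kiteAngle i a b ≤ c.mid i := by
    rcases le_total b a with h | h
    · rw [kiteAngle_of_le h]; nlinarith
    · rw [kiteAngle_of_ge h]; nlinarith
  have u2 : c.mid (j - 1) ≤ c.kiteAngle j a' b' := by
    rcases le_total b' a' with h | h
    · rw [kiteAngle_of_le h]; nlinarith
    · rw [kiteAngle_of_ge h]; nlinarith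
  have hle : i = j - 1 := by
    by_contra hne
    have h1 : (c.s (i + 1) : ℝ) ≤ c.s (j - 1) :=
      Int.cast_le.2 (c.mono.monotone (by omega))
    have h2 := c.mid_sub_half (j - 1)
    have h3 := c.mid_add_half i
    linarith
  obtain rfl : j = i + 1 := by omega
  rw [add_sub_cancel_right] at u2 m2 hj'
  have v1 : c.kiteAngle i a b = c.mid i := by linarith
  have v2 : c.kiteAngle (i + 1) a' b' = c.mid i := by linarith
  refine ⟨rfl, ?_⟩
  have w1 : a - b = 1 := by
    rcases le_total b a with h | h
    · rw [kiteAngle_of_le h] at v1; nlinarith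
    · rw [kiteAngle_of_ge h] at v1; nlinarith
  have w2 : b' - a' = 1 := by
    rcases le_total b' a' with h | h
    · rw [kiteAngle_of_le h] at v2; nlinarith
    · rw [kiteAngle_of_ge h, add_sub_cancel_right] at v2; nlinarith
  refine ⟨?_, ?_, ?_, ?_⟩ <;> linarith

theorem kite_kite {i j : ℤ} {a b a' b' : ℝ}
    (ha : 0 ≤ a) (hb : 0 ≤ b) (ha1 : a ≤ 1) (hb1 : b ≤ 1) (ha' : 0 ≤ a') (hb' : 0 ≤ b')
    (ha1' : a' ≤ 1) (hb1' : b' ≤ 1) (hr : kiteRadius a b = kiteRadius a' b')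
    (hθ : c.kiteAngle i a b = c.kiteAngle j a' b') :
    (i = j ∧ a = a' ∧ b = b') ∨ (j = i + 1 ∧ a = 1 ∧ b = 0 ∧ a' = 0 ∧ b' = 1) ∨
      (i = j + 1 ∧ a' = 1 ∧ b' = 0 ∧ a = 0 ∧ b = 1) := by
  rcases lt_trichotomy i j with h | rfl | h
  · exact Or.inr (Or.inl (kite_kite_of_lt hb ha1 ha' hb1' hθ h))
  · left
    have hi := c.half_pos i
    have hi' := c.half_pos (i - 1)
    have hs : a + b = a' + b' := by unfold kiteRadius at hr; linarith
    have hd : a - b = a' - b' := by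
      rcases le_total b a with h | h <;> rcases le_total b' a' with h' | h'
      · rw [kiteAngle_of_le h, kiteAngle_of_le h'] at hθ
        exact mul_left_cancel₀ hi.ne' (by linarith)
      · rw [kiteAngle_of_le h, kiteAngle_of_ge h'] at hθ
        have : a - b ≤ 0 := by nlinarith
        have : b' - a' ≤ 0 := by nlinarith
        linarith
      · rw [kiteAngle_of_ge h, kiteAngle_of_le h'] at hθ
        have : b - a ≤ 0 := by nlinarith
        have : a' - b' ≤ 0 := by nlinarith
        linarith
      · rw [kiteAngle_of_ge h, kiteAngle_of_ge h'] at hθ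
        have : b - a = b' - a' := mul_left_cancel₀ hi'.ne' (by linarith)
        linarith
    refine ⟨rfl, ?_, ?_⟩ <;> linarith
  · exact Or.inr (Or.inr (kite_kite_of_lt hb' ha1' ha hb1 hθ.symm h))

/-- At offset `δ` from the cut, in units of the half slot, core squares reach up to radius `(1 + δ)
/ 3` and the kite starts there. Equality puts both points on the rib from the apex to the inner
vertex. -/
theorem kite_core {i j : ℤ} {a b a' b' : ℝ}
    (ha : 0 ≤ a) (hb : 0 ≤ b) (ha1 : a ≤ 1) (hb1 : b ≤ 1) (ha' : 0 ≤ a') (hb' : 0 ≤ b')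
    (ha1' : a' ≤ 1) (hb1' : b' ≤ 1) (hr : kiteRadius a b = coreRadius a' b')
    (hθ : c.kiteAngle i a b = c.coreAngle j a' b') :
    (j = i ∧ a = 1 ∧ a' = 1 ∧ b = 1 - b') ∨ (j = i - 1 ∧ b = 1 ∧ b' = 1 ∧ a = 1 - a') := by
  have hi := c.half_pos i
  have hi' := c.half_pos (i - 1)
  have hj := c.half_pos j
  have m1 := c.mid_sub_half i
  have m1' := c.mid_add_half i
  have m2 := c.mid_add_half (i - 1)
  have m2' := c.mid_sub_half (i - 1)
  rw [sub_add_cancel] at m2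
  have n1 := c.mid_sub_half j
  have n2 := c.mid_add_half j
  have hs : a + b = 3 - (a' + b') := by unfold kiteRadius coreRadius at hr; linarith
  have hc := c.coreAngle_mem_slot (i := j) ha' hb'
  have ha0 : 0 < a' ∨ 0 < b' := by
    by_contra! h
    linarith
  have core_le : b' ≤ a' → 0 < a' → c.coreAngle j a' b' = c.s j + c.half j * (b' / a') := by
    intro h h0
    unfold coreAngle
    rw [max_eq_left h, ← n1]; field_simp; ring
  have core_ge : a' ≤ b' → 0 < b' → c.coreAngle j a' b' = c.s (j + 1) - c.half j * (a' / b') := by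
    intro h h0
    unfold coreAngle
    rw [max_eq_right h, ← n2]; field_simp; ring
  have right : ∀ {x y u v : ℝ}, 0 ≤ v → v ≤ u → u ≤ 1 → 0 < u → x ≤ 1 → x - y = v / u →
      x + y = 3 - (u + v) → x = 1 ∧ u = 1 ∧ y = 1 - v := by
    intro x y u v hv hvu hu hu0 hx h1 h2
    have h3 : (x - y) * u = v := by rw [h1]; field_simp
    -- The two relations add up to a formula for `2 * x`; inserting it in `x ≤ 1` and multiplying by
    -- `u` gives this.
    have h4 : (1 - u) * (u + v) ≤ 0 := by nlinarith
    have h5 : u = 1 := by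
      by_contra hne
      have : u < 1 := lt_of_le_of_ne hu hne
      nlinarith
    subst h5
    refine ⟨?_, rfl, ?_⟩ <;> linarith
  have ratio : ∀ {u v : ℝ}, 0 ≤ v → v ≤ u → 0 < u → 0 ≤ v / u ∧ v / u ≤ 1 := by
    intro u v hv hvu hu
    exact ⟨div_nonneg hv hu.le, (div_le_one hu).2 hvu⟩
  have hslot : c.kiteAngle i a b ≤ c.mid i ∧ c.mid (i - 1) ≤ c.kiteAngle i a b := by
    rcases le_total b a with h | h
    · rw [kiteAngle_of_le h]; constructor <;> nlinarith
    · rw [kiteAngle_of_ge h]; constructor <;> nlinarith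
  rw [← hθ] at hc
  have hcase : j = i ∨ j = i - 1 := by
    rcases lt_trichotomy j i with h | h | h
    · right
      by_contra hne
      have h1 : (c.s (j + 1) : ℝ) ≤ c.s (i - 1) := Int.cast_le.2 (c.mono.monotone (by omega))
      linarith
    · exact Or.inl h
    · exfalso
      have h1 : (c.s (i + 1) : ℝ) ≤ c.s j := Int.cast_le.2 (c.mono.monotone (by omega))
      linarith
  rcases hcase with rfl | rfl
  · left
    refine ⟨rfl, ?_⟩
    have hba : b ≤ a := by
      by_contra! h
      rw [kiteAngle_of_ge h.le] at hc
      nlinarith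
    have hba' : b' ≤ a' := by
      by_contra! h
      have h0 : 0 < b' := lt_of_le_of_lt ha' h
      rw [core_ge h.le h0, kiteAngle_of_le hba, ← m1, ← m1'] at hθ
      have h1 : c.half j * ((a - b) + a' / b' - 2) = 0 := by linarith
      have h2 : (a - b) + a' / b' - 2 = 0 := (mul_eq_zero.1 h1).resolve_left hi.ne'
      have h3 : a' / b' < 1 := (div_lt_one h0).2 h
      linarith
    have h0 : 0 < a' := ha0.elim id fun h => lt_of_lt_of_le h hba'
    rw [core_le hba' h0, kiteAngle_of_le hba] at hθ
    exact right hb' hba' ha1' h0 ha1 (mul_left_cancel₀ hi.ne' (by linarith)) hs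
  · right
    rw [sub_add_cancel] at n2 hc core_ge
    refine ⟨rfl, ?_⟩
    have hba : a ≤ b := by
      by_contra! h
      rw [kiteAngle_of_le h.le] at hc
      nlinarith
    have hba' : a' ≤ b' := by
      by_contra! h
      have h0 : 0 < a' := lt_of_le_of_lt hb' h
      rw [core_le h.le h0, kiteAngle_of_ge hba, ← m2, ← m2'] at hθ
      have h1 : c.half (i - 1) * ((b - a) + b' / a' - 2) = 0 := by linarith
      have h2 : (b - a) + b' / a' - 2 = 0 := (mul_eq_zero.1 h1).resolve_left hi'.ne'
      have h3 : b' / a' < 1 := (div_lt_one h0).2 h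
      linarith
    have h0 : 0 < b' := ha0.elim (fun h => lt_of_lt_of_le h hba') id
    rw [core_ge hba' h0, kiteAngle_of_ge hba] at hθ
    exact right ha' hba' hb1' h0 hb1 (mul_left_cancel₀ hi'.ne' (by linarith)) (by linarith)

/-- Away from the centre the angle depends only on the ratio of the coordinates and the radius only
on their sum, so within a slot both coordinates are determined. Neighbouring slots share only the
angle of the cut, where one coordinate vanishes in each. -/
theorem core_core {i j : ℤ} {a b a' b' : ℝ}
    (ha : 0 ≤ a) (hb : 0 ≤ b) (ha' : 0 ≤ a') (hb' : 0 ≤ b')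
    (hr : coreRadius a b = coreRadius a' b') (hr0 : coreRadius a b ≠ 0)
    (hθ : c.coreAngle i a b = c.coreAngle j a' b') :
    (i = j ∧ a = a' ∧ b = b') ∨ (j = i + 1 ∧ a = 0 ∧ b' = 0 ∧ a' = b) ∨
      (i = j + 1 ∧ a' = 0 ∧ b = 0 ∧ a = b') := by
  have hs : a + b = a' + b' := by unfold coreRadius at hr; linarith
  have hs0 : a + b ≠ 0 := fun h => hr0 (by unfold coreRadius; rw [h]; simp)
  have hpos : 0 < a + b := lt_of_le_of_ne (by linarith) (Ne.symm hs0)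
  have hm : ∀ {x y : ℝ}, 0 < x + y → 0 < max x y := by
    intro x y h
    rcases le_total x y with h' | h'
    · rw [max_eq_right h']; linarith
    · rw [max_eq_left h']; linarith
  have hM := hm hpos
  have hM' : 0 < max a' b' := hm (by linarith)
  have hi := c.half_pos i
  have end1 : ∀ {x y : ℝ} {n : ℤ}, 0 ≤ x → 0 ≤ y → 0 < max x y →
      c.coreAngle n x y = c.s (n + 1) → x = 0 := by
    intro x y n hx hy h0 h
    have hn := c.half_pos n
    unfold coreAngle at h
    rw [← c.mid_add_half, add_right_inj, div_eq_iff h0.ne'] at h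
    have := mul_left_cancel₀ hn.ne' h
    rcases le_total x y with h' | h'
    · rw [max_eq_right h'] at this; linarith
    · rw [max_eq_left h'] at this; linarith
  have end0 : ∀ {x y : ℝ} {n : ℤ}, 0 ≤ x → 0 ≤ y → 0 < max x y →
      c.coreAngle n x y = c.s n → y = 0 := by
    intro x y n hx hy h0 h
    have hn := c.half_pos n
    unfold coreAngle at h
    rw [← c.mid_sub_half, sub_eq_add_neg (c.mid n), add_right_inj, div_eq_iff h0.ne'] at h
    have := mul_left_cancel₀ hn.ne' (h.trans (by ring : _ = c.half n * (-max x y)))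
    rcases le_total x y with h' | h'
    · rw [max_eq_right h'] at this; linarith
    · rw [max_eq_left h'] at this; linarith
  have hc := c.coreAngle_mem_slot (i := i) ha hb
  have hc' := c.coreAngle_mem_slot (i := j) ha' hb'
  rcases c.slot_cases hc.1 hc.2 (hθ ▸ hc'.1) (hθ ▸ hc'.2) with rfl | ⟨rfl, h⟩ | ⟨rfl, h⟩
  · left
    refine ⟨rfl, ?_⟩
    unfold coreAngle at hθ
    rw [add_right_inj, div_eq_div_iff hM.ne' hM'.ne'] at hθ
    have h1 : (b - a) * max a' b' = (b' - a') * max a b :=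
      mul_left_cancel₀ hi.ne' (by linarith)
    rcases le_total a b with h | h <;> rcases le_total a' b' with h' | h'
    · rw [max_eq_right h, max_eq_right h'] at h1
      have : (a + b) * (a - a') = 0 := by
        have e : b' = a + b - a' := by linarith
        rw [e] at h1; linarith
      have := (mul_eq_zero.1 this).resolve_left hs0
      constructor <;> linarith
    · rw [max_eq_right h, max_eq_left h'] at h1
      rw [max_eq_right h] at hM
      rw [max_eq_left h'] at hM'
      have : b - a ≤ 0 := by nlinarith
      have : a' - b' ≤ 0 := by nlinarith
      constructor <;> linarith
    · rw [max_eq_left h, max_eq_right h'] at h1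
      rw [max_eq_left h] at hM
      rw [max_eq_right h'] at hM'
      have : a - b ≤ 0 := by nlinarith
      have : b' - a' ≤ 0 := by nlinarith
      constructor <;> linarith
    · rw [max_eq_left h, max_eq_left h'] at h1
      have : (a + b) * (a - a') = 0 := by
        have e : b' = a + b - a' := by linarith
        rw [e] at h1; linarith
      have := (mul_eq_zero.1 this).resolve_left hs0
      constructor <;> linarith
  · right; left
    have h1 := end1 ha hb hM h
    have h2 := end0 ha' hb' hM' (hθ ▸ h)
    exact ⟨rfl, h1, h2, by linarith⟩
  · right; right
    have h1 := end0 ha hb hM h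
    have h2 := end1 ha' hb' hM' (hθ ▸ h)
    exact ⟨rfl, h2, h1, by linarith⟩

end CutSeq

/-! ### Labels along sides, and membership in a square from labels. -/

section Segment

variable {Λ : Type*}

/-- The labels of the end points of the smallest face, containing `t`, of a labelled interval. -/
def segLabels (l m : Λ) (t : unitInterval) : Set Λ := {x | (t ≠ 1 ∧ x = l) ∨ (t ≠ 0 ∧ x = m)}

theorem segLabels_symm (l m : Λ) (t : unitInterval) :
    segLabels l m (unitInterval.symm t) = segLabels m l t := by
  ext x
  have h1 : unitInterval.symm t ≠ 1 ↔ t ≠ 0 := by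
    rw [Ne, Ne, unitInterval.symm_eq_one]
  have h0 : unitInterval.symm t ≠ 0 ↔ t ≠ 1 := by
    rw [Ne, Ne, unitInterval.symm_eq_zero]
  simp only [segLabels, mem_ofPred_eq, h1, h0, or_comm]

theorem carrier_endpt_left (lab : Bool → Bool → Λ) (β : Bool) (b : unitInterval) :
    carrier lab (endpt β) b = segLabels (lab β false) (lab β true) b := by
  ext x
  simp only [carrier, near_endpt_iff, segLabels, mem_ofPred_eq, Bool.exists_bool]
  cases β <;> simp [Near, endpt, eq_comm]

theorem carrier_endpt_right (lab : Bool → Bool → Λ) (a : unitInterval) (γ : Bool) :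
    carrier lab a (endpt γ) = segLabels (lab false γ) (lab true γ) a := by
  ext x
  simp only [carrier, near_endpt_iff, segLabels, mem_ofPred_eq, Bool.exists_bool]
  cases γ <;> simp [Near, endpt, eq_comm]

theorem image_segLabels {Λ' : Type*} (f : Λ → Λ') (l m : Λ) (t : unitInterval) :
    f '' segLabels l m t = segLabels (f l) (f m) t := by
  ext x
  constructor
  · rintro ⟨y, ⟨h, rfl⟩ | ⟨h, rfl⟩, rfl⟩
    exacts [Or.inl ⟨h, rfl⟩, Or.inr ⟨h, rfl⟩]
  · rintro (⟨h, rfl⟩ | ⟨h, rfl⟩)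
    exacts [⟨_, Or.inl ⟨h, rfl⟩, rfl⟩, ⟨_, Or.inr ⟨h, rfl⟩, rfl⟩]

end Segment

theorem GraphEmbedding.isCarrier_arc {V : Type*} {G : SimpleGraph V} {M : Type*}
    [TopologicalSpace M] (E : GraphEmbedding G M) {u v : V} (h : G.Adj u v) (t : unitInterval) :
    E.IsCarrier (E.arc h t) (segLabels u v t) := by
  by_cases h0 : t = 0
  · subst h0
    left
    refine ⟨u, (E.arc h).source, ?_⟩
    ext x; simp [segLabels]
  · by_cases h1 : t = 1
    · subst h1
      left
      refine ⟨v, (E.arc h).target, ?_⟩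
      ext x; simp [segLabels]
    · right
      refine ⟨u, v, h, t, h0, h1, rfl, ?_⟩
      ext x; simp [segLabels, h0, h1]

/-- If the edges of labelled squares are determined by their labels, then a point of one square
lies in every other square that has all labels of its carrier. -/
theorem mem_square_of_carrier_subset {M ι Λ : Type*} {q : ι → unitInterval → unitInterval → M}
    {lab : ι → Bool → Bool → Λ} {col : Λ → Bool} {pos : Λ → M} {edge : Λ → Λ → Set M}
    (hcorner : ∀ i β γ, q i (endpt β) (endpt γ) = pos (lab i β γ))
    (hcol : ∀ i, Alternates col (lab i)) (hne : ∀ i β γ, lab i β γ ≠ lab i (!β) (!γ))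
    (hdiag : ∀ i j β γ β' γ', lab i β γ = lab j β' γ' →
      lab i (!β) (!γ) = lab j (!β') (!γ') → i = j)
    (hsymm : ∀ l m, edge l m = edge m l)
    (hfst : ∀ i γ, range (fun a => q i a (endpt γ)) = edge (lab i false γ) (lab i true γ))
    (hsnd : ∀ i β, range (fun b => q i (endpt β) b) = edge (lab i β false) (lab i β true))
    {i j : ι} (hij : i ≠ j) {a b : unitInterval}
    (h : ∀ l ∈ carrier (lab i) a b, ∃ β γ, lab j β γ = l) : ∃ a' b', q j a' b' = q i a b := by
  have hedge : ∀ {β γ β' γ'} {x : M}, col (lab j β γ) ≠ col (lab j β' γ') →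
      x ∈ edge (lab j β γ) (lab j β' γ') → ∃ a' b', q j a' b' = x := by
    intro β γ β' γ' x hc hx
    rcases (hcol j).eq_adj hc with ⟨rfl, rfl⟩ | ⟨rfl, rfl⟩
    · have hx' : x ∈ range fun a => q j a (endpt γ') := by
        rw [hfst]
        cases β
        · exact hx
        · rw [hsymm]; exact hx
      obtain ⟨t, ht⟩ := hx'
      exact ⟨_, _, ht⟩
    · have hx' : x ∈ range fun b => q j (endpt β') b := by
        rw [hsnd]
        cases γ
        · exact hx
        · rw [hsymm]; exact hx
      obtain ⟨t, ht⟩ := hx'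
      exact ⟨_, _, ht⟩
  rcases near_all_or_eq_endpt a with ha | ⟨β, rfl⟩ <;>
    rcases near_all_or_eq_endpt b with hb | ⟨γ, rfl⟩
  -- An inner point has all four corners in its carrier, among them a diagonal, which `j` cannot
  -- contain.
  · exact absurd (h _ ⟨_, _, ha _, hb _, rfl⟩) (not_opp_mem_range hcol hne hdiag hij true true
      (h _ ⟨_, _, ha _, hb _, rfl⟩))
  · obtain ⟨β₁, γ₁, h₁⟩ := h _ ⟨false, γ, ha _, near_endpt_iff.2 rfl, rfl⟩
    obtain ⟨β₂, γ₂, h₂⟩ := h _ ⟨true, γ, ha _, near_endpt_iff.2 rfl, rfl⟩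
    refine hedge (β := β₁) (γ := γ₁) (β' := β₂) (γ' := γ₂) ?_ ?_
    · rw [h₁, h₂]
      have := (hcol i false γ).1
      simp only [Bool.not_false] at this
      rw [this]; simp
    · rw [h₁, h₂, ← hfst]; exact ⟨a, rfl⟩
  · obtain ⟨β₁, γ₁, h₁⟩ := h _ ⟨β, false, near_endpt_iff.2 rfl, hb _, rfl⟩
    obtain ⟨β₂, γ₂, h₂⟩ := h _ ⟨β, true, near_endpt_iff.2 rfl, hb _, rfl⟩
    refine hedge (β := β₁) (γ := γ₁) (β' := β₂) (γ' := γ₂) ?_ ?_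
    · rw [h₁, h₂]
      have := (hcol i β false).2
      simp only [Bool.not_false] at this
      rw [this]; simp
    · rw [h₁, h₂, ← hsnd]; exact ⟨b, rfl⟩
  · obtain ⟨β₁, γ₁, h₁⟩ := h _ (by rw [carrier_endpt]; rfl)
    exact ⟨endpt β₁, endpt γ₁, by rw [hcorner, hcorner, h₁]⟩

/-! ### Cells of a cut face, their labels and their intersections. -/

namespace GraphEmbedding

variable {V : Type*} {G : SimpleGraph V} {M : Type*} [TopologicalSpace M]

/-- A face in polar coordinates, whose boundary cycle has been cut at vertices of colour `κ` into
simple paths. -/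
structure CutFace (E : GraphEmbedding G M) (col : V → Bool) (κ : Bool) (U : Set M)
    (w : ClosedWalk G) (k : ℕ) where
  polar : PolarFace E U w
  cuts : CutSeq w.len k
  col_ne : ∀ u v, G.Adj u v → col u ≠ col v
  col_cut : ∀ i, col (w.vertex (cuts.s i : ℤ)) = κ
  simple : ∀ i a b : ℤ, cuts.s i ≤ a → a ≤ cuts.s (i + 1) → cuts.s i ≤ b → b ≤ cuts.s (i + 1) →
    w.vertex (a : ZMod w.len) = w.vertex (b : ZMod w.len) → a = b
  disjoint : ∀ x ∈ U, x ∉ E.image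

end GraphEmbedding

/-- The squares in a cut face: fans of squares from the apex of a slot to its boundary path, a kite
at each cut, and squares at the centre of the face. -/
inductive Cell
  | fan (i p : ℤ)
  | kite (i : ℤ)
  | core (i : ℤ)

namespace GraphEmbedding.CutFace

variable {V : Type*} {G : SimpleGraph V} {M : Type*} [TopologicalSpace M]
  {E : GraphEmbedding G M} {col : V → Bool} {κ : Bool} {U : Set M} {w : ClosedWalk G} {k : ℕ}
  (F : CutFace E col κ U w k)

/-- The label of the apex of slot `i`. -/
def apex (k : ℕ) (i : ℤ) : V ⊕ (ZMod k ⊕ ZMod k ⊕ Unit) := Sum.inr (Sum.inl i)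

/-- The label of the inner vertex at the cut `i`. -/
def inner (k : ℕ) (i : ℤ) : V ⊕ (ZMod k ⊕ ZMod k ⊕ Unit) := Sum.inr (Sum.inr (Sum.inl i))

/-- The label of the centre. -/
def centre (k : ℕ) : V ⊕ (ZMod k ⊕ ZMod k ⊕ Unit) := Sum.inr (Sum.inr (Sum.inr ()))

/-- The label of the boundary position `n`. -/
def bd (w : ClosedWalk G) (k : ℕ) (n : ℤ) : V ⊕ (ZMod k ⊕ ZMod k ⊕ Unit) :=
  Sum.inl (w.vertex (n : ZMod w.len))

/-- A square with prescribed corner labels. -/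
def corners {Λ : Type*} (l₀₀ l₁₀ l₀₁ l₁₁ : Λ) (β γ : Bool) : Λ :=
  bif β then (bif γ then l₁₁ else l₁₀) else (bif γ then l₀₁ else l₀₀)

/-- The corner labels of a cell. -/
def lab : Cell → Bool → Bool → V ⊕ (ZMod k ⊕ ZMod k ⊕ Unit)
  | .fan i p => corners (apex k i) (bd w k p) (bd w k (p + 2)) (bd w k (p + 1))
  | .kite i => corners (bd w k (F.cuts.s i)) (apex k i) (apex k (i - 1)) (inner k i)
  | .core i => corners (centre k) (inner k i) (inner k (i + 1)) (apex k i)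

/-- The angle of a point of a cell. -/
noncomputable def angle : Cell → ℝ → ℝ → ℝ
  | .fan i p => F.cuts.fanAngle i p
  | .kite i => F.cuts.kiteAngle i
  | .core i => F.cuts.coreAngle i

/-- The radius of a point of a cell. -/
noncomputable def radius : Cell → ℝ → ℝ → ℝ
  | .fan _ _ => CutSeq.fanRadius
  | .kite _ => CutSeq.kiteRadius
  | .core _ => CutSeq.coreRadius

/-- The square of a cell. -/
noncomputable def square (C : Cell) (a b : unitInterval) : M :=
  F.polar.Φ (F.angle C a b) (radius C a b)

/-- The cell lies in its slot. -/
def Valid : Cell → Prop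
  | .fan i p => F.cuts.InSlot i p
  | _ => True

/-- Move a cell by `n` periods. -/
def shift (w : ClosedWalk G) (k : ℕ) (n : ℤ) : Cell → Cell
  | .fan i p => .fan (i + n * k) (p + n * w.len)
  | .kite i => .kite (i + n * k)
  | .core i => .core (i + n * k)

/-- The slot or cut of a cell. -/
def index : Cell → ℤ
  | .fan i _ => i
  | .kite i => i
  | .core i => i

theorem k_pos (F : CutFace E col κ U w k) : 0 < k := lt_of_lt_of_le (by norm_num) F.cuts.three_le

theorem apex_add (i n : ℤ) : (apex k (i + n * k) : V ⊕ _) = apex k i := by simp [apex]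

theorem inner_add (i n : ℤ) : (inner k (i + n * k) : V ⊕ _) = inner k i := by simp [inner]

theorem bd_add (p n : ℤ) : bd w k (p + n * w.len) = bd w k p := by simp [bd]

/-- Cells are indexed by all integers so that angles can be compared as real numbers, as on the
universal cover of the punctured disk. A shift by whole periods moves the angle by full turns and
changes neither labels nor squares. -/
theorem lab_shift (n : ℤ) (C : Cell) : F.lab (shift w k n C) = F.lab C := by
  cases C with
  | fan i p =>
    simp only [shift, lab]
    rw [apex_add, bd_add, show p + n * w.len + 2 = (p + 2) + n * w.len by ring, bd_add,
      show p + n * w.len + 1 = (p + 1) + n * w.len by ring, bd_add]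
  | kite i =>
    simp only [shift, lab]
    rw [F.cuts.s_add_mul, bd_add, apex_add, show i + n * k - 1 = (i - 1) + n * k by ring,
      apex_add, inner_add]
  | core i =>
    simp only [shift, lab]
    rw [inner_add, show i + n * k + 1 = (i + 1) + n * k by ring, apex_add, inner_add]

theorem angle_shift (n : ℤ) (C : Cell) (a b : ℝ) :
    F.angle (shift w k n C) a b = F.angle C a b + n * w.len := by
  cases C with
  | fan i p =>
    simp only [shift, angle, CutSeq.fanAngle, F.cuts.mid_add_mul]; push_cast; ring
  | kite i =>
    simp only [shift, angle, CutSeq.kiteAngle]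
    rw [show i + n * k - 1 = (i - 1) + n * k by ring, F.cuts.half_add_mul, F.cuts.half_add_mul,
      F.cuts.s_add_mul]
    push_cast; ring
  | core i =>
    simp only [shift, angle, CutSeq.coreAngle, F.cuts.mid_add_mul, F.cuts.half_add_mul]; ring

theorem radius_shift (n : ℤ) (C : Cell) : radius (shift w k n C) = radius C := by
  cases C <;> rfl

theorem square_shift (n : ℤ) (C : Cell) : F.square (shift w k n C) = F.square C := by
  funext a b
  simp only [square, angle_shift, radius_shift, F.polar.period]

theorem valid_shift (n : ℤ) {C : Cell} (h : F.Valid C) : F.Valid (shift w k n C) := by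
  cases C with
  | fan i p =>
    have h' : F.cuts.InSlot i p := h
    refine ⟨?_, ?_, ?_⟩
    · rw [F.cuts.s_add_mul]; linarith [h'.le]
    · rw [show i + n * k + 1 = (i + 1) + n * k by ring, F.cuts.s_add_mul]; linarith [h'.le']
    · rw [F.cuts.s_add_mul]; simpa using h'.even
  | kite i => trivial
  | core i => trivial

theorem shift_shift (m n : ℤ) (C : Cell) : shift w k m (shift w k n C) = shift w k (n + m) C := by
  cases C <;> simp only [shift] <;> congr 1 <;> ring

theorem shift_zero (C : Cell) : shift w k 0 C = C := by cases C <;> simp [shift]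

theorem index_shift (n : ℤ) (C : Cell) : index (shift w k n C) = index C + n * k := by
  cases C <;> rfl

theorem radius_bounds (C : Cell) (a b : unitInterval) :
    0 ≤ radius C a b ∧ radius C a b ≤ 1 := by
  have ha := a.2.1; have hb := b.2.1; have ha1 := a.2.2; have hb1 := b.2.2
  cases C
  · have h1 : (0 : ℝ) ≤ max (a : ℝ) b := ha.trans (le_max_left _ _)
    have h2 : max (a : ℝ) b ≤ 1 := max_le ha1 hb1
    simp only [radius, CutSeq.fanRadius]; constructor <;> linarith
  · simp only [radius, CutSeq.kiteRadius]; constructor <;> linarith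
  · simp only [radius, CutSeq.coreRadius]; constructor <;> linarith

theorem index_ne_of_mul_eq {F : CutFace E col κ U w k} {i n : ℤ} : i + n * k ≠ i + 1 := by
  intro h
  have h1 : n * k = 1 := by linarith
  have h3 : (3 : ℤ) ≤ k := by exact_mod_cast F.cuts.three_le
  have := Int.eq_one_or_neg_one_of_mul_eq_one' h1
  omega

/-- Cells that meet at a point induce the same carrier at that point. -/
def Compatible (C C' : Cell) (a b a' b' : unitInterval) : Prop :=
  carrier (F.lab C) a b = carrier (F.lab C') a' b' ∧
    ∀ n, C' = shift w k n C → a = a' ∧ b = b'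

theorem Compatible.symm {F : CutFace E col κ U w k} {C C' : Cell} {a b a' b' : unitInterval}
    (h : F.Compatible C C' a b a' b') : F.Compatible C' C a' b' a b := by
  refine ⟨h.1.symm, fun n hn => ?_⟩
  obtain ⟨h1, h2⟩ := h.2 (-n) (by rw [hn, shift_shift, add_neg_cancel, shift_zero])
  exact ⟨h1.symm, h2.symm⟩

theorem compatible_fan_fan {i p j p' : ℤ} (hp : F.cuts.InSlot i p) (hp' : F.cuts.InSlot j p')
    {a b a' b' : unitInterval} (hr : CutSeq.fanRadius a b = CutSeq.fanRadius a' b')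
    (hr1 : CutSeq.fanRadius a b < 1)
    (hθ : F.cuts.fanAngle i p a b = F.cuts.fanAngle j p' a' b') :
    F.Compatible (.fan i p) (.fan j p') a b a' b' := by
  obtain ⟨rfl, h⟩ := CutSeq.fan_fan hp hp' a.2.1 b.2.1 a'.2.1 b'.2.1 hr hr1 hθ
  have hk := F.k_pos
  have hshift : ∀ n, Cell.fan i p' = shift w k n (.fan i p) → p = p' := by
    intro n hn
    simp only [shift, Cell.fan.injEq] at hn
    have h0 : n * (k : ℤ) = 0 := by linarith [hn.1]
    have h1 : n = 0 := (mul_eq_zero.1 h0).resolve_right (by omega)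
    rw [h1] at hn; linarith [hn.2]
  rcases h with ⟨rfl, h1, h2⟩ | ⟨h1, h2, h3, h4⟩ | ⟨rfl, h1, h2, h3⟩ | ⟨rfl, h1, h2, h3⟩
  · obtain rfl := Subtype.ext h1
    obtain rfl := Subtype.ext h2
    exact ⟨rfl, fun _ _ => ⟨rfl, rfl⟩⟩
  · obtain rfl : a = endpt false := Subtype.ext h1
    obtain rfl : b = endpt false := Subtype.ext h2
    obtain rfl : a' = endpt false := Subtype.ext h3
    obtain rfl : b' = endpt false := Subtype.ext h4
    refine ⟨?_, fun _ _ => ⟨rfl, rfl⟩⟩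
    rw [carrier_endpt, carrier_endpt]; rfl
  · obtain rfl : a = endpt false := Subtype.ext h1
    obtain rfl : b' = endpt false := Subtype.ext h2
    obtain rfl := Subtype.ext h3
    refine ⟨?_, fun n hn => absurd (hshift n hn) (by omega)⟩
    rw [carrier_endpt_left, carrier_endpt_right]; rfl
  · obtain rfl : b = endpt false := Subtype.ext h1
    obtain rfl : a' = endpt false := Subtype.ext h2
    obtain rfl := Subtype.ext h3
    refine ⟨?_, fun n hn => absurd (hshift n hn) (by omega)⟩
    rw [carrier_endpt_left, carrier_endpt_right]; rfl

theorem compatible_fan_kite {i p j : ℤ} (hp : F.cuts.InSlot i p)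
    {a b a' b' : unitInterval} (hr : CutSeq.fanRadius a b = CutSeq.kiteRadius a' b')
    (hr1 : CutSeq.fanRadius a b < 1)
    (hθ : F.cuts.fanAngle i p a b = F.cuts.kiteAngle j a' b') :
    F.Compatible (.fan i p) (.kite j) a b a' b' := by
  refine ⟨?_, fun n hn => by simp [shift] at hn⟩
  rcases CutSeq.fan_kite hp a.2.1 b.2.1 a'.2.1 b'.2.1 a'.2.2 b'.2.2 hr hr1 hθ with
    ⟨rfl, h1, ⟨h2, h3, h4⟩ | ⟨rfl, h3, h4⟩⟩ | ⟨rfl, h1, ⟨h2, h3, h4⟩ | ⟨hp2, h3, h4⟩⟩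
  · obtain rfl : b' = endpt false := Subtype.ext h1
    obtain rfl : a = endpt false := Subtype.ext h2
    obtain rfl : b = endpt false := Subtype.ext h3
    obtain rfl : a' = endpt true := Subtype.ext h4
    rw [carrier_endpt, carrier_endpt]; rfl
  · obtain rfl : b' = endpt false := Subtype.ext h1
    obtain rfl : b = endpt false := Subtype.ext h3
    obtain rfl : a = unitInterval.symm a' := Subtype.ext h4
    rw [carrier_endpt_right, carrier_endpt_right, segLabels_symm]; rfl
  · obtain rfl : a' = endpt false := Subtype.ext h1
    obtain rfl : a = endpt false := Subtype.ext h2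
    obtain rfl : b = endpt false := Subtype.ext h3
    obtain rfl : b' = endpt true := Subtype.ext h4
    rw [carrier_endpt, carrier_endpt]
    simp [lab, corners]
  · obtain rfl : a' = endpt false := Subtype.ext h1
    obtain rfl : a = endpt false := Subtype.ext h3
    obtain rfl : b = unitInterval.symm b' := Subtype.ext h4
    rw [carrier_endpt_left, carrier_endpt_left, segLabels_symm]
    simp [lab, corners, hp2]

theorem compatible_fan_core {i p j : ℤ} (hp : F.cuts.InSlot i p)
    {a b a' b' : unitInterval} (hr : CutSeq.fanRadius a b = CutSeq.coreRadius a' b')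
    (hθ : F.cuts.fanAngle i p a b = F.cuts.coreAngle j a' b') :
    F.Compatible (.fan i p) (.core j) a b a' b' := by
  refine ⟨?_, fun n hn => by simp [shift] at hn⟩
  obtain ⟨rfl, h1, h2, h3, h4⟩ :=
    CutSeq.fan_core hp a.2.1 b.2.1 a.2.2 b.2.2 a'.2.2 b'.2.2 hr hθ
  obtain rfl : a = endpt false := Subtype.ext h1
  obtain rfl : b = endpt false := Subtype.ext h2
  obtain rfl : a' = endpt true := Subtype.ext h3
  obtain rfl : b' = endpt true := Subtype.ext h4
  rw [carrier_endpt, carrier_endpt]; rfl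

theorem compatible_kite_kite {i j : ℤ} {a b a' b' : unitInterval}
    (hr : CutSeq.kiteRadius a b = CutSeq.kiteRadius a' b')
    (hθ : F.cuts.kiteAngle i a b = F.cuts.kiteAngle j a' b') :
    F.Compatible (.kite i) (.kite j) a b a' b' := by
  have key : ∀ {i : ℤ} {a b a' b' : unitInterval}, (a : ℝ) = 1 → (b : ℝ) = 0 → (a' : ℝ) = 0 →
      (b' : ℝ) = 1 → F.Compatible (.kite i) (.kite (i + 1)) a b a' b' := by
    intro i a b a' b' h1 h2 h3 h4
    refine ⟨?_, fun n hn => ?_⟩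
    · obtain rfl : a = endpt true := Subtype.ext h1
      obtain rfl : b = endpt false := Subtype.ext h2
      obtain rfl : a' = endpt false := Subtype.ext h3
      obtain rfl : b' = endpt true := Subtype.ext h4
      rw [carrier_endpt, carrier_endpt]
      simp [lab, corners]
    · simp only [shift, Cell.kite.injEq] at hn
      exact absurd hn.symm (index_ne_of_mul_eq (F := F))
  rcases CutSeq.kite_kite a.2.1 b.2.1 a.2.2 b.2.2 a'.2.1 b'.2.1 a'.2.2 b'.2.2 hr hθ with
    ⟨rfl, h1, h2⟩ | ⟨rfl, h1, h2, h3, h4⟩ | ⟨rfl, h1, h2, h3, h4⟩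
  · obtain rfl := Subtype.ext h1
    obtain rfl := Subtype.ext h2
    exact ⟨rfl, fun _ _ => ⟨rfl, rfl⟩⟩
  · exact key h1 h2 h3 h4
  · exact (key h1 h2 h3 h4).symm

theorem compatible_kite_core {i j : ℤ} {a b a' b' : unitInterval}
    (hr : CutSeq.kiteRadius a b = CutSeq.coreRadius a' b')
    (hθ : F.cuts.kiteAngle i a b = F.cuts.coreAngle j a' b') :
    F.Compatible (.kite i) (.core j) a b a' b' := by
  refine ⟨?_, fun n hn => by simp [shift] at hn⟩
  rcases CutSeq.kite_core a.2.1 b.2.1 a.2.2 b.2.2 a'.2.1 b'.2.1 a'.2.2 b'.2.2 hr hθ with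
    ⟨rfl, h1, h2, h3⟩ | ⟨rfl, h1, h2, h3⟩
  · obtain rfl : a = endpt true := Subtype.ext h1
    obtain rfl : a' = endpt true := Subtype.ext h2
    obtain rfl : b = unitInterval.symm b' := Subtype.ext h3
    rw [carrier_endpt_left, carrier_endpt_left, segLabels_symm]; rfl
  · obtain rfl : b = endpt true := Subtype.ext h1
    obtain rfl : b' = endpt true := Subtype.ext h2
    obtain rfl : a = unitInterval.symm a' := Subtype.ext h3
    rw [carrier_endpt_right, carrier_endpt_right, segLabels_symm]
    simp [lab, corners]

theorem compatible_core_core {i j : ℤ} {a b a' b' : unitInterval}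
    (hr : CutSeq.coreRadius a b = CutSeq.coreRadius a' b')
    (hθ : CutSeq.coreRadius a b = 0 ∨ F.cuts.coreAngle i a b = F.cuts.coreAngle j a' b') :
    F.Compatible (.core i) (.core j) a b a' b' := by
  have key : ∀ {i : ℤ} {a b a' b' : unitInterval}, (a : ℝ) = 0 → (b' : ℝ) = 0 →
      (a' : ℝ) = b → F.Compatible (.core i) (.core (i + 1)) a b a' b' := by
    intro i a b a' b' h1 h2 h3
    refine ⟨?_, fun n hn => ?_⟩
    · obtain rfl : a = endpt false := Subtype.ext h1
      obtain rfl : b' = endpt false := Subtype.ext h2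
      obtain rfl := Subtype.ext h3
      rw [carrier_endpt_left, carrier_endpt_right]; rfl
    · simp only [shift, Cell.core.injEq] at hn
      exact absurd hn.symm (index_ne_of_mul_eq (F := F))
  by_cases h0 : CutSeq.coreRadius a b = 0
  · have h0' := hr ▸ h0
    unfold CutSeq.coreRadius at h0 h0'
    have ha := a.2.1; have hb := b.2.1; have ha' := a'.2.1; have hb' := b'.2.1
    obtain rfl : a = endpt false := Subtype.ext (by change (a : ℝ) = 0; linarith)
    obtain rfl : b = endpt false := Subtype.ext (by change (b : ℝ) = 0; linarith)
    obtain rfl : a' = endpt false := Subtype.ext (by change (a' : ℝ) = 0; linarith)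
    obtain rfl : b' = endpt false := Subtype.ext (by change (b' : ℝ) = 0; linarith)
    refine ⟨?_, fun _ _ => ⟨rfl, rfl⟩⟩
    rw [carrier_endpt, carrier_endpt]; rfl
  · rcases CutSeq.core_core a.2.1 b.2.1 a'.2.1 b'.2.1 hr h0 (hθ.resolve_left h0) with
      ⟨rfl, h1, h2⟩ | ⟨rfl, h1, h2, h3⟩ | ⟨rfl, h1, h2, h3⟩
    · obtain rfl := Subtype.ext h1
      obtain rfl := Subtype.ext h2
      exact ⟨rfl, fun _ _ => ⟨rfl, rfl⟩⟩
    · exact key h1 h2 h3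
    · exact (key h1 h2 h3).symm

/-- Collects the pairwise comparisons of cells. Radius zero occurs only in core squares, so the
angle can be disregarded only there, and there all core squares have the label of the centre. -/
theorem compatible_of_eq {C C' : Cell} (hC : F.Valid C) (hC' : F.Valid C')
    {a b a' b' : unitInterval} (hr : radius C a b = radius C' a' b') (hr1 : radius C a b < 1)
    (hθ : radius C a b = 0 ∨ F.angle C a b = F.angle C' a' b') :
    F.Compatible C C' a b a' b' := by
  have hfan : ∀ a b : unitInterval, CutSeq.fanRadius a b ≠ 0 := by
    intro a b h
    have := a.2.1.trans (le_max_left (a : ℝ) b)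
    unfold CutSeq.fanRadius at h; linarith
  have hkite : ∀ a b : unitInterval, CutSeq.kiteRadius a b ≠ 0 := by
    intro a b h
    have := a.2.2; have := b.2.2
    unfold CutSeq.kiteRadius at h; linarith
  rcases C with ⟨i, p⟩ | i | i <;> rcases C' with ⟨j, p'⟩ | j | j <;>
    simp only [radius, angle] at hr hr1 hθ
  · exact F.compatible_fan_fan hC hC' hr hr1 (hθ.resolve_left (hfan _ _))
  · exact F.compatible_fan_kite hC hr hr1 (hθ.resolve_left (hfan _ _))
  · exact F.compatible_fan_core hC hr (hθ.resolve_left (hfan _ _))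
  · exact (F.compatible_fan_kite hC' hr.symm (hr ▸ hr1)
      (hθ.resolve_left (hkite _ _)).symm).symm
  · exact F.compatible_kite_kite hr (hθ.resolve_left (hkite _ _))
  · exact F.compatible_kite_core hr (hθ.resolve_left (hkite _ _))
  · exact (F.compatible_fan_core hC' hr.symm
      (hθ.resolve_left (hr ▸ hfan _ _)).symm).symm
  · exact (F.compatible_kite_core hr.symm (hθ.resolve_left (hr ▸ hkite _ _)).symm).symm
  · exact F.compatible_core_core hr hθ

end GraphEmbedding.CutFace

/-! ### The squares of a cut face: boundary values, injectivity, continuity, corners. -/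

namespace GraphEmbedding.CutFace

variable {V : Type*} {G : SimpleGraph V} {M : Type*} [TopologicalSpace M]
  {E : GraphEmbedding G M} {col : V → Bool} {κ : Bool} {U : Set M} {w : ClosedWalk G} {k : ℕ}
  (F : CutFace E col κ U w k)

theorem square_fan_left (i p : ℤ) (b : unitInterval) :
    F.square (.fan i p) (endpt true) b = E.arc (w.adj (p : ZMod w.len)) b := by
  rw [← F.polar.bdry]
  have h : max (1 : ℝ) b = 1 := max_eq_left b.2.2
  simp only [square, angle, radius, CutSeq.fanAngle, CutSeq.fanRadius, endpt, cond_true,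
    Set.Icc.coe_one, h]
  congr 1 <;> ring

theorem square_fan_top (i p : ℤ) (a : unitInterval) :
    F.square (.fan i p) a (endpt true) =
      E.arc (w.adj ((p + 1 : ℤ) : ZMod w.len)) (unitInterval.symm a) := by
  rw [← F.polar.bdry]
  have h : max (a : ℝ) 1 = 1 := max_eq_right a.2.2
  simp only [square, angle, radius, CutSeq.fanAngle, CutSeq.fanRadius, endpt, cond_true,
    Set.Icc.coe_one, h, unitInterval.coe_symm_eq]
  push_cast
  congr 1 <;> ring

theorem square_kite_zero (i : ℤ) :
    F.square (.kite i) (endpt false) (endpt false) =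
      E.vert (w.vertex (F.cuts.s i : ZMod w.len)) := by
  rw [← (E.arc (w.adj (F.cuts.s i : ZMod w.len))).source, ← F.polar.bdry]
  simp [square, angle, radius, CutSeq.kiteAngle, CutSeq.kiteRadius, endpt]

theorem bd_succ (p : ℤ) : bd w k (p + 1) = Sum.inl (w.vertex ((p : ZMod w.len) + 1)) := by
  simp [bd]

theorem bd_add_two (p : ℤ) :
    bd w k (p + 2) = Sum.inl (w.vertex (((p + 1 : ℤ) : ZMod w.len) + 1)) := by
  rw [← bd_succ]; congr 1; ring

/-- Each point of a cell lies in the open face or on the boundary of a fan or at a cut. -/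
theorem radius_lt_or (C : Cell) (a b : unitInterval) :
    radius C a b < 1 ∨ (∃ i p, C = .fan i p ∧ (a = endpt true ∨ b = endpt true)) ∨
      ∃ i, C = .kite i ∧ a = endpt false ∧ b = endpt false := by
  have ha := a.2.1; have hb := b.2.1; have ha1 := a.2.2; have hb1 := b.2.2
  rcases C with ⟨i, p⟩ | i | i
  · rcases eq_or_lt_of_le ha1 with h | h
    · exact Or.inr (Or.inl ⟨i, p, rfl, Or.inl (Subtype.ext h)⟩)
    · rcases eq_or_lt_of_le hb1 with h' | h'
      · exact Or.inr (Or.inl ⟨i, p, rfl, Or.inr (Subtype.ext h')⟩)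
      · left
        have := max_lt h h'
        simp only [radius, CutSeq.fanRadius]; linarith
  · by_cases h : (a : ℝ) + b = 0
    · refine Or.inr (Or.inr ⟨i, rfl, Subtype.ext ?_, Subtype.ext ?_⟩)
      · change (a : ℝ) = 0; linarith
      · change (b : ℝ) = 0; linarith
    · left
      have : 0 < (a : ℝ) + b := lt_of_le_of_ne (by linarith) (Ne.symm h)
      simp only [radius, CutSeq.kiteRadius]; linarith
  · left
    simp only [radius, CutSeq.coreRadius]; linarith

theorem square_mem {C : Cell} {a b : unitInterval} (h : radius C a b < 1) : F.square C a b ∈ U :=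
  F.polar.mem (radius_bounds C a b).1 h

theorem isCarrier_square_fan_left (i p : ℤ) (b : unitInterval) :
    ∃ S, E.IsCarrier (F.square (.fan i p) (endpt true) b) S ∧
      carrier (F.lab (.fan i p)) (endpt true) b = Sum.inl '' S := by
  refine ⟨_, F.square_fan_left i p b ▸ E.isCarrier_arc _ b, ?_⟩
  rw [carrier_endpt_left, image_segLabels, ← bd_succ (k := k)]; rfl

theorem isCarrier_square_fan_top (i p : ℤ) (a : unitInterval) :
    ∃ S, E.IsCarrier (F.square (.fan i p) a (endpt true)) S ∧
      carrier (F.lab (.fan i p)) a (endpt true) = Sum.inl '' S := by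
  refine ⟨_, F.square_fan_top i p a ▸ E.isCarrier_arc _ (unitInterval.symm a), ?_⟩
  rw [carrier_endpt_right, image_segLabels, segLabels_symm, ← bd_add_two (k := k)]; rfl

/-- A point of radius below 1 is in the open face, and its carrier has a new label: the apex in a
fan, one of three corners in a kite, any corner in a core square. The other points lie on the two
outer sides of a fan or at a cut. -/
theorem square_loc (C : Cell) (a b : unitInterval) :
    (F.square C a b ∈ U ∧ ∃ n, Sum.inr n ∈ carrier (F.lab C) a b) ∨
    ∃ S, E.IsCarrier (F.square C a b) S ∧ carrier (F.lab C) a b = Sum.inl '' S := by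
  rcases radius_lt_or C a b with h | ⟨i, p, rfl, rfl | rfl⟩ | ⟨i, rfl, rfl, rfl⟩
  · refine Or.inl ⟨F.square_mem h, ?_⟩
    rcases C with ⟨i, p⟩ | i | i
    · simp only [radius, CutSeq.fanRadius] at h
      have h1 := le_max_left (a : ℝ) b
      have h2 := le_max_right (a : ℝ) b
      refine ⟨_, false, false, fun e => ?_, fun e => ?_, rfl⟩
      · have : (a : ℝ) = 1 := congrArg Subtype.val e
        linarith
      · have : (b : ℝ) = 1 := congrArg Subtype.val e
        linarith
    · simp only [radius, CutSeq.kiteRadius] at h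
      by_cases ha : Near a true
      · obtain ⟨γ, hγ⟩ := exists_near b
        cases γ
        · exact ⟨_, true, false, ha, hγ, rfl⟩
        · exact ⟨_, true, true, ha, hγ, rfl⟩
      · have ha0 := eq_endpt_of_not_near ha
        have hb : Near b true := by
          intro e
          rw [ha0, e] at h
          simp [endpt] at h
        exact ⟨_, false, true, by rw [ha0]; exact near_endpt_iff.2 rfl, hb, rfl⟩
    · obtain ⟨β, hβ⟩ := exists_near a
      obtain ⟨γ, hγ⟩ := exists_near b
      cases β <;> cases γ <;> exact ⟨_, _, _, hβ, hγ, rfl⟩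
  · exact Or.inr (F.isCarrier_square_fan_left i p b)
  · exact Or.inr (F.isCarrier_square_fan_top i p a)
  · refine Or.inr ⟨_, F.square_kite_zero i ▸ E.isCarrier_vert _, ?_⟩
    rw [carrier_endpt, image_singleton]; rfl

theorem radius_lt_of_mem {C : Cell} {a b : unitInterval} (h : F.square C a b ∈ U) :
    radius C a b < 1 := by
  rcases radius_lt_or C a b with h' | ⟨i, p, rfl, rfl | rfl⟩ | ⟨i, rfl, rfl, rfl⟩
  · exact h'
  · rw [square_fan_left] at h
    exact absurd (E.isCarrier_arc _ _).mem_image (F.disjoint _ h)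
  · rw [square_fan_top] at h
    exact absurd (E.isCarrier_arc _ _).mem_image (F.disjoint _ h)
  · rw [square_kite_zero] at h
    exact absurd (E.isCarrier_vert _).mem_image (F.disjoint _ h)

/-- Equal points have equal radius and, off the centre, angles that differ by some number of full
turns. Shifting one cell by as many periods makes the angles equal as real numbers, and the
comparison of cells applies. -/
theorem square_meet {C C' : Cell} (hC : F.Valid C) (hC' : F.Valid C') {a b a' b' : unitInterval}
    (hU : F.square C a b ∈ U) (h : F.square C a b = F.square C' a' b') :
    carrier (F.lab C) a b = carrier (F.lab C') a' b' ∧ (C = C' → a = a' ∧ b = b') := by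
  have hr := F.radius_lt_of_mem hU
  have hr' := F.radius_lt_of_mem (h ▸ hU)
  obtain ⟨h1, h2⟩ := F.polar.inj (radius_bounds C a b).1 hr (radius_bounds C' a' b').1 hr' h
  have h3 : ∃ n : ℤ, radius C a b = 0 ∨ F.angle C' a' b' = F.angle C a b + n * w.len := by
    rcases h2 with h2 | ⟨n, hn⟩
    exacts [⟨0, Or.inl h2⟩, ⟨n, Or.inr hn⟩]
  obtain ⟨n, hn⟩ := h3
  have hcomp : F.Compatible (shift w k n C) C' a b a' b' := by
    refine F.compatible_of_eq (F.valid_shift n hC) hC' ?_ ?_ ?_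
    · rw [radius_shift]; exact h1
    · rw [radius_shift]; exact hr
    · rw [radius_shift, angle_shift]
      exact hn.imp id Eq.symm
  refine ⟨by rw [← hcomp.1, lab_shift], ?_⟩
  rintro rfl
  exact hcomp.2 (-n) (by rw [shift_shift, add_neg_cancel, shift_zero])

theorem vertex_ne {i p a b : ℤ} (hp : F.cuts.InSlot i p) (ha : p ≤ a) (ha' : a ≤ p + 2)
    (hb : p ≤ b) (hb' : b ≤ p + 2) (hab : a ≠ b) :
    w.vertex (a : ZMod w.len) ≠ w.vertex (b : ZMod w.len) := by
  have h1 := hp.le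
  have h2 := hp.le'
  exact fun h => hab (F.simple i a b (by omega) (by omega) (by omega) (by omega) h)

/-- The vertices at `p, p + 1, p + 2` are distinct because the slot is simple. A common point of the
two arcs has one carrier, which can contain neither the first nor the last of them, so the point is
the vertex between. -/
theorem fan_corner_eq {i p : ℤ} (hp : F.cuts.InSlot i p) {t t' : unitInterval}
    (h : E.arc (w.adj (p : ZMod w.len)) t = E.arc (w.adj ((p + 1 : ℤ) : ZMod w.len)) t') :
    t = 1 ∧ t' = 0 := by
  have hc := (E.isCarrier_arc (w.adj (p : ZMod w.len)) t).unique
    (h ▸ E.isCarrier_arc (w.adj ((p + 1 : ℤ) : ZMod w.len)) t')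
  have e1 : w.vertex ((p : ZMod w.len) + 1) = w.vertex ((p + 1 : ℤ) : ZMod w.len) := by
    push_cast; rfl
  have e2 : w.vertex (((p + 1 : ℤ) : ZMod w.len) + 1) = w.vertex ((p + 2 : ℤ) : ZMod w.len) := by
    congr 1; push_cast; ring
  have n01 := F.vertex_ne hp le_rfl (by omega) (by omega : p ≤ p + 1) (by omega) (by omega)
  have n02 := F.vertex_ne hp le_rfl (by omega) (by omega : p ≤ p + 2) (by omega) (by omega)
  have n12 := F.vertex_ne hp (by omega : p ≤ p + 1) (by omega) (by omega : p ≤ p + 2) (by omega)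
    (by omega)
  rw [e1, e2] at hc
  constructor
  · by_contra ht
    have : w.vertex (p : ZMod w.len) ∈ segLabels (w.vertex (p : ZMod w.len))
        (w.vertex ((p + 1 : ℤ) : ZMod w.len)) t := Or.inl ⟨ht, rfl⟩
    rw [hc] at this
    rcases this with ⟨-, h⟩ | ⟨-, h⟩
    exacts [n01 h, n02 h]
  · by_contra ht
    have : w.vertex ((p + 2 : ℤ) : ZMod w.len) ∈ segLabels (w.vertex ((p + 1 : ℤ) : ZMod w.len))
        (w.vertex ((p + 2 : ℤ) : ZMod w.len)) t' := Or.inr ⟨ht, rfl⟩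
    rw [← hc] at this
    rcases this with ⟨-, h⟩ | ⟨-, h⟩
    exacts [n02 h.symm, n12 h.symm]

theorem square_injective {C : Cell} (hC : F.Valid C) {a b a' b' : unitInterval}
    (h : F.square C a b = F.square C a' b') : a = a' ∧ b = b' := by
  by_cases hU : F.square C a b ∈ U
  · exact (F.square_meet hC hC hU h).2 rfl
  · have hU' : F.square C a' b' ∉ U := h ▸ hU
    have hr : ¬ radius C a b < 1 := fun h => hU (F.square_mem h)
    have hr' : ¬ radius C a' b' < 1 := fun h => hU' (F.square_mem h)
    rcases (radius_lt_or C a b).resolve_left hr with ⟨i, p, rfl, hab⟩ | ⟨i, rfl, rfl, rfl⟩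
    · rcases (radius_lt_or _ a' b').resolve_left hr' with ⟨_, _, h1, hab'⟩ | ⟨_, h1, -⟩
      · rcases hab with rfl | rfl <;> rcases hab' with rfl | rfl
        · rw [square_fan_left, square_fan_left] at h
          exact ⟨rfl, E.arc_injective _ h⟩
        · rw [square_fan_left, square_fan_top] at h
          obtain ⟨h2, h3⟩ := F.fan_corner_eq hC h
          exact ⟨(unitInterval.symm_eq_zero.1 h3).symm, h2⟩
        · rw [square_fan_left, square_fan_top] at h
          obtain ⟨h2, h3⟩ := F.fan_corner_eq hC h.symm
          exact ⟨unitInterval.symm_eq_zero.1 h3, h2.symm⟩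
        · rw [square_fan_top, square_fan_top] at h
          exact ⟨unitInterval.symm_bijective.injective (E.arc_injective _ h), rfl⟩
      · exact absurd h1 (by simp)
    · rcases (radius_lt_or _ a' b').resolve_left hr' with ⟨_, _, h1, -⟩ | ⟨_, h1, rfl, rfl⟩
      · exact absurd h1 (by simp)
      · exact ⟨rfl, rfl⟩

theorem continuous_square (C : Cell) :
    Continuous fun x : unitInterval × unitInterval => F.square C x.1 x.2 := by
  refine F.polar.cont (fun x => F.angle C x.1 x.2) (fun x => radius C x.1 x.2) ?_
    (fun x => radius_bounds C x.1 x.2) ?_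
  · cases C
    · simp only [radius, CutSeq.fanRadius]; fun_prop
    · simp only [radius, CutSeq.kiteRadius]; fun_prop
    · simp only [radius, CutSeq.coreRadius]; fun_prop
  · intro x hx
    cases C
    · refine Continuous.continuousAt ?_
      simp only [angle, CutSeq.fanAngle]; fun_prop
    · refine Continuous.continuousAt ?_
      simp only [angle, CutSeq.kiteAngle]; fun_prop
    · simp only [angle, CutSeq.coreAngle]
      simp only [radius, CutSeq.coreRadius] at hx
      -- The denominator of the core angle vanishes only at the centre, where continuity of the
      -- angle is not required.
      have hmax : max (x.1 : ℝ) x.2 ≠ 0 := by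
        intro h
        have h1 := le_max_left (x.1 : ℝ) x.2
        have h2 := le_max_right (x.1 : ℝ) x.2
        have h3 := x.1.2.1
        have h4 := x.2.2.1
        exact hx (by linarith)
      refine ContinuousAt.add continuousAt_const (ContinuousAt.div ?_ ?_ hmax)
      · exact Continuous.continuousAt (by fun_prop)
      · exact Continuous.continuousAt (by fun_prop)

/-- The positions of the new vertices. -/
noncomputable def newPos : ZMod k ⊕ ZMod k ⊕ Unit → M :=
  Sum.elim (fun i => F.polar.Φ (F.cuts.mid i.val) (2 / 3))
    (Sum.elim (fun i => F.polar.Φ (F.cuts.s i.val) (1 / 3)) fun _ => F.polar.Φ 0 0)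

theorem pos_apex (i : ℤ) :
    Sum.elim E.vert F.newPos (apex k i) = F.polar.Φ (F.cuts.mid i) (2 / 3) := by
  obtain ⟨j, hj⟩ := exists_int_cast_val F.k_pos i
  simp only [apex, newPos, Sum.elim_inr, Sum.elim_inl]
  rw [← F.polar.period _ _ j, ← F.cuts.mid_add_mul, ← hj]

theorem pos_inner (i : ℤ) :
    Sum.elim E.vert F.newPos (inner k i) = F.polar.Φ (F.cuts.s i) (1 / 3) := by
  obtain ⟨j, hj⟩ := exists_int_cast_val F.k_pos i
  simp only [inner, newPos, Sum.elim_inr, Sum.elim_inl]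
  rw [← F.polar.period _ _ j]
  have := F.cuts.s_add_mul ((i : ZMod k).val) j
  rw [← hj] at this
  rw [this]; push_cast; rfl

theorem square_corner (C : Cell) (β γ : Bool) :
    F.square C (endpt β) (endpt γ) = Sum.elim E.vert F.newPos (F.lab C β γ) := by
  rcases C with ⟨i, p⟩ | i | i
  · cases β <;> cases γ
    · change _ = Sum.elim E.vert F.newPos (apex k i)
      rw [pos_apex]
      simp [square, angle, radius, CutSeq.fanAngle, CutSeq.fanRadius, endpt]
    · rw [square_fan_top]
      change _ = Sum.elim E.vert F.newPos (bd w k (p + 2))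
      rw [bd_add_two]
      simp [endpt]
    · rw [square_fan_left]
      exact (E.arc _).source
    · rw [square_fan_left]
      change _ = Sum.elim E.vert F.newPos (bd w k (p + 1))
      rw [bd_succ]
      exact (E.arc _).target
  · cases β <;> cases γ
    · exact F.square_kite_zero i
    · change _ = Sum.elim E.vert F.newPos (apex k (i - 1))
      rw [pos_apex, ← sub_add_cancel (F.cuts.mid (i - 1)) (F.cuts.half (i - 1))]
      have h := F.cuts.mid_add_half (i - 1)
      rw [sub_add_cancel] at h
      simp only [square, angle, radius, CutSeq.kiteAngle, CutSeq.kiteRadius, endpt]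
      norm_num
      congr 1
      linarith
    · change _ = Sum.elim E.vert F.newPos (apex k i)
      rw [pos_apex]
      have h := F.cuts.mid_sub_half i
      simp only [square, angle, radius, CutSeq.kiteAngle, CutSeq.kiteRadius, endpt]
      norm_num
      congr 1
      linarith
    · change _ = Sum.elim E.vert F.newPos (inner k i)
      rw [pos_inner]
      simp only [square, angle, radius, CutSeq.kiteAngle, CutSeq.kiteRadius, endpt]
      norm_num
  · cases β <;> cases γ
    · change _ = F.polar.Φ 0 0
      simp only [square, angle, radius, CutSeq.coreAngle, CutSeq.coreRadius, endpt]
      norm_num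
      exact F.polar.zero _ _
    · change _ = Sum.elim E.vert F.newPos (inner k (i + 1))
      rw [pos_inner, ← F.cuts.mid_add_half]
      simp only [square, angle, radius, CutSeq.coreAngle, CutSeq.coreRadius, endpt]
      norm_num
    · change _ = Sum.elim E.vert F.newPos (inner k i)
      rw [pos_inner, ← F.cuts.mid_sub_half]
      simp only [square, angle, radius, CutSeq.coreAngle, CutSeq.coreRadius, endpt]
      norm_num [sub_eq_add_neg]
    · change _ = Sum.elim E.vert F.newPos (apex k i)
      rw [pos_apex]
      simp only [square, angle, radius, CutSeq.coreAngle, CutSeq.coreRadius, endpt]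
      norm_num

end GraphEmbedding.CutFace

/-! ### Sides of the cells as curves determined by their end labels. -/

namespace GraphEmbedding.CutFace

variable {V : Type*} {G : SimpleGraph V} {M : Type*} [TopologicalSpace M]
  {E : GraphEmbedding G M} {col : V → Bool} {κ : Bool} {U : Set M} {w : ClosedWalk G} {k : ℕ}
  (F : CutFace E col κ U w k)

/-- The edge from the apex of slot `i` to the boundary position `p`. -/
noncomputable def spoke (i p : ℤ) (t : unitInterval) : M :=
  F.polar.Φ (F.cuts.mid i + t * (p - F.cuts.mid i)) (2 / 3 + t / 3)

/-- The edge from the apex of slot `i` to the inner vertex at the cut `i`. -/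
noncomputable def leftRib (i : ℤ) (t : unitInterval) : M :=
  F.polar.Φ (F.cuts.mid i - t * F.cuts.half i) (2 / 3 - t / 3)

/-- The edge from the apex of slot `i` to the inner vertex at the cut `i + 1`. -/
noncomputable def rightRib (i : ℤ) (t : unitInterval) : M :=
  F.polar.Φ (F.cuts.mid i + t * F.cuts.half i) (2 / 3 - t / 3)

/-- The edge from the centre to the inner vertex at the cut `i`. -/
noncomputable def arm (i : ℤ) (t : unitInterval) : M := F.polar.Φ (F.cuts.s i) (t / 3)

/-- `γ` is the edge from the vertex labelled `l` to the vertex labelled `m`. -/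
def IsCurve (l m : V ⊕ (ZMod k ⊕ ZMod k ⊕ Unit)) (γ : unitInterval → M) : Prop :=
  (∃ i p, F.cuts.s i ≤ p ∧ p ≤ F.cuts.s (i + 1) ∧ l = apex k i ∧ m = bd w k p ∧
    γ = F.spoke i p) ∨
  (∃ i, l = apex k i ∧ m = inner k i ∧ γ = F.leftRib i) ∨
  (∃ i, l = apex k i ∧ m = inner k (i + 1) ∧ γ = F.rightRib i) ∨
  (∃ i, l = centre k ∧ m = inner k i ∧ γ = F.arm i) ∨
  ∃ (u v : V) (h : G.Adj u v), l = Sum.inl u ∧ m = Sum.inl v ∧ γ = E.arc h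

theorem exists_of_cast_eq {i j : ℤ} (h : (i : ZMod k) = j) : ∃ n : ℤ, j = i + n * k := by
  obtain ⟨n, hn⟩ := (ZMod.intCast_eq_intCast_iff_dvd_sub _ _ _).1 h
  exact ⟨n, by linarith⟩

theorem exists_of_vertex_eq {i p p' : ℤ} (h1 : F.cuts.s i ≤ p) (h2 : p ≤ F.cuts.s (i + 1))
    {n : ℤ} (h3 : F.cuts.s (i + n * k) ≤ p') (h4 : p' ≤ F.cuts.s (i + n * k + 1))
    (h : w.vertex (p : ZMod w.len) = w.vertex (p' : ZMod w.len)) : p' = p + n * w.len := by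
  rw [F.cuts.s_add_mul] at h3
  rw [show i + n * k + 1 = (i + 1) + n * k by ring, F.cuts.s_add_mul] at h4
  have := F.simple i p (p' - n * w.len) h1 h2 (by linarith) (by linarith) (by simpa using h)
  linarith

theorem spoke_add (i p n : ℤ) : F.spoke (i + n * k) (p + n * w.len) = F.spoke i p := by
  funext t
  unfold spoke
  refine Eq.trans ?_ (F.polar.period _ _ n)
  rw [F.cuts.mid_add_mul]
  congr 1; push_cast; ring

theorem leftRib_add (i n : ℤ) : F.leftRib (i + n * k) = F.leftRib i := by
  funext t
  unfold leftRib
  refine Eq.trans ?_ (F.polar.period _ _ n)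
  rw [F.cuts.mid_add_mul, F.cuts.half_add_mul]
  congr 1; ring

theorem rightRib_add (i n : ℤ) : F.rightRib (i + n * k) = F.rightRib i := by
  funext t
  unfold rightRib
  refine Eq.trans ?_ (F.polar.period _ _ n)
  rw [F.cuts.mid_add_mul, F.cuts.half_add_mul]
  congr 1; ring

theorem arm_add (i n : ℤ) : F.arm (i + n * k) = F.arm i := by
  funext t
  unfold arm
  refine Eq.trans ?_ (F.polar.period _ _ n)
  rw [F.cuts.s_add_mul]
  congr 1; push_cast; ring

theorem intCast_ne_zero {F : CutFace E col κ U w k} {m : ℤ} (h1 : 0 < m) (h2 : m < 3) :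
    (m : ZMod k) ≠ 0 := by
  intro h
  have h4 := Int.le_of_dvd h1 ((ZMod.intCast_zmod_eq_zero_iff_dvd m k).1 h)
  have h3 := F.cuts.three_le
  omega

theorem cast_ne_cast_add_one {F : CutFace E col κ U w k} {i : ℤ} :
    (i : ZMod k) ≠ ((i + 1 : ℤ) : ZMod k) := by
  intro h
  have := intCast_ne_zero (F := F) (m := 1) (by norm_num) (by norm_num)
  push_cast at h this
  exact this (left_eq_add.1 h)

theorem cast_ne_cast_add_two {F : CutFace E col κ U w k} {i : ℤ} :
    (i : ZMod k) ≠ ((i + 2 : ℤ) : ZMod k) := by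
  intro h
  have := intCast_ne_zero (F := F) (m := 2) (by norm_num) (by norm_num)
  push_cast at h this
  exact this (left_eq_add.1 h)

theorem apex_inj {i j : ℤ} : (apex k i : V ⊕ _) = apex k j ↔ (i : ZMod k) = j := by
  simp [apex]

theorem inner_inj {i j : ℤ} : (inner k i : V ⊕ _) = inner k j ↔ (i : ZMod k) = j := by
  simp [inner]

theorem bd_inj {p p' : ℤ} :
    bd w k p = bd w k p' ↔ w.vertex (p : ZMod w.len) = w.vertex (p' : ZMod w.len) := by
  simp [bd]

/-- The kinds of the two labels leave few candidates. Spokes from one apex have different ends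
because the slot is simple, the two ribs of an apex end at cuts that differ modulo `k`, and curves
that agree up to whole periods coincide. -/
theorem IsCurve.unique {F : CutFace E col κ U w k} {l m : V ⊕ (ZMod k ⊕ ZMod k ⊕ Unit)}
    {γ γ' : unitInterval → M} (h : F.IsCurve l m γ) (h' : F.IsCurve l m γ') : γ = γ' := by
  rcases h with ⟨i, p, h1, h2, rfl, rfl, rfl⟩ | ⟨i, rfl, rfl, rfl⟩ | ⟨i, rfl, rfl, rfl⟩ |
    ⟨i, rfl, rfl, rfl⟩ | ⟨u, v, h, rfl, rfl, rfl⟩ <;>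
  rcases h' with ⟨j, p', h1', h2', hl, hm, rfl⟩ | ⟨j, hl, hm, rfl⟩ | ⟨j, hl, hm, rfl⟩ |
    ⟨j, hl, hm, rfl⟩ | ⟨u', v', h', hl, hm, rfl⟩
  · obtain ⟨n, rfl⟩ := exists_of_cast_eq (apex_inj.1 hl)
    obtain rfl := F.exists_of_vertex_eq h1 h2 h1' h2' (bd_inj.1 hm)
    rw [spoke_add]
  · exact absurd hm (by simp [bd, inner])
  · exact absurd hm (by simp [bd, inner])
  · exact absurd hm (by simp [bd, inner])
  · exact absurd hl (by simp [apex])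
  · exact absurd hm (by simp [bd, inner])
  · obtain ⟨n, rfl⟩ := exists_of_cast_eq (apex_inj.1 hl)
    rw [leftRib_add]
  · rw [apex_inj] at hl
    rw [inner_inj, hl] at hm
    exact absurd hm (cast_ne_cast_add_one (F := F))
  · exact absurd hl (by simp [apex, centre])
  · exact absurd hl (by simp [apex])
  · exact absurd hm (by simp [bd, inner])
  · rw [apex_inj] at hl
    rw [inner_inj, ← hl] at hm
    exact absurd hm.symm (cast_ne_cast_add_one (F := F))
  · obtain ⟨n, rfl⟩ := exists_of_cast_eq (apex_inj.1 hl)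
    rw [rightRib_add]
  · exact absurd hl (by simp [apex, centre])
  · exact absurd hl (by simp [apex])
  · exact absurd hm (by simp [bd, inner])
  · exact absurd hl (by simp [apex, centre])
  · exact absurd hl (by simp [apex, centre])
  · obtain ⟨n, rfl⟩ := exists_of_cast_eq (inner_inj.1 hm)
    rw [arm_add]
  · exact absurd hl (by simp [centre])
  · exact absurd hl (by simp [apex])
  · exact absurd hl (by simp [apex])
  · exact absurd hl (by simp [apex])
  · exact absurd hl (by simp [centre])
  · obtain rfl := Sum.inl_injective hl
    obtain rfl := Sum.inl_injective hm
    rfl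

theorem IsCurve.range_eq_swap {F : CutFace E col κ U w k}
    {l m : V ⊕ (ZMod k ⊕ ZMod k ⊕ Unit)} {γ γ' : unitInterval → M} (h : F.IsCurve l m γ)
    (h' : F.IsCurve m l γ') : range γ = range γ' := by
  rcases h with ⟨i, p, h1, h2, rfl, rfl, rfl⟩ | ⟨i, rfl, rfl, rfl⟩ | ⟨i, rfl, rfl, rfl⟩ |
    ⟨i, rfl, rfl, rfl⟩ | ⟨u, v, h, rfl, rfl, rfl⟩ <;>
  rcases h' with ⟨j, p', h1', h2', hl, hm, rfl⟩ | ⟨j, hl, hm, rfl⟩ | ⟨j, hl, hm, rfl⟩ |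
    ⟨j, hl, hm, rfl⟩ | ⟨u', v', h', hl, hm, rfl⟩ <;>
  simp [apex, bd, inner, centre] at hl hm
  subst hl hm
  exact range_arc_eq h h' Sym2.eq_swap

/-- The edge between the vertices with given labels, as a set. -/
def edgeSet (l m : V ⊕ (ZMod k ⊕ ZMod k ⊕ Unit)) : Set M :=
  {x | ∃ γ, (F.IsCurve l m γ ∨ F.IsCurve m l γ) ∧ x ∈ range γ}

theorem edgeSet_symm (l m : V ⊕ (ZMod k ⊕ ZMod k ⊕ Unit)) :
    F.edgeSet l m = F.edgeSet m l := by
  unfold edgeSet; simp only [or_comm]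

theorem IsCurve.range_eq {F : CutFace E col κ U w k} {l m : V ⊕ (ZMod k ⊕ ZMod k ⊕ Unit)}
    {γ : unitInterval → M} (h : F.IsCurve l m γ) {f : unitInterval → M} (hf : ∀ t, f t = γ t) :
    range f = F.edgeSet l m := by
  rw [funext hf]
  ext x
  refine ⟨fun hx => ⟨γ, Or.inl h, hx⟩, ?_⟩
  rintro ⟨γ', h' | h', hx⟩
  · rwa [h.unique h']
  · rwa [h.range_eq_swap h']

theorem IsCurve.range_symm_eq {F : CutFace E col κ U w k}
    {l m : V ⊕ (ZMod k ⊕ ZMod k ⊕ Unit)} {γ : unitInterval → M} (h : F.IsCurve m l γ)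
    {f : unitInterval → M} (hf : ∀ t, f t = γ (unitInterval.symm t)) :
    range f = F.edgeSet l m := by
  rw [edgeSet_symm, ← h.range_eq fun _ => rfl, funext hf]
  exact unitInterval.symm_bijective.surjective.range_comp γ

theorem isCurve_arc_bd (p : ℤ) :
    F.IsCurve (bd w k p) (bd w k (p + 1)) (E.arc (w.adj (p : ZMod w.len))) := by
  rw [bd_succ]
  exact Or.inr (Or.inr (Or.inr (Or.inr ⟨_, _, w.adj _, rfl, rfl, rfl⟩)))

theorem isCurve_spoke {i p : ℤ} (h1 : F.cuts.s i ≤ p) (h2 : p ≤ F.cuts.s (i + 1)) :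
    F.IsCurve (apex k i) (bd w k p) (F.spoke i p) := Or.inl ⟨i, p, h1, h2, rfl, rfl, rfl⟩

theorem isCurve_leftRib (i : ℤ) : F.IsCurve (apex k i) (inner k i) (F.leftRib i) :=
  Or.inr (Or.inl ⟨i, rfl, rfl, rfl⟩)

theorem isCurve_rightRib (i : ℤ) : F.IsCurve (apex k i) (inner k (i + 1)) (F.rightRib i) :=
  Or.inr (Or.inr (Or.inl ⟨i, rfl, rfl, rfl⟩))

theorem isCurve_arm (i : ℤ) : F.IsCurve (centre k) (inner k i) (F.arm i) :=
  Or.inr (Or.inr (Or.inr (Or.inl ⟨i, rfl, rfl, rfl⟩)))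

theorem range_edge_fst {C : Cell} (hC : F.Valid C) (γ : Bool) :
    range (fun a => F.square C a (endpt γ)) = F.edgeSet (F.lab C false γ) (F.lab C true γ) := by
  rcases C with ⟨i, p⟩ | i | i
  · have hp : F.cuts.InSlot i p := hC
    cases γ
    · refine (F.isCurve_spoke hp.le (by linarith [hp.le'])).range_eq fun t => ?_
      have h : max (t : ℝ) 0 = t := max_eq_left t.2.1
      simp only [square, angle, radius, CutSeq.fanAngle, CutSeq.fanRadius, endpt, spoke,
        cond_false, Set.Icc.coe_zero, h]
      congr 1; ring
    · have h := F.isCurve_arc_bd (p + 1)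
      rw [show p + 1 + 1 = p + 2 by ring] at h
      exact h.range_symm_eq fun t => F.square_fan_top i p t
  · have m1 := F.cuts.mid_sub_half i
    have m2 := F.cuts.mid_add_half (i - 1)
    rw [sub_add_cancel] at m2
    cases γ
    · refine (F.isCurve_spoke le_rfl (F.cuts.mono (lt_add_one i)).le).range_symm_eq fun t => ?_
      have h := t.2.1
      simp only [square, angle, radius, CutSeq.kiteRadius, endpt, spoke, cond_false,
        Set.Icc.coe_zero, unitInterval.coe_symm_eq, CutSeq.kiteAngle_of_le h]
      rw [← m1]
      congr 1 <;> ring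
    · have h := F.isCurve_rightRib (i - 1)
      rw [sub_add_cancel] at h
      refine h.range_eq fun t => ?_
      simp only [square, angle, radius, CutSeq.kiteRadius, endpt, rightRib, cond_true,
        Set.Icc.coe_one, CutSeq.kiteAngle_of_ge t.2.2]
      rw [← m2]
      congr 1 <;> ring
  · cases γ
    · refine (F.isCurve_arm i).range_eq fun t => ?_
      have h : max (t : ℝ) 0 = t := max_eq_left t.2.1
      simp only [square, angle, radius, CutSeq.coreAngle, CutSeq.coreRadius, endpt, arm,
        cond_false, Set.Icc.coe_zero, h, add_zero]
      -- At the centre the angle formula degenerates to a division by zero, but there the angle is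
      -- irrelevant.
      by_cases ht : (t : ℝ) = 0
      · rw [ht, zero_div]; exact F.polar.zero _ _
      · rw [← F.cuts.mid_sub_half]
        congr 1; field_simp; ring
    · refine (F.isCurve_rightRib i).range_symm_eq fun t => ?_
      have h : max (t : ℝ) 1 = 1 := max_eq_right t.2.2
      simp only [square, angle, radius, CutSeq.coreAngle, CutSeq.coreRadius, endpt, rightRib,
        cond_true, Set.Icc.coe_one, h, unitInterval.coe_symm_eq]
      congr 1 <;> ring

theorem range_edge_snd {C : Cell} (hC : F.Valid C) (β : Bool) :
    range (fun b => F.square C (endpt β) b) = F.edgeSet (F.lab C β false) (F.lab C β true) := by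
  rcases C with ⟨i, p⟩ | i | i
  · have hp : F.cuts.InSlot i p := hC
    cases β
    · refine (F.isCurve_spoke (by linarith [hp.le]) hp.le').range_eq fun t => ?_
      have h : max 0 (t : ℝ) = t := max_eq_right t.2.1
      simp only [square, angle, radius, CutSeq.fanAngle, CutSeq.fanRadius, endpt, spoke,
        cond_false, Set.Icc.coe_zero, h]
      congr 1; push_cast; ring
    · exact (F.isCurve_arc_bd p).range_eq fun t => F.square_fan_left i p t
  · have m1 := F.cuts.mid_sub_half i
    have m2 := F.cuts.mid_add_half (i - 1)
    rw [sub_add_cancel] at m2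
    cases β
    · have hs : F.cuts.s (i - 1) ≤ F.cuts.s i := (F.cuts.mono (by linarith)).le
      refine (F.isCurve_spoke (i := i - 1) hs (by rw [sub_add_cancel])).range_symm_eq
        fun t => ?_
      simp only [square, angle, radius, CutSeq.kiteRadius, endpt, spoke, cond_false,
        Set.Icc.coe_zero, unitInterval.coe_symm_eq, CutSeq.kiteAngle_of_ge t.2.1]
      rw [← m2]
      congr 1 <;> ring
    · refine (F.isCurve_leftRib i).range_eq fun t => ?_
      simp only [square, angle, radius, CutSeq.kiteRadius, endpt, leftRib, cond_true,
        Set.Icc.coe_one, CutSeq.kiteAngle_of_le t.2.2]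
      rw [← m1]
      congr 1 <;> ring
  · cases β
    · refine (F.isCurve_arm (i + 1)).range_eq fun t => ?_
      have h : max 0 (t : ℝ) = t := max_eq_right t.2.1
      simp only [square, angle, radius, CutSeq.coreAngle, CutSeq.coreRadius, endpt, arm,
        cond_false, Set.Icc.coe_zero, h, zero_add]
      by_cases ht : (t : ℝ) = 0
      · rw [ht, zero_div]; exact F.polar.zero _ _
      · rw [← F.cuts.mid_add_half]
        congr 1; field_simp; ring
    · refine (F.isCurve_leftRib i).range_symm_eq fun t => ?_
      have h : max 1 (t : ℝ) = 1 := max_eq_left t.2.2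
      simp only [square, angle, radius, CutSeq.coreAngle, CutSeq.coreRadius, endpt, leftRib,
        cond_true, Set.Icc.coe_one, h, unitInterval.coe_symm_eq]
      congr 1 <;> ring

end GraphEmbedding.CutFace

/-! ### Colours, finiteness of the cells and uniqueness of diagonals. -/

namespace GraphEmbedding.CutFace

variable {V : Type*} {G : SimpleGraph V} {M : Type*} [TopologicalSpace M]
  {E : GraphEmbedding G M} {col : V → Bool} {κ : Bool} {U : Set M} {w : ClosedWalk G} {k : ℕ}
  (F : CutFace E col κ U w k)

theorem col_succ (F : CutFace E col κ U w k) (n : ℤ) :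
    col (w.vertex ((n + 1 : ℤ) : ZMod w.len)) = !col (w.vertex (n : ZMod w.len)) := by
  have h := F.col_ne _ _ (w.adj (n : ZMod w.len))
  push_cast
  exact Bool.eq_not_of_ne (Ne.symm h)

theorem col_of_even {i p : ℤ} (h : Even (p - F.cuts.s i)) :
    col (w.vertex (p : ZMod w.len)) = κ := by
  obtain ⟨d, hd⟩ := h
  have key : ∀ d : ℤ, col (w.vertex ((F.cuts.s i + (d + d) : ℤ) : ZMod w.len)) = κ := by
    intro d
    induction d using Int.induction_on with
    | zero => simpa using F.col_cut i
    | succ n ih =>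
      rw [show F.cuts.s i + ((n : ℤ) + 1 + (n + 1)) = F.cuts.s i + ((n : ℤ) + n) + 1 + 1 by ring,
        F.col_succ, F.col_succ, Bool.not_not, ih]
    | pred n ih =>
      rw [show F.cuts.s i + (-(n : ℤ) + -n) = F.cuts.s i + (-(n : ℤ) - 1 + (-n - 1)) + 1 + 1 by
        ring, F.col_succ, F.col_succ, Bool.not_not] at ih
      exact ih
  rw [show p = F.cuts.s i + (d + d) by linarith]
  exact key d

/-- The colours of the new vertices. -/
def newCol (κ : Bool) (k : ℕ) : ZMod k ⊕ ZMod k ⊕ Unit → Bool :=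
  Sum.elim (fun _ => !κ) (Sum.elim (fun _ => κ) fun _ => !κ)

theorem alternates_corners {Λ : Type*} {col : Λ → Bool} {l₀₀ l₁₀ l₀₁ l₁₁ : Λ} {c : Bool}
    (h₀₀ : col l₀₀ = c) (h₁₀ : col l₁₀ = !c) (h₀₁ : col l₀₁ = !c) (h₁₁ : col l₁₁ = c) :
    Alternates col (corners l₀₀ l₁₀ l₀₁ l₁₁) := by
  intro β γ
  cases β <;> cases γ <;> simp [corners, h₀₀, h₁₀, h₀₁, h₁₁]

theorem lab_alternates {C : Cell} (hC : F.Valid C) :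
    Alternates (Sum.elim col (newCol κ k)) (F.lab C) := by
  rcases C with ⟨i, p⟩ | i | i
  · have hp : F.cuts.InSlot i p := hC
    have h0 := F.col_of_even hp.even
    have h1 := F.col_succ p
    have h2 := F.col_succ (p + 1)
    rw [h1, h0, Bool.not_not, show p + 1 + 1 = p + 2 by ring] at h2
    rw [h0] at h1
    exact alternates_corners (c := !κ) rfl (by rw [Bool.not_not]; exact h0)
      (by rw [Bool.not_not]; exact h2) h1
  · exact alternates_corners (c := κ) (F.col_cut i) rfl rfl rfl
  · exact alternates_corners (c := !κ) rfl (by rw [Bool.not_not]; rfl)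
      (by rw [Bool.not_not]; rfl) rfl

theorem lab_ne_opp {C : Cell} (hC : F.Valid C) (β γ : Bool) :
    F.lab C β γ ≠ F.lab C (!β) (!γ) := by
  have key : F.lab C false false ≠ F.lab C true true ∧ F.lab C true false ≠ F.lab C false true := by
    rcases C with ⟨i, p⟩ | i | i
    · have hp : F.cuts.InSlot i p := hC
      refine ⟨by simp [lab, corners, apex, bd], fun h => ?_⟩
      exact F.vertex_ne hp le_rfl (by omega) (by omega : p ≤ p + 2) le_rfl (by omega) (bd_inj.1 h)
    · refine ⟨by simp [lab, corners, inner, bd], fun h => ?_⟩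
      have := cast_ne_cast_add_one (F := F) (i := i - 1)
      rw [sub_add_cancel] at this
      exact this (apex_inj.1 h).symm
    · exact ⟨by simp [lab, corners, apex, centre],
        fun h => cast_ne_cast_add_one (F := F) (inner_inj.1 h)⟩
  cases β <;> cases γ
  exacts [key.1, key.2.symm, key.2, key.1.symm]

theorem index_eq_of_cast_eq {i j : ℤ} (hi : 0 ≤ i) (hi' : i < k) (hj : 0 ≤ j) (hj' : j < k)
    (h : (i : ZMod k) = j) : i = j := by
  have := (ZMod.intCast_eq_intCast_iff i j k).1 h
  rwa [Int.ModEq, Int.emod_eq_of_lt hi hi', Int.emod_eq_of_lt hj hj'] at this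

/-- The cells in one period. -/
def Cells : Type := {C : Cell // F.Valid C ∧ 0 ≤ index C ∧ index C < k}

theorem exists_shift (F : CutFace E col κ U w k) (C : Cell) : ∃ n, 0 ≤ index (shift w k n C) ∧ index (shift w k n C) < k := by
  have hk : (0 : ℤ) < k := by exact_mod_cast F.k_pos
  refine ⟨-(index C / k), ?_⟩
  rw [index_shift]
  have h1 := Int.emod_add_mul_ediv (index C) k
  have h2 := Int.emod_nonneg (index C) hk.ne'
  have h3 := Int.emod_lt_of_pos (index C) hk
  constructor <;> linarith

theorem finite_cells : Finite F.Cells := by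
  have hfin : ((fun x : ℤ × ℤ => Cell.fan x.1 x.2) ''
      (Ico 0 (k : ℤ) ×ˢ Icc (F.cuts.s 0) (F.cuts.s k)) ∪
      (Cell.kite '' Ico 0 (k : ℤ) ∪ Cell.core '' Ico 0 (k : ℤ))).Finite :=
    (((finite_Ico _ _).prod (finite_Icc _ _)).image _).union
      (((finite_Ico _ _).image _).union ((finite_Ico _ _).image _))
  refine (hfin.subset ?_ : {C : Cell | F.Valid C ∧ 0 ≤ index C ∧ index C < k}.Finite)
  rintro (⟨i, p⟩ | i | i) ⟨hC, h0, hk⟩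
  · have hp : F.cuts.InSlot i p := hC
    have h1 := F.cuts.mono.monotone h0
    have h2 : F.cuts.s (i + 1) ≤ F.cuts.s k := F.cuts.mono.monotone (show i + 1 ≤ k from hk)
    have h3 := hp.le
    have h4 := hp.le'
    simp only [index] at h1
    exact Or.inl ⟨(i, p), ⟨⟨h0, hk⟩, by linarith, by linarith⟩, rfl⟩
  · exact Or.inr (Or.inl ⟨i, ⟨h0, hk⟩, rfl⟩)
  · exact Or.inr (Or.inr ⟨i, ⟨h0, hk⟩, rfl⟩)

/-- Excludes two core squares, or two kites, with the same diagonal read in opposite directions: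
that would give 2 = 0 modulo `k`. Here two cuts would not be enough. -/
theorem cross_false {F : CutFace E col κ U w k} {i j : ℤ} (h1 : (i : ZMod k) = ((j + 1 : ℤ) : ZMod k))
    (h2 : ((i + 1 : ℤ) : ZMod k) = j) : False := by
  apply cast_ne_cast_add_two (F := F) (i := j)
  rw [← h2]
  push_cast at h1 ⊢
  rw [h1]; ring

/-- The diagonals with a new end join apex and boundary (fan), cut and inner vertex or two apices
(kite), centre and apex or two inner vertices (core). These types are all different, so the cells
are of the same kind. For fans the apex gives the slot and simplicity the position; for the others
the labels give the index modulo `k`, up to the crossed case. -/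
theorem diag_new {C C' : Cell} (hC : F.Valid C) (hC' : F.Valid C') (h0 : 0 ≤ index C)
    (hk : index C < k) (h0' : 0 ≤ index C') (hk' : index C' < k) {β γ β' γ' : Bool}
    (hnew : ∀ u v, F.lab C β γ = Sum.inl u → F.lab C (!β) (!γ) ≠ Sum.inl v)
    (h1 : F.lab C β γ = F.lab C' β' γ') (h2 : F.lab C (!β) (!γ) = F.lab C' (!β') (!γ')) :
    C = C' := by
  have hfan : ∀ {i j p p' : ℤ}, F.cuts.InSlot i p → F.cuts.InSlot j p' → 0 ≤ i → i < k → 0 ≤ j →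
      j < k → (apex k i : V ⊕ _) = apex k j → bd w k (p + 1) = bd w k (p' + 1) →
      Cell.fan i p = Cell.fan j p' := by
    intro i j p p' hp hp' hi hi' hj hj' e1 e2
    obtain rfl := index_eq_of_cast_eq hi hi' hj hj' (apex_inj.1 e1)
    have a1 := hp.le; have a2 := hp.le'; have a3 := hp'.le; have a4 := hp'.le'
    have := F.simple i (p + 1) (p' + 1) (by omega) (by omega) (by omega) (by omega) (bd_inj.1 e2)
    rw [show p = p' by omega]
  rcases C with ⟨i, p⟩ | i | i <;> rcases C' with ⟨j, p'⟩ | j | j <;>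
    simp only [index] at h0 hk h0' hk' <;> cases β <;> cases γ <;> cases β' <;> cases γ' <;>
    simp only [lab, corners, cond_true, cond_false, Bool.not_true, Bool.not_false] at h1 h2 hnew
  all_goals first
    | exact hfan hC hC' h0 hk h0' hk' h1 h2
    | exact hfan hC hC' h0 hk h0' hk' h2 h1
    | exact absurd rfl (hnew _ _ rfl)
    | (exfalso; simp [apex, bd, inner, centre] at h1; done)
    | (exfalso; simp [apex, bd, inner, centre] at h2; done)
    | (rw [index_eq_of_cast_eq h0 hk h0' hk' (apex_inj.1 h1)])
    | (rw [index_eq_of_cast_eq h0 hk h0' hk' (apex_inj.1 h2)])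
    | (rw [index_eq_of_cast_eq h0 hk h0' hk' (inner_inj.1 h1)])
    | (rw [index_eq_of_cast_eq h0 hk h0' hk' (inner_inj.1 h2)])
    | exact (cross_false (F := F) (inner_inj.1 h1) (inner_inj.1 h2)).elim
    | exact (cross_false (F := F) (inner_inj.1 h2) (inner_inj.1 h1)).elim
    | exact (cross_false (F := F) (i := i - 1) (j := j - 1)
        (by rw [sub_add_cancel]; exact apex_inj.1 h2)
        (by rw [sub_add_cancel]; exact apex_inj.1 h1)).elim
    | exact (cross_false (F := F) (i := i - 1) (j := j - 1)
        (by rw [sub_add_cancel]; exact apex_inj.1 h1)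
        (by rw [sub_add_cancel]; exact apex_inj.1 h2)).elim

/-- The boundary position at which the corner labels of a cell start. -/
def start (w : ClosedWalk G) : Cell → ZMod w.len
  | .fan _ p => p
  | _ => 0

theorem diag_old {C : Cell} (hC : F.Valid C) {β γ : Bool} {u v : V}
    (h1 : F.lab C β γ = Sum.inl u) (h2 : F.lab C (!β) (!γ) = Sum.inl v) :
    (∃ i p, C = .fan i p) ∧ col u = κ ∧ s(u, v) = w.outerPair (start w C) := by
  rcases C with ⟨i, p⟩ | i | i
  · have hp : F.cuts.InSlot i p := hC
    refine ⟨⟨i, p, rfl⟩, ?_⟩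
    have hcol := F.col_of_even hp.even
    have hcol2 : col (w.vertex ((p + 2 : ℤ) : ZMod w.len)) = κ := by
      refine F.col_of_even (i := i) ?_
      rw [show p + 2 - F.cuts.s i = p - F.cuts.s i + 2 by ring]
      exact hp.even.add even_two
    have e : ((p + 2 : ℤ) : ZMod w.len) = (p : ZMod w.len) + 2 := by push_cast; rfl
    cases β <;> cases γ <;>
      simp only [lab, corners, cond_true, cond_false, Bool.not_true, Bool.not_false] at h1 h2
    · exact absurd h1 (by simp [apex])
    · obtain rfl := Sum.inl_injective h1
      obtain rfl := Sum.inl_injective h2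
      refine ⟨hcol2, ?_⟩
      rw [Sym2.eq_swap, e]; rfl
    · obtain rfl := Sum.inl_injective h1
      obtain rfl := Sum.inl_injective h2
      refine ⟨hcol, ?_⟩
      rw [e]; rfl
    · exact absurd h2 (by simp [apex])
  · exfalso
    cases β <;> cases γ <;>
      simp only [lab, corners, cond_true, cond_false, Bool.not_true, Bool.not_false, apex,
        inner, bd] at h1 h2 <;>
      first | (simp at h1; done) | simp at h2
  · exfalso
    cases β <;> cases γ <;>
      simp only [lab, corners, cond_true, cond_false, Bool.not_true, Bool.not_false, apex,
        inner, centre] at h1 h2 <;>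
      exact absurd h1 (by simp)

/-- After a shift by whole periods the two cells have the same position, and their slots then agree
because they share the middle position of the triple. -/
theorem fan_eq_of_start_eq {i p j p' : ℤ} (hp : F.cuts.InSlot i p) (hp' : F.cuts.InSlot j p')
    (h0 : 0 ≤ i) (hk : i < k) (h0' : 0 ≤ j) (hk' : j < k)
    (h : (p : ZMod w.len) = p') : Cell.fan i p = Cell.fan j p' := by
  obtain ⟨n, hn⟩ := (ZMod.intCast_eq_intCast_iff_dvd_sub _ _ _).1 h
  have hval : F.cuts.InSlot (i + n * k) (p + n * w.len) := F.valid_shift n (C := .fan i p) hp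
  have hp2 : p' = p + n * w.len := by linarith
  rw [← hp2] at hval
  have a1 := hval.le; have a2 := hval.le'; have a3 := hp'.le; have a4 := hp'.le'
  have hj : i + n * k = j := by
    -- The position `p' + 1` is strictly inside its slot, unlike `p'` and `p' + 2`, which may be
    -- cuts.
    refine F.cuts.slot_unique (θ := ((p' + 1 : ℤ) : ℝ)) ?_ ?_ ?_ ?_
    · exact Int.cast_lt.2 (by omega)
    · exact Int.cast_lt.2 (by omega)
    · exact Int.cast_le.2 (by omega)
    · exact Int.cast_le.2 (by omega)
  have hij : i = j := index_eq_of_cast_eq h0 hk h0' hk' (by rw [← hj]; simp)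
  have hk0 : (0 : ℤ) < k := by exact_mod_cast F.k_pos
  have hn0 : n = 0 := by
    have : n * (k : ℤ) = 0 := by linarith
    exact (mul_eq_zero.1 this).resolve_right hk0.ne'
  rw [hp2, hn0, hij]; simp

end GraphEmbedding.CutFace

/-! ### The cells cover the closed face. -/

namespace GraphEmbedding.CutFace

variable {V : Type*} {G : SimpleGraph V} {M : Type*} [TopologicalSpace M]
  {E : GraphEmbedding G M} {col : V → Bool} {κ : Bool} {U : Set M} {w : ClosedWalk G} {k : ℕ}
  (F : CutFace E col κ U w k)

theorem even_slot (i : ℤ) : Even (F.cuts.s (i + 1) - F.cuts.s i) := by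
  rw [← Int.not_odd_iff_even]
  rintro ⟨d, hd⟩
  have h1 := F.col_of_even (i := i) (p := F.cuts.s (i + 1) - 1) ⟨d, by linarith⟩
  have h2 := F.col_succ (F.cuts.s (i + 1) - 1)
  rw [sub_add_cancel, h1, F.col_cut] at h2
  cases κ <;> simp at h2

theorem exists_inSlot {i : ℤ} {y : ℝ} (h1 : F.cuts.s i ≤ y) (h2 : y ≤ F.cuts.s (i + 1)) :
    ∃ p, F.cuts.InSlot i p ∧ (p : ℝ) ≤ y ∧ y ≤ p + 2 := by
  have hlt := F.cuts.mono (lt_add_one i)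
  obtain ⟨e, he⟩ := F.even_slot i
  -- At the right end of the slot, rounding down would give a triple that starts at the cut, so the
  -- last triple is taken instead.
  rcases eq_or_lt_of_le h2 with h | h
  · refine ⟨F.cuts.s (i + 1) - 2, ⟨by omega, by omega, ⟨e - 1, by linarith⟩⟩, ?_, ?_⟩
    · rw [h]; push_cast; linarith
    · rw [h]; push_cast; linarith
  · set d : ℤ := ⌊(y - F.cuts.s i) / 2⌋ with hd
    have f1 : (d : ℝ) ≤ (y - F.cuts.s i) / 2 := Int.floor_le _
    have f2 : (y - F.cuts.s i) / 2 < d + 1 := Int.lt_floor_add_one _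
    have f0 : 0 ≤ d := Int.floor_nonneg.2 (by linarith)
    have f3 : F.cuts.s i + 2 * d < F.cuts.s (i + 1) := by
      have : ((F.cuts.s i + 2 * d : ℤ) : ℝ) < (F.cuts.s (i + 1) : ℤ) := by push_cast; linarith
      exact_mod_cast this
    refine ⟨F.cuts.s i + 2 * d, ⟨by omega, by omega, ⟨d, by ring⟩⟩, ?_, ?_⟩
    · push_cast; linarith
    · push_cast; linarith

/-- A pair of reals in the unit interval at which a cell has given polar coordinates. -/
theorem exists_square_of_coords {C : Cell} (hC : F.Valid C) {a b θ r : ℝ} (ha : 0 ≤ a)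
    (ha1 : a ≤ 1) (hb : 0 ≤ b) (hb1 : b ≤ 1) (hθ : F.angle C a b = θ) (hr : radius C a b = r) :
    ∃ C, F.Valid C ∧ ∃ a b : unitInterval, F.square C a b = F.polar.Φ θ r :=
  ⟨C, hC, ⟨a, ha, ha1⟩, ⟨b, hb, hb1⟩, by rw [← hθ, ← hr]; rfl⟩

theorem exists_square_fan {i : ℤ} {θ r : ℝ} (hr : 2 / 3 ≤ r) (hr1 : r ≤ 1)
    (h1 : F.cuts.mid i - (3 * r - 2) * F.cuts.half i ≤ θ)
    (h2 : θ ≤ F.cuts.mid i + (3 * r - 2) * F.cuts.half i) :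
    ∃ C, F.Valid C ∧ ∃ a b : unitInterval, F.square C a b = F.polar.Φ θ r := by
  obtain ⟨t, ht⟩ : ∃ t, t = 3 * r - 2 := ⟨_, rfl⟩
  have ht0 : 0 ≤ t := by linarith
  have ht1 : t ≤ 1 := by linarith
  rw [← ht] at h1 h2
  have m1 := F.cuts.mid_sub_half i
  have m2 := F.cuts.mid_add_half i
  have hh := F.cuts.half_pos i
  -- `y` is the boundary angle at which the ray from the apex through the point arrives in the
  -- coordinates of angle and radius. At the apex itself, `t = 0`, any `y` in the slot will do.
  obtain ⟨y, hy1, hy2, hy⟩ : ∃ y : ℝ, F.cuts.s i ≤ y ∧ y ≤ F.cuts.s (i + 1) ∧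
      θ = F.cuts.mid i + t * (y - F.cuts.mid i) := by
    rcases eq_or_lt_of_le ht0 with h | h
    · refine ⟨F.cuts.mid i, by linarith, by linarith, ?_⟩
      rw [← h] at h1 h2 ⊢
      linarith
    · refine ⟨F.cuts.mid i + (θ - F.cuts.mid i) / t, ?_, ?_, by field_simp; ring⟩
      · have : -F.cuts.half i ≤ (θ - F.cuts.mid i) / t := by
          rw [le_div_iff₀ h]; linarith
        linarith
      · have : (θ - F.cuts.mid i) / t ≤ F.cuts.half i := by
          rw [div_le_iff₀ h]; linarith
        linarith
  obtain ⟨p, hp, hp1, hp2⟩ := F.exists_inSlot hy1 hy2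
  have d1 : t * (y - p - 1) ≤ t := by nlinarith
  have d2 : -t ≤ t * (y - p - 1) := by nlinarith
  rcases le_total 0 (t * (y - p - 1)) with hd | hd
  · have hmax : max (t - t * (y - p - 1)) t = t := max_eq_right (by linarith)
    refine F.exists_square_of_coords (C := .fan i p) hp (a := t - t * (y - p - 1)) (b := t)
      (by linarith) (by linarith) ht0 ht1 ?_ ?_
    · simp only [angle, CutSeq.fanAngle, hmax]; rw [hy]; ring
    · simp only [radius, CutSeq.fanRadius, hmax]; linarith
  · have hmax : max t (t + t * (y - p - 1)) = t := max_eq_left (by linarith)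
    refine F.exists_square_of_coords (C := .fan i p) hp (a := t) (b := t + t * (y - p - 1))
      ht0 ht1 (by linarith) (by linarith) ?_ ?_
    · simp only [angle, CutSeq.fanAngle, hmax]; rw [hy]; ring
    · simp only [radius, CutSeq.fanRadius, hmax]; linarith

/-- Let `δ` be the distance of the angle to the nearer end of its slot, in units of the half slot.
Along this ray the core square reaches up to radius `(1 + δ) / 3`, the kite from there to `1 - δ /
3`, and the fan from there to 1; the coordinates in each cell come from solving its linear
equations. -/
theorem exists_square (θ : ℝ) {r : ℝ} (hr : 0 ≤ r) (hr1 : r ≤ 1) :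
    ∃ C, F.Valid C ∧ ∃ a b : unitInterval, F.square C a b = F.polar.Φ θ r := by
  rcases eq_or_lt_of_le hr with rfl | h0
  · rw [F.polar.zero θ (F.angle (.core 0) 0 0)]
    exact F.exists_square_of_coords (C := .core 0) trivial (a := 0) (b := 0) le_rfl
      zero_le_one le_rfl zero_le_one rfl (by simp [radius, CutSeq.coreRadius])
  obtain ⟨i, h1, h2⟩ := F.cuts.exists_slot θ
  have m1 := F.cuts.mid_sub_half i
  have m2 := F.cuts.mid_add_half i
  have hh := F.cuts.half_pos i
  rcases le_total θ (F.cuts.mid i) with hm | hm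
  · obtain ⟨δ, hδ⟩ : ∃ δ, θ = F.cuts.s i + F.cuts.half i * δ :=
      ⟨(θ - F.cuts.s i) / F.cuts.half i, by field_simp; ring⟩
    have hδ0 : 0 ≤ δ := by
      by_contra! h
      nlinarith
    have hδ1 : δ ≤ 1 := by
      by_contra! h
      nlinarith
    by_cases c1 : r ≤ (1 + δ) / 3
    · have ha : 0 < 3 * r / (1 + δ) := by positivity
      have ha1 : 3 * r / (1 + δ) ≤ 1 := by rw [div_le_one (by linarith)]; linarith
      have hmax : max (3 * r / (1 + δ)) (δ * (3 * r / (1 + δ))) = 3 * r / (1 + δ) :=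
        max_eq_left (by nlinarith)
      refine F.exists_square_of_coords (C := .core i) trivial ha.le ha1
        (mul_nonneg hδ0 ha.le) (by nlinarith) ?_ ?_
      · simp only [angle, CutSeq.coreAngle, hmax]
        rw [hδ, ← m1]; field_simp; ring
      · simp only [radius, CutSeq.coreRadius]
        field_simp
    · by_cases c2 : r ≤ 1 - δ / 3
      · refine F.exists_square_of_coords (C := .kite i) trivial
          (a := (3 * (1 - r) + δ) / 2) (b := (3 * (1 - r) - δ) / 2)
          (by linarith) (by linarith) (by linarith) (by linarith) ?_ ?_
        · simp only [angle]
          rw [CutSeq.kiteAngle_of_le (by linarith), hδ]; ring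
        · simp only [radius, CutSeq.kiteRadius]; ring
      · refine F.exists_square_fan (i := i) (by linarith) hr1 ?_ ?_
        · rw [hδ, ← m1]; nlinarith
        · nlinarith
  · obtain ⟨δ, hδ⟩ : ∃ δ, θ = F.cuts.s (i + 1) - F.cuts.half i * δ :=
      ⟨(F.cuts.s (i + 1) - θ) / F.cuts.half i, by field_simp; ring⟩
    have hδ0 : 0 ≤ δ := by
      by_contra! h
      nlinarith
    have hδ1 : δ ≤ 1 := by
      by_contra! h
      nlinarith
    by_cases c1 : r ≤ (1 + δ) / 3
    · have ha : 0 < 3 * r / (1 + δ) := by positivity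
      have ha1 : 3 * r / (1 + δ) ≤ 1 := by rw [div_le_one (by linarith)]; linarith
      have hmax : max (δ * (3 * r / (1 + δ))) (3 * r / (1 + δ)) = 3 * r / (1 + δ) :=
        max_eq_right (by nlinarith)
      refine F.exists_square_of_coords (C := .core i) trivial
        (mul_nonneg hδ0 ha.le) (by nlinarith) ha.le ha1 ?_ ?_
      · simp only [angle, CutSeq.coreAngle, hmax]
        rw [hδ, ← m2]; field_simp; ring
      · simp only [radius, CutSeq.coreRadius]
        field_simp; ring
    · by_cases c2 : r ≤ 1 - δ / 3
      · refine F.exists_square_of_coords (C := .kite (i + 1)) trivial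
          (a := (3 * (1 - r) - δ) / 2) (b := (3 * (1 - r) + δ) / 2)
          (by linarith) (by linarith) (by linarith) (by linarith) ?_ ?_
        · simp only [angle]
          rw [CutSeq.kiteAngle_of_ge (by linarith), add_sub_cancel_right, hδ]; ring
        · simp only [radius, CutSeq.kiteRadius]; ring
      · refine F.exists_square_fan (i := i) (by linarith) hr1 ?_ ?_
        · nlinarith
        · rw [hδ, ← m2]; nlinarith

theorem diag_eq {C C' : Cell} (hC : F.Valid C) (hC' : F.Valid C') (h0 : 0 ≤ index C)
    (hk : index C < k) (h0' : 0 ≤ index C') (hk' : index C' < k) {β γ β' γ' : Bool} {u v u' v' : V}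
    (h1 : F.lab C β γ = Sum.inl u) (h2 : F.lab C (!β) (!γ) = Sum.inl v)
    (h1' : F.lab C' β' γ' = Sum.inl u') (h2' : F.lab C' (!β') (!γ') = Sum.inl v')
    (h : start w C = start w C') : C = C' := by
  obtain ⟨⟨i, p, rfl⟩, -⟩ := F.diag_old hC h1 h2
  obtain ⟨⟨j, p', rfl⟩, -⟩ := F.diag_old hC' h1' h2'
  exact fan_eq_of_start_eq F hC hC' h0 hk h0' hk' h

theorem edgeSet_inl {u v : V} (h : (F.edgeSet (Sum.inl u) (Sum.inl v)).Nonempty) :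
    ∃ h : G.Adj u v, range (E.arc h) = F.edgeSet (Sum.inl u) (Sum.inl v) := by
  have key : ∀ {u v : V} {γ : unitInterval → M}, F.IsCurve (Sum.inl u) (Sum.inl v) γ →
      G.Adj u v := by
    intro u v γ h
    rcases h with ⟨i, p, -, -, h1, -⟩ | ⟨i, h1, -⟩ | ⟨i, h1, -⟩ | ⟨i, h1, -⟩ | ⟨u', v', h, h1, h2, -⟩
    · exact absurd h1 (by simp [apex])
    · exact absurd h1 (by simp [apex])
    · exact absurd h1 (by simp [apex])
    · exact absurd h1 (by simp [centre])
    · obtain rfl := Sum.inl_injective h1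
      obtain rfl := Sum.inl_injective h2
      exact h
  have hadj : G.Adj u v := by
    obtain ⟨x, γ, hγ | hγ, -⟩ := h
    exacts [key hγ, (key hγ).symm]
  exact ⟨hadj, IsCurve.range_eq (F := F)
    (Or.inr (Or.inr (Or.inr (Or.inr ⟨u, v, hadj, rfl, rfl, rfl⟩)))) fun _ => rfl⟩

/-- The subdivision of a cut face into fans, kites and squares at the centre. -/
noncomputable def faceQuad (hw : Function.Injective w.outerPair) :
    FaceQuad E col κ U w where
  ι := F.Cells
  N := ZMod k ⊕ ZMod k ⊕ Unit
  finite_ι := F.finite_cells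
  fintype_N :=
    haveI : NeZero k := ⟨F.k_pos.ne'⟩
    inferInstance
  q C := F.square C.1
  lab C := F.lab C.1
  npos := F.newPos
  ncol := newCol κ k
  pos C := start w C.1
  cont C := F.continuous_square C.1
  inj C _ _ _ _ h := F.square_injective C.2.1 h
  corner C := F.square_corner C.1
  alternates C := F.lab_alternates C.2.1
  lab_ne C := F.lab_ne_opp C.2.1
  diag C C' β γ β' γ' hnew h1 h2 := Subtype.ext
    (F.diag_new C.2.1 C'.2.1 C.2.2.1 C.2.2.2 C'.2.2.1 C'.2.2.2 hnew h1 h2)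
  diag_old C β γ u v h1 h2 := (F.diag_old C.2.1 h1 h2).2
  diag_pos C C' β γ u v β' γ' u' v' h1 h2 h1' h2' h := Subtype.ext
    (F.diag_eq C.2.1 C'.2.1 C.2.2.1 C.2.2.2 C'.2.2.1 C'.2.2.2 h1 h2 h1' h2' h)
  loc C := F.square_loc C.1
  mem C C' hne a b hab := by
    constructor
    · rintro ⟨a', b', h⟩ l hl
      rw [(F.square_meet C.2.1 C'.2.1 hab h.symm).1] at hl
      obtain ⟨β, γ, -, -, rfl⟩ := hl
      exact ⟨β, γ, rfl⟩
    · refine mem_square_of_carrier_subset (q := fun C : F.Cells => F.square C.1)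
        (lab := fun C : F.Cells => F.lab C.1) (col := Sum.elim col (newCol κ k))
        (edge := F.edgeSet) (fun C => F.square_corner C.1) (fun C => F.lab_alternates C.2.1)
        (fun C => F.lab_ne_opp C.2.1) ?_ F.edgeSet_symm (fun C => F.range_edge_fst C.2.1)
        (fun C => F.range_edge_snd C.2.1) hne
      intro C C' β γ β' γ' h1 h2
      -- A diagonal with two old ends determines its position on the cycle because outer pairs are
      -- not repeated.
      by_cases hnew : ∀ u v, F.lab C.1 β γ = Sum.inl u → F.lab C.1 (!β) (!γ) ≠ Sum.inl v
      · exact Subtype.ext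
          (F.diag_new C.2.1 C'.2.1 C.2.2.1 C.2.2.2 C'.2.2.1 C'.2.2.2 hnew h1 h2)
      · push Not at hnew
        obtain ⟨u, v, hu, hv⟩ := hnew
        have hu' := h1 ▸ hu
        have hv' := h2 ▸ hv
        refine Subtype.ext (F.diag_eq C.2.1 C'.2.1 C.2.2.1 C.2.2.2 C'.2.2.1 C'.2.2.2 hu hv
          hu' hv' (hw ?_))
        rw [← (F.diag_old C.2.1 hu hv).2.2, ← (F.diag_old C'.2.1 hu' hv').2.2]
  edge_fst C γ u v hu hv := by
    have h := F.range_edge_fst C.2.1 γ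
    rw [hu, hv] at h
    obtain ⟨hadj, e⟩ := F.edgeSet_inl (u := u) (v := v) (h ▸ range_nonempty _)
    exact ⟨hadj, e.trans h.symm⟩
  edge_snd C β u v hu hv := by
    have h := F.range_edge_snd C.2.1 β
    rw [hu, hv] at h
    obtain ⟨hadj, e⟩ := F.edgeSet_inl (u := u) (v := v) (h ▸ range_nonempty _)
    exact ⟨hadj, e.trans h.symm⟩
  cover x hx := by
    obtain ⟨θ, r, hr, hr1, rfl⟩ := F.polar.cover x hx
    obtain ⟨C, hC, a, b, h⟩ := F.exists_square θ hr hr1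
    -- The cell is moved to the fundamental period without changing its square.
    obtain ⟨n, hn⟩ := exists_shift F C
    exact ⟨⟨shift w k n C, F.valid_shift n hC, hn⟩, a, b, by rw [← h, F.square_shift]⟩

end GraphEmbedding.CutFace

/-! ### Faces with a boundary cycle of length two: combinatorics of the 3-cube. -/

namespace CubeFace

/-- Fill in the coordinate `i.1` of a facet of the 3-cube. -/
def insert {α : Type*} (i : Fin 3 × Bool) (s a b : α) : Fin 3 → α :=
  i.1.insertNth (α := fun _ => α) s ![a, b]

/-- A point of the facet `i` of the 3-cube. -/
def point (i : Fin 3 × Bool) (a b : unitInterval) : Fin 3 → unitInterval :=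
  insert i (endpt i.2) a b

/-- A vertex of the facet `i` of the 3-cube. -/
def corner (i : Fin 3 × Bool) (β γ : Bool) : Fin 3 → Bool := insert i i.2 β γ

theorem insert_comp {α α' : Type*} (f : α → α') (i : Fin 3 × Bool) (s a b : α) :
    insert i (f s) (f a) (f b) = f ∘ insert i s a b := by
  obtain ⟨k, s'⟩ := i
  funext m
  fin_cases k <;> fin_cases m <;> rfl

theorem point_endpt (i : Fin 3 × Bool) (β γ : Bool) :
    point i (endpt β) (endpt γ) = endpt ∘ corner i β γ := insert_comp _ _ _ _ _

theorem point_injective {i : Fin 3 × Bool} {a b a' b' : unitInterval}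
    (h : point i a b = point i a' b') : a = a' ∧ b = b' := by
  obtain ⟨k, s⟩ := i
  have h0 := congrFun h (k.succAbove 0)
  have h1 := congrFun h (k.succAbove 1)
  simpa [point, insert] using And.intro h0 h1

theorem exists_point {P : Fin 3 → unitInterval} {i : Fin 3 × Bool} (h : P i.1 = endpt i.2) :
    ∃ a b, point i a b = P := by
  obtain ⟨k, s⟩ := i
  refine ⟨P (k.succAbove 0), P (k.succAbove 1), ?_⟩
  funext m
  refine k.succAboveCases ?_ (fun j => ?_) m
  · simpa [point, insert] using h.symm
  · fin_cases j <;> simp [point, insert]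

/-- The vertices of the smallest face of the 3-cube that contains a point. -/
def nearSet (P : Fin 3 → unitInterval) : Set (Fin 3 → Bool) := {ε | ∀ m, Near (P m) (ε m)}

/-- The carrier depends only on the point of the cube and not on the facet through which it is
reached, so facets that meet at a point agree about its labels. -/
theorem carrier_corner {Λ : Type*} (L : (Fin 3 → Bool) → Λ) (i : Fin 3 × Bool)
    (a b : unitInterval) :
    carrier (fun β γ => L (corner i β γ)) a b = L '' nearSet (point i a b) := by
  obtain ⟨k, s⟩ := i
  have hnear : ∀ β γ, corner (k, s) β γ ∈ nearSet (point (k, s) a b) ↔ Near a β ∧ Near b γ := by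
    intro β γ
    simp only [nearSet, mem_ofPred_eq, Fin.forall_iff_succAbove k, Fin.forall_fin_two]
    simp [point, corner, insert, near_endpt_iff]
  ext l
  constructor
  · rintro ⟨β, γ, hβ, hγ, rfl⟩
    exact ⟨_, (hnear β γ).2 ⟨hβ, hγ⟩, rfl⟩
  · rintro ⟨ε, hε, rfl⟩
    have hk : ε k = s := by
      have := hε k
      simpa [point, insert, near_endpt_iff] using this
    have e : ε = corner (k, s) (ε (k.succAbove 0)) (ε (k.succAbove 1)) := by
      funext m
      refine k.succAboveCases ?_ (fun j => ?_) m
      · simpa [corner, insert] using hk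
      · fin_cases j <;> simp [corner, insert]
    rw [e] at hε ⊢
    obtain ⟨h1, h2⟩ := (hnear _ _).1 hε
    exact ⟨_, _, h1, h2, rfl⟩

theorem corner_apply_self (i : Fin 3 × Bool) (β γ : Bool) : corner i β γ i.1 = i.2 := by
  obtain ⟨k, s⟩ := i
  simp [corner, insert]

theorem eq_endpt_of_nearSet_subset {P : Fin 3 → unitInterval} {i : Fin 3 × Bool}
    (h : ∀ ε ∈ nearSet P, ε i.1 = i.2) : P i.1 = endpt i.2 := by
  by_contra hne
  choose ε hε using fun m => exists_near (P m)
  have hmem : Function.update ε i.1 (!i.2) ∈ nearSet P := by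
    intro m
    by_cases hm : m = i.1
    · subst hm
      simpa [Near] using hne
    · simpa [hm] using hε m
  have := h _ hmem
  simp at this

/-- The vertices `000` and `100` of the 3-cube are labelled by two given vertices. -/
def label {V : Type*} (v₀ v₁ : V) (ε : Fin 3 → Bool) : V ⊕ (Fin 3 → Bool) :=
  if ε 1 = false ∧ ε 2 = false then Sum.inl (bif ε 0 then v₁ else v₀) else Sum.inr ε

theorem label_eq_inl {V : Type*} {v₀ v₁ v : V} {ε : Fin 3 → Bool}
    (h : label v₀ v₁ ε = Sum.inl v) :
    ε 1 = false ∧ ε 2 = false ∧ v = bif ε 0 then v₁ else v₀ := by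
  unfold label at h
  split_ifs at h with h'
  exact ⟨h'.1, h'.2, (Sum.inl_injective h).symm⟩

theorem label_injective {V : Type*} {v₀ v₁ : V} (hne : v₀ ≠ v₁) :
    Function.Injective (label v₀ v₁) := by
  intro ε ε' h
  by_cases h1 : ε 1 = false ∧ ε 2 = false
  · rw [label, if_pos h1] at h
    obtain ⟨h1', h2', h0⟩ := label_eq_inl h.symm
    have : ε 0 = ε' 0 := by
      cases h3 : ε 0 <;> cases h4 : ε' 0 <;> simp [h3, h4, hne, hne.symm] at h0 ⊢
    funext m
    fin_cases m
    exacts [this, h1.1.trans h1'.symm, h1.2.trans h2'.symm]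
  · rw [label, if_neg h1] at h
    unfold label at h
    split_ifs at h
    exact Sum.inr_injective h

/-- The colour of a vertex of the 3-cube, given the colour of `000`. -/
def colour (c : Bool) (ε : Fin 3 → Bool) : Bool := xor c (xor (ε 0) (xor (ε 1) (ε 2)))

theorem colour_label {V : Type*} {v₀ v₁ : V} {col : V → Bool} (h : col v₁ = !col v₀)
    (ε : Fin 3 → Bool) :
    Sum.elim col (colour (col v₀)) (label v₀ v₁ ε) = colour (col v₀) ε := by
  unfold label
  split_ifs with h'
  · simp only [Sum.elim_inl, colour, h'.1, h'.2]
    cases ε 0 <;> simp [h]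
  · rfl

theorem colour_corner (c : Bool) (i : Fin 3 × Bool) :
    Alternates (colour c) (corner i) := by
  revert c i
  unfold Alternates
  decide

theorem eq_of_corner_eq : ∀ (i j : Fin 3 × Bool) (β γ β' γ' : Bool),
    corner i β γ = corner j β' γ' → corner i (!β) (!γ) = corner j (!β') (!γ') → i = j := by
  decide

theorem corner_opp : ∀ (i : Fin 3 × Bool) (β γ : Bool), ¬ ((corner i β γ 1 = false ∧
    corner i β γ 2 = false) ∧ corner i (!β) (!γ) 1 = false ∧ corner i (!β) (!γ) 2 = false) := by
  decide

theorem corner_ne_opp : ∀ (i : Fin 3 × Bool) (β γ : Bool), corner i β γ ≠ corner i (!β) (!γ) := by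
  decide

theorem fst_eq_of_corner : ∀ (i : Fin 3 × Bool) (γ : Bool), corner i false γ 1 = false →
    corner i false γ 2 = false → corner i true γ 1 = false → corner i true γ 2 = false →
    (i = (1, false) ∨ i = (2, false)) ∧ γ = false := by
  decide

theorem snd_corner : ∀ (i : Fin 3 × Bool) (β : Bool), ¬ (corner i β false 1 = false ∧
    corner i β false 2 = false ∧ corner i β true 1 = false ∧ corner i β true 2 = false) := by
  decide

end CubeFace

open CubeFace in
/-- A subdivision of a face like the surface of a 3-cube, one of whose edges is an edge of `G`. -/
def GraphEmbedding.cubeFaceQuad {V : Type*} {G : SimpleGraph V} {M : Type*} [TopologicalSpace M]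
    (E : GraphEmbedding G M) {col : V → Bool} (κ : Bool) {U : Set M} (w : ClosedWalk G)
    {v₀ v₁ : V} (hadj : G.Adj v₀ v₁) (hcol : col v₁ = !col v₀) (Ψ : (Fin 3 → unitInterval) → M)
    (hcont : ∀ i, Continuous fun x : unitInterval × unitInterval => Ψ (point i x.1 x.2))
    (hinj : ∀ i j a b a' b', Ψ (point i a b) = Ψ (point j a' b') → point i a b = point j a' b')
    (harc : ∀ P : Fin 3 → unitInterval, P 1 = 0 → P 2 = 0 → Ψ P = E.arc hadj (P 0))
    (hmem : ∀ i a b, ¬ (point i a b 1 = 0 ∧ point i a b 2 = 0) → Ψ (point i a b) ∈ U)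
    (hcover : ∀ x ∈ closure U, ∃ i a b, Ψ (point i a b) = x) : FaceQuad E col κ U w where
  ι := Fin 3 × Bool
  N := Fin 3 → Bool
  finite_ι := inferInstance
  fintype_N := inferInstance
  q i a b := Ψ (point i a b)
  lab i β γ := label v₀ v₁ (corner i β γ)
  npos ε := Ψ (endpt ∘ ε)
  ncol := colour (col v₀)
  pos _ := 0
  cont := hcont
  inj i a b a' b' h := point_injective (hinj i i a b a' b' h)
  corner i β γ := by
    rw [point_endpt]
    unfold label
    split_ifs with h
    · rw [harc _ (by simp [h.1, endpt]) (by simp [h.2, endpt])]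
      simp only [Function.comp_apply, Sum.elim_inl]
      cases CubeFace.corner i β γ 0 <;> simp [endpt]
    · rfl
  alternates i := by
    intro β γ
    simp only [colour_label hcol]
    exact colour_corner _ i β γ
  lab_ne i β γ h := corner_ne_opp i β γ (label_injective hadj.ne h)
  diag i j β γ β' γ' _ h h' := eq_of_corner_eq i j β γ β' γ' (label_injective hadj.ne h)
    (label_injective hadj.ne h')
  -- The two old vertices of the cube are joined by an edge, so they are never opposite in a facet.
  diag_old i β γ u v h h' :=
    have e := label_eq_inl h
    have e' := label_eq_inl h'
    absurd ⟨⟨e.1, e.2.1⟩, e'.1, e'.2.1⟩ (corner_opp i β γ)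
  diag_pos i j β γ u v β' γ' u' v' h h' _ _ _ :=
    have e := label_eq_inl h
    have e' := label_eq_inl h'
    absurd ⟨⟨e.1, e.2.1⟩, e'.1, e'.2.1⟩ (corner_opp i β γ)
  loc i a b := by
    rw [carrier_corner]
    by_cases h : point i a b 1 = 0 ∧ point i a b 2 = 0
    · right
      refine ⟨_, harc _ h.1 h.2 ▸ E.isCarrier_arc hadj _, ?_⟩
      rw [image_segLabels]
      have h0 : ∀ ε, ε ∈ nearSet (point i a b) ↔
          Near (point i a b 0) (ε 0) ∧ ε 1 = false ∧ ε 2 = false := by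
        intro ε
        have hz : (0 : unitInterval) = endpt false := rfl
        simp only [nearSet, mem_ofPred_eq, Fin.forall_fin_succ, Fin.forall_fin_zero]
        simp [h.1, h.2, hz, near_endpt_iff]
      ext l
      constructor
      · rintro ⟨ε, hε, rfl⟩
        obtain ⟨e0, e1, e2⟩ := (h0 ε).1 hε
        rw [label, if_pos ⟨e1, e2⟩]
        cases e : ε 0 <;> rw [e] at e0
        · exact Or.inl ⟨e0, rfl⟩
        · exact Or.inr ⟨e0, rfl⟩
      · rintro (⟨e, rfl⟩ | ⟨e, rfl⟩)
        · exact ⟨fun _ => false, (h0 _).2 ⟨e, rfl, rfl⟩, by simp [label]⟩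
        · exact ⟨![true, false, false], (h0 _).2 ⟨e, rfl, rfl⟩, by simp [label]⟩
    · left
      refine ⟨hmem i a b h, ?_⟩
      choose ε hε using fun m => exists_near (point i a b m)
      -- Off the old edge the second or third coordinate is nonzero; a vertex of the carrier with
      -- that coordinate 1 has a new label.
      obtain ⟨m, hm, hm0⟩ : ∃ m : Fin 3, m ≠ 0 ∧ point i a b m ≠ 0 := by
        by_contra! hc
        exact h ⟨hc 1 (by decide), hc 2 (by decide)⟩
      refine ⟨Function.update ε m true, Function.update ε m true, fun m' => ?_, ?_⟩
      · by_cases e : m' = m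
        · subst e
          simpa [Near, endpt] using hm0
        · simpa [e] using hε m'
      · rw [label, if_neg]
        rintro ⟨h1, h2⟩
        fin_cases m
        exacts [hm rfl, by simp at h1, by simp at h2]
  mem i j _ a b _ := by
    rw [carrier_corner]
    constructor
    · rintro ⟨a', b', h⟩
      rw [← hinj _ _ _ _ _ _ h, ← carrier_corner]
      rintro _ ⟨β, γ, -, -, rfl⟩
      exact ⟨β, γ, rfl⟩
    · intro h
      have hj : point i a b j.1 = endpt j.2 := by
        refine eq_endpt_of_nearSet_subset fun ε hε => ?_
        obtain ⟨β, γ, e⟩ := h _ ⟨ε, hε, rfl⟩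
        rw [← label_injective hadj.ne e, corner_apply_self]
      obtain ⟨a', b', e⟩ := exists_point hj
      exact ⟨a', b', by rw [e]⟩
  edge_fst i γ u v hu hv := by
    obtain ⟨h1, h2, rfl⟩ := label_eq_inl hu
    obtain ⟨h1', h2', rfl⟩ := label_eq_inl hv
    obtain ⟨rfl | rfl, rfl⟩ := fst_eq_of_corner i γ h1 h2 h1' h2'
    · refine ⟨hadj, congrArg range (funext fun a => ?_)⟩
      rw [harc _ rfl rfl]; rfl
    · refine ⟨hadj, congrArg range (funext fun a => ?_)⟩
      rw [harc _ rfl rfl]; rfl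
  edge_snd i β u v hu hv := by
    obtain ⟨h1, h2, -⟩ := label_eq_inl hu
    obtain ⟨h1', h2', -⟩ := label_eq_inl hv
    exact absurd ⟨h1, h2, h1', h2'⟩ (snd_corner i β)
  cover := hcover

/-! ### Unfolding the surface of the cube, slit along one edge, onto the disk. -/

namespace CubeFace

/-- The distance from the edge `Y = Z = 0` of the 3-cube. -/
noncomputable def height (P : Fin 3 → unitInterval) : ℝ := max (P 1 : ℝ) (P 2)

/-- The coordinate on the disk along the edge `Y = Z = 0` of the 3-cube. -/
noncomputable def across (P : Fin 3 → unitInterval) : ℝ :=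
  P 0 * (1 - 2 * height P / 3) + height P / 3

/-- The coordinate on the disk around the edge `Y = Z = 0` of the 3-cube. -/
noncomputable def slant (P : Fin 3 → unitInterval) : ℝ :=
  -- The slit edge corresponds to both boundary arcs, slant 1 and slant -1. Choosing 1 is harmless,
  -- since the face map takes equal values at the two boundary points.
  if height P = 0 then 1 else (P 1 - P 2) * (1 / height P - 1 / 2)

/-- The point of the closed unit disk that divides a vertical chord in a given ratio. -/
noncomputable def disk (t y : ℝ) : ℂ := ⟨Real.cos (Real.pi * t), y * Real.sin (Real.pi * t)⟩

theorem height_nonneg (P : Fin 3 → unitInterval) : 0 ≤ height P :=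
  (P 1).2.1.trans (le_max_left _ _)

theorem height_le_one (P : Fin 3 → unitInterval) : height P ≤ 1 := max_le (P 1).2.2 (P 2).2.2

theorem height_eq_zero {P : Fin 3 → unitInterval} : height P = 0 ↔ P 1 = 0 ∧ P 2 = 0 := by
  constructor
  · intro h
    have h1 := le_max_left (P 1 : ℝ) (P 2)
    have h2 := le_max_right (P 1 : ℝ) (P 2)
    unfold height at h
    exact ⟨Subtype.ext (le_antisymm (h1.trans h.le) (P 1).2.1),
      Subtype.ext (le_antisymm (h2.trans h.le) (P 2).2.1)⟩
  · rintro ⟨h1, h2⟩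
    simp [height, h1, h2]

theorem le_across (P : Fin 3 → unitInterval) :
    height P / 3 ≤ across P ∧ across P ≤ 1 - height P / 3 := by
  have h0 := height_nonneg P
  have h1 := height_le_one P
  have h2 := (P 0).2.1
  have h3 := (P 0).2.2
  unfold across
  constructor <;> nlinarith

theorem abs_slant_le (P : Fin 3 → unitInterval) : |slant P| ≤ 1 - height P / 2 := by
  have h0 := height_nonneg P
  have h1 := height_le_one P
  unfold slant
  split_ifs with h
  · rw [h]; norm_num
  · have hpos : 0 < height P := lt_of_le_of_ne h0 (Ne.symm h)
    have e : 1 - height P / 2 = height P * (1 / height P - 1 / 2) := by field_simp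
    have h4 : 0 ≤ 1 / height P - 1 / 2 := by
      rw [sub_nonneg, div_le_div_iff₀ (by norm_num) hpos]; linarith
    rw [abs_mul, abs_of_nonneg h4, e]
    refine mul_le_mul_of_nonneg_right ?_ h4
    have h5 := (P 1).2.1
    have h6 := (P 2).2.1
    have h7 := le_max_left (P 1 : ℝ) (P 2)
    have h8 := le_max_right (P 1 : ℝ) (P 2)
    rw [abs_le]
    unfold height
    constructor <;> linarith

theorem abs_slant_eq {P : Fin 3 → unitInterval} (h : P 1 = 0 ∨ P 2 = 0) :
    |slant P| = 1 - height P / 2 := by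
  have h0 := height_nonneg P
  have h1 := height_le_one P
  have hd : |(P 1 : ℝ) - P 2| = height P := by
    rcases h with h | h
    · simp [h, height, abs_of_nonneg (P 2).2.1, (P 2).2.1]
    · simp [h, height, abs_of_nonneg (P 1).2.1, (P 1).2.1]
  unfold slant
  split_ifs with h
  · rw [h]; norm_num
  · have hpos : 0 < height P := lt_of_le_of_ne h0 (Ne.symm h)
    have h4 : 0 ≤ 1 / height P - 1 / 2 := by
      rw [sub_nonneg, div_le_div_iff₀ (by norm_num) hpos]; linarith
    rw [abs_mul, abs_of_nonneg h4, hd]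
    field_simp

/-- The distance from the edge `Y = Z = 0`, computed from the coordinates on the disk. -/
noncomputable def level (t y : ℝ) : ℝ := min (min 1 (3 * t)) (min (3 * (1 - t)) (2 * (1 - |y|)))

/-- In the coordinates `across` and `slant` the curves of constant height on the surface of the cube
become the boundaries of nested rectangles. Each facet realises one term of the minimum: the facets
of the first coordinate its left and right sides, those through the slit edge the bound on `|y|`,
and the remaining two the value 1. -/
theorem height_point (i : Fin 3 × Bool) (a b : unitInterval) :
    height (point i a b) = level (across (point i a b)) (slant (point i a b)) := by
  obtain ⟨P, hP⟩ : ∃ P, P = point i a b := ⟨_, rfl⟩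
  rw [← hP]
  have h1 := height_le_one P
  obtain ⟨h2, h3⟩ := le_across P
  have h4 := abs_slant_le P
  refine le_antisymm (le_min (le_min h1 (by linarith)) (le_min (by linarith) (by linarith))) ?_
  have hi : P i.1 = endpt i.2 := by rw [hP]; simp [point, insert]
  obtain ⟨k, s⟩ := i
  have hone : ∀ m, (m = 1 ∨ m = 2) → P m = 1 → level (across P) (slant P) ≤ height P := by
    intro m hm h
    refine (min_le_left _ _).trans ((min_le_left _ _).trans ?_)
    have : ((P m : unitInterval) : ℝ) = 1 := by rw [h]; rfl
    rw [← this]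
    rcases hm with rfl | rfl
    exacts [le_max_left _ _, le_max_right _ _]
  have hzero : (P 1 = 0 ∨ P 2 = 0) → level (across P) (slant P) ≤ height P := by
    intro h
    refine (min_le_right _ _).trans ((min_le_right _ _).trans ?_)
    rw [abs_slant_eq h]; linarith
  fin_cases k <;> cases s
  · refine (min_le_left _ _).trans ((min_le_right _ _).trans ?_)
    have : ((P 0 : unitInterval) : ℝ) = 0 := congrArg Subtype.val hi
    unfold across; rw [this]; linarith
  · refine (min_le_right _ _).trans ((min_le_left _ _).trans ?_)
    have : ((P 0 : unitInterval) : ℝ) = 1 := congrArg Subtype.val hi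
    unfold across; rw [this]; linarith
  · exact hzero (Or.inl hi)
  · exact hone 1 (Or.inl rfl) hi
  · exact hzero (Or.inr hi)
  · exact hone 2 (Or.inr rfl) hi

/-- Once the height is known, the two disk coordinates are linear in the first coordinate and in the
difference of the other two, with nonzero factors for heights in `(0, 1]`. -/
theorem eq_of_height_eq {P P' : Fin 3 → unitInterval} (h : height P = height P')
    (h0 : height P ≠ 0) (ht : across P = across P') (hy : slant P = slant P') : P = P' := by
  have hpos := lt_of_le_of_ne (height_nonneg P) (Ne.symm h0)
  have h1 := height_le_one P
  have e0 : ((P 0 : unitInterval) : ℝ) = P' 0 := by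
    unfold across at ht
    rw [← h] at ht
    exact mul_right_cancel₀ (b := 1 - 2 * height P / 3) (by linarith) (by linarith)
  have ed : (P 1 : ℝ) - P 2 = P' 1 - P' 2 := by
    unfold slant at hy
    rw [← h, if_neg h0, if_neg h0] at hy
    have h4 : 0 < 1 / height P - 1 / 2 := by
      rw [sub_pos, div_lt_div_iff₀ (by norm_num) hpos]; linarith
    exact mul_right_cancel₀ h4.ne' hy
  unfold height at h
  have e12 : (P 1 : ℝ) = P' 1 ∧ (P 2 : ℝ) = P' 2 := by
    rcases le_total (P 1 : ℝ) (P 2) with g | g <;> rcases le_total (P' 1 : ℝ) (P' 2) with g' | g' <;>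
      simp only [max_eq_left, max_eq_right, g, g'] at h <;> constructor <;> linarith
  funext m
  refine Subtype.ext ?_
  fin_cases m
  exacts [e0, e12.1, e12.2]

theorem exists_point_of_level {t y : ℝ} (h : 0 < level t y) :
    ∃ i a b, across (point i a b) = t ∧ slant (point i a b) = y := by
  obtain ⟨ρ, hρ⟩ : ∃ ρ, ρ = level t y := ⟨_, rfl⟩
  rw [← hρ] at h
  have l1 : ρ ≤ 1 := by rw [hρ]; exact (min_le_left _ _).trans (min_le_left _ _)
  have l2 : ρ ≤ 3 * t := by rw [hρ]; exact (min_le_left _ _).trans (min_le_right _ _)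
  have l3 : ρ ≤ 3 * (1 - t) := by rw [hρ]; exact (min_le_right _ _).trans (min_le_left _ _)
  have l4 : ρ ≤ 2 * (1 - |y|) := by rw [hρ]; exact (min_le_right _ _).trans (min_le_right _ _)
  -- The term that attains the minimum tells which facet contains the preimage.
  have hcase : ρ = 1 ∨ ρ = 3 * t ∨ ρ = 3 * (1 - t) ∨ ρ = 2 * (1 - |y|) := by
    rw [hρ, level]
    rcases min_choice (min 1 (3 * t)) (min (3 * (1 - t)) (2 * (1 - |y|))) with e | e <;> rw [e]
    · rcases min_choice 1 (3 * t) with e | e <;> rw [e] <;> simp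
    · rcases min_choice (3 * (1 - t)) (2 * (1 - |y|)) with e | e <;> rw [e] <;> simp
  have hden : 0 < 1 - 2 * ρ / 3 := by linarith
  have hden' : 0 < 1 / ρ - 1 / 2 := by
    rw [sub_pos, div_lt_div_iff₀ (by norm_num) h]; linarith
  obtain ⟨x, hx⟩ : ∃ x, x = (t - ρ / 3) / (1 - 2 * ρ / 3) := ⟨_, rfl⟩
  have hx' : x * (1 - 2 * ρ / 3) = t - ρ / 3 := by rw [hx, div_mul_cancel₀ _ hden.ne']
  obtain ⟨δ, hδ⟩ : ∃ δ, δ = y / (1 / ρ - 1 / 2) := ⟨_, rfl⟩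
  have hδ' : δ * (1 / ρ - 1 / 2) = y := by rw [hδ, div_mul_cancel₀ _ hden'.ne']
  have hδa : |δ| * (1 / ρ - 1 / 2) = |y| := by rw [← hδ', abs_mul, abs_of_pos hden']
  have hρδ : ρ * (1 / ρ - 1 / 2) = 1 - ρ / 2 := by field_simp
  have hδρ : |δ| ≤ ρ := by
    refine le_of_mul_le_mul_right ?_ hden'
    rw [hδa, hρδ]; linarith
  obtain ⟨d1, d2⟩ := abs_le.1 hδρ
  obtain ⟨Y, Z, hY0, hY1, hZ0, hZ1, hmax, hsub⟩ : ∃ Y Z : ℝ, 0 ≤ Y ∧ Y ≤ 1 ∧ 0 ≤ Z ∧ Z ≤ 1 ∧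
      max Y Z = ρ ∧ Y - Z = δ := by
    rcases le_total 0 δ with hd | hd
    · exact ⟨ρ, ρ - δ, by linarith, by linarith, by linarith, by linarith,
        max_eq_left (by linarith), by ring⟩
    · exact ⟨ρ + δ, ρ, by linarith, by linarith, by linarith, by linarith,
        max_eq_right (by linarith), by ring⟩
  have hx0 : 0 ≤ x := by rw [hx]; exact div_nonneg (by linarith) hden.le
  have hx1 : x ≤ 1 := by rw [hx, div_le_one hden]; linarith
  obtain ⟨P, hP0, hP1, hP2⟩ : ∃ P : Fin 3 → unitInterval, (P 0 : ℝ) = x ∧ (P 1 : ℝ) = Y ∧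
      (P 2 : ℝ) = Z := ⟨![⟨x, hx0, hx1⟩, ⟨Y, hY0, hY1⟩, ⟨Z, hZ0, hZ1⟩], rfl, rfl, rfl⟩
  have hh : height P = ρ := by rw [height, hP1, hP2, hmax]
  have hface : ∃ i : Fin 3 × Bool, P i.1 = endpt i.2 := by
    rcases hcase with e | e | e | e
    · rcases max_choice Y Z with e' | e'
      · exact ⟨(1, true), Subtype.ext (by rw [hP1, ← e', hmax, e]; rfl)⟩
      · exact ⟨(2, true), Subtype.ext (by rw [hP2, ← e', hmax, e]; rfl)⟩
    · exact ⟨(0, false), Subtype.ext (by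
        rw [hP0, hx, show t - ρ / 3 = 0 by linarith, zero_div]; rfl)⟩
    · exact ⟨(0, true), Subtype.ext (by
        rw [hP0, hx, show t - ρ / 3 = 1 - 2 * ρ / 3 by linarith, div_self hden.ne']; rfl)⟩
    · have hδe : |δ| = ρ := by
        refine mul_right_cancel₀ hden'.ne' ?_
        rw [hδa, hρδ]; linarith
      rcases le_total 0 δ with hd | hd
      · rw [abs_of_nonneg hd] at hδe
        exact ⟨(2, false), Subtype.ext (by
          rw [hP2]; change Z = 0
          have := le_max_left Y Z
          linarith)⟩
      · rw [abs_of_nonpos hd] at hδe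
        exact ⟨(1, false), Subtype.ext (by
          rw [hP1]; change Y = 0
          have := le_max_right Y Z
          linarith)⟩
  obtain ⟨i, hi⟩ := hface
  obtain ⟨a, b, rfl⟩ := exists_point hi
  refine ⟨i, a, b, ?_, ?_⟩
  · rw [across, hh, hP0, hx']; ring
  · rw [slant, hh, if_neg h.ne', hP1, hP2, hsub, hδ']

theorem norm_disk_sq (t y : ℝ) :
    ‖disk t y‖ ^ 2 = 1 - (1 - y ^ 2) * Real.sin (Real.pi * t) ^ 2 := by
  rw [← Complex.normSq_eq_norm_sq, Complex.normSq_mk]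
  have := Real.sin_sq_add_cos_sq (Real.pi * t)
  simp only [disk]
  linear_combination this

theorem disk_mem_closedBall (t : ℝ) {y : ℝ} (hy : |y| ≤ 1) :
    disk t y ∈ Metric.closedBall (0 : ℂ) 1 := by
  rw [mem_closedBall_zero_iff, ← abs_norm, abs_le_one_iff_mul_self_le_one, ← sq, norm_disk_sq]
  have := (sq_le_one_iff_abs_le_one y).2 hy
  nlinarith [sq_nonneg (Real.sin (Real.pi * t))]

theorem sin_pos {t : ℝ} (h0 : 0 < t) (h1 : t < 1) : 0 < Real.sin (Real.pi * t) :=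
  Real.sin_pos_of_pos_of_lt_pi (by positivity) (by nlinarith [Real.pi_pos])

theorem disk_mem_ball {t y : ℝ} (h0 : 0 < t) (h1 : t < 1) (hy : |y| < 1) :
    disk t y ∈ Metric.ball (0 : ℂ) 1 := by
  rw [mem_ball_zero_iff, ← sq_lt_one_iff₀ (norm_nonneg _), norm_disk_sq]
  have h2 := (sq_lt_one_iff_abs_lt_one y).2 hy
  have h3 := sin_pos h0 h1
  have : 0 < (1 - y ^ 2) * Real.sin (Real.pi * t) ^ 2 := mul_pos (by linarith) (by positivity)
  linarith

theorem disk_injective {t y t' y' : ℝ} (h0 : 0 < t) (h1 : t < 1) (h0' : 0 < t') (h1' : t' < 1)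
    (h : disk t y = disk t' y') : t = t' ∧ y = y' := by
  have hpi := Real.pi_pos
  have hre := congrArg Complex.re h
  have him := congrArg Complex.im h
  simp only [disk] at hre him
  have ht : Real.pi * t = Real.pi * t' := Real.injOn_cos ⟨by positivity, by nlinarith⟩
    ⟨by positivity, by nlinarith⟩ hre
  have ht' : t = t' := mul_left_cancel₀ hpi.ne' ht
  subst ht'
  exact ⟨rfl, mul_right_cancel₀ (sin_pos h0 h1).ne' him⟩

theorem exists_disk {z : ℂ} (hz : z ∈ Metric.closedBall (0 : ℂ) 1) :
    ∃ t y : ℝ, 0 ≤ t ∧ t ≤ 1 ∧ |y| ≤ 1 ∧ disk t y = z := by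
  have hpi := Real.pi_pos
  rw [mem_closedBall_zero_iff] at hz
  have hn : z.re ^ 2 + z.im ^ 2 ≤ 1 := by
    have := Complex.normSq_eq_norm_sq z
    rw [Complex.normSq_apply] at this
    nlinarith [norm_nonneg z]
  have hre := abs_le.1 ((sq_le_one_iff_abs_le_one z.re).1 (by nlinarith [sq_nonneg z.im]))
  have ht : Real.pi * (Real.arccos z.re / Real.pi) = Real.arccos z.re := by field_simp
  refine ⟨Real.arccos z.re / Real.pi, z.im / Real.sqrt (1 - z.re ^ 2),
    div_nonneg (Real.arccos_nonneg _) hpi.le, (div_le_one hpi).2 (Real.arccos_le_pi _), ?_, ?_⟩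
  · rw [abs_div, abs_of_nonneg (Real.sqrt_nonneg _)]
    refine div_le_one_of_le₀ ?_ (Real.sqrt_nonneg _)
    exact Real.abs_le_sqrt (by linarith)
  · unfold disk
    rw [ht, Real.cos_arccos hre.1 hre.2, Real.sin_arccos]
    by_cases h : Real.sqrt (1 - z.re ^ 2) = 0
    · have h1 := (Real.sqrt_eq_zero (by nlinarith [sq_nonneg z.im])).1 h
      have h2 : z.im = 0 := by nlinarith [sq_nonneg z.im]
      rw [h, mul_zero, ← h2]
    · rw [div_mul_cancel₀ _ h]

theorem disk_one (t : ℝ) : disk t 1 = Complex.exp ((Real.pi * t : ℝ) * Complex.I) := by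
  rw [Complex.exp_mul_I, ← Complex.ofReal_cos, ← Complex.ofReal_sin]
  apply Complex.ext <;> simp [disk, -Complex.ofReal_cos, -Complex.ofReal_sin]

theorem disk_neg_one (t : ℝ) : disk t (-1) = Complex.exp ((-(Real.pi * t) : ℝ) * Complex.I) := by
  rw [Complex.exp_mul_I, ← Complex.ofReal_cos, ← Complex.ofReal_sin, Real.cos_neg, Real.sin_neg]
  apply Complex.ext <;> simp [disk, -Complex.ofReal_cos, -Complex.ofReal_sin]

theorem continuous_disk {X : Type*} [TopologicalSpace X] {f g : X → ℝ} (hf : Continuous f)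
    (hg : Continuous g) : Continuous fun x => disk (f x) (g x) := by
  have : ∀ t y, disk t y = (Real.cos (Real.pi * t) : ℂ) + (y * Real.sin (Real.pi * t) : ℝ) *
      Complex.I := by
    intro t y
    apply Complex.ext <;> simp [disk, -Complex.ofReal_cos, -Complex.ofReal_sin, -Complex.ofReal_mul]
  simp only [this]
  fun_prop

end CubeFace

namespace CubeFace

theorem height_ne_zero_bounds {P : Fin 3 → unitInterval} (h : height P ≠ 0) :
    0 < across P ∧ across P < 1 ∧ |slant P| < 1 := by
  have hpos := lt_of_le_of_ne (height_nonneg P) (Ne.symm h)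
  obtain ⟨h1, h2⟩ := le_across P
  have h3 := abs_slant_le P
  refine ⟨?_, ?_, ?_⟩ <;> linarith

theorem abs_slant_le_one (P : Fin 3 → unitInterval) : |slant P| ≤ 1 := by
  have h3 := abs_slant_le P
  have h4 := height_nonneg P
  linarith

theorem continuous_point (i : Fin 3 × Bool) :
    Continuous fun x : unitInterval × unitInterval => point i x.1 x.2 := by
  obtain ⟨k, s⟩ := i
  refine continuous_pi fun m => ?_
  fin_cases k <;> fin_cases m
  all_goals first | exact continuous_fst | exact continuous_snd | exact continuous_const

theorem continuous_height : Continuous height := by unfold height; fun_prop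

theorem continuous_across : Continuous across := by
  unfold across
  have := continuous_height
  fun_prop

theorem continuousAt_slant {P : Fin 3 → unitInterval} (h : height P ≠ 0) :
    ContinuousAt slant P := by
  have hev : ∀ᶠ Q in 𝓝 P, slant Q = ((Q 1 : ℝ) - Q 2) * (1 / height Q - 1 / 2) := by
    filter_upwards [continuous_height.continuousAt.eventually_ne h] with Q hQ
    rw [slant, if_neg hQ]
  refine ContinuousAt.congr ?_ (Filter.EventuallyEq.symm hev)
  have hc := continuous_height.continuousAt (x := P)
  have h1 : ContinuousAt (fun Q : Fin 3 → unitInterval => ((Q 1 : ℝ) - Q 2)) P := by fun_prop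
  exact h1.mul ((continuousAt_const.div hc h).sub continuousAt_const)

/-- On these two facets the slant has no limit at the corner on the slit edge, but it is bounded and
is multiplied by a sine that vanishes there: the chord of the disk shrinks to a point. -/
theorem continuous_slant_mul_sin_left {s : Bool} :
    Continuous fun x : unitInterval × unitInterval => slant (point (0, s) x.1 x.2) *
      Real.sin (Real.pi * across (point (0, s) x.1 x.2)) := by
  have hp := continuous_point (0, s)
  have hs : Continuous fun x : unitInterval × unitInterval =>
      Real.sin (Real.pi * across (point (0, s) x.1 x.2)) := by
    have := continuous_across.comp hp
    simp only [Function.comp_def] at this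
    fun_prop
  rw [continuous_iff_continuousAt]
  intro x
  by_cases hx : height (point (0, s) x.1 x.2) = 0
  · have hzero : Real.sin (Real.pi * across (point (0, s) x.1 x.2)) = 0 := by
      unfold across
      rw [hx]
      cases s <;> simp [point, insert, endpt]
    rw [ContinuousAt, hzero, mul_zero]
    have ht := hs.tendsto x
    rw [hzero] at ht
    refine squeeze_zero_norm (fun y => ?_) (tendsto_norm_zero.comp ht)
    rw [norm_mul]
    exact mul_le_of_le_one_left (norm_nonneg _) (abs_slant_le_one _)
  · exact (ContinuousAt.comp (f := fun x : unitInterval × unitInterval => point (0, s) x.1 x.2)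
      (continuousAt_slant hx) hp.continuousAt).mul hs.continuousAt

theorem continuous_disk_left {s : Bool} : Continuous fun x : unitInterval × unitInterval =>
    disk (across (point (0, s) x.1 x.2)) (slant (point (0, s) x.1 x.2)) := by
  have e : ∀ t y, disk t y = (Real.cos (Real.pi * t) : ℂ) + (y * Real.sin (Real.pi * t) : ℝ) *
      Complex.I := by
    intro t y
    apply Complex.ext <;>
      simp [disk, -Complex.ofReal_cos, -Complex.ofReal_sin, -Complex.ofReal_mul]
  have ha := continuous_across.comp (continuous_point (0, s))
  have h2 := Complex.continuous_ofReal.comp (continuous_slant_mul_sin_left (s := s))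
  have h3 := Complex.continuous_ofReal.comp
    (Real.continuous_cos.comp (continuous_const.mul ha : Continuous fun x => Real.pi * _))
  refine (h3.add (h2.mul (continuous_const (y := Complex.I)))).congr fun x => ?_
  exact (e _ _).symm

theorem slant_of_zero {P : Fin 3 → unitInterval} (h : P 2 = 0) : slant P = 1 - height P / 2 := by
  unfold slant
  split_ifs with h0
  · rw [h0]; norm_num
  · have : height P = P 1 := by simp [height, h, (P 1).2.1]
    rw [this] at h0 ⊢
    rw [h]
    field_simp
    simp

theorem slant_of_zero' {P : Fin 3 → unitInterval} (h : P 1 = 0) (h0 : height P ≠ 0) :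
    slant P = -(1 - height P / 2) := by
  unfold slant
  rw [if_neg h0]
  have : height P = P 2 := by simp [height, h, (P 2).2.1]
  rw [this] at h0 ⊢
  rw [h]
  field_simp
  simp

theorem slant_of_one {P : Fin 3 → unitInterval} (h : P 1 = 1 ∨ P 2 = 1) :
    slant P = (P 1 - P 2) / 2 := by
  have : height P = 1 := by
    rcases h with h | h
    · simp [height, h, (P 2).2.2]
    · simp [height, h, (P 1).2.2]
  rw [slant, if_neg (by rw [this]; norm_num), this]
  ring

/-- Only the facet `(1, false)` sees the jump of the slant along the slit edge. There `hsymm` allows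
the boundary value 1 to be replaced by -1, which makes the formula continuous. On the other facets
the map to the disk is itself continuous. -/
theorem continuous_comp_disk {M : Type*} [TopologicalSpace M] {φ : ℂ → M}
    (hφ : ContinuousOn φ (Metric.closedBall 0 1))
    (hsymm : ∀ t : ℝ, 0 ≤ t → t ≤ 1 → φ (disk t 1) = φ (disk t (-1))) (i : Fin 3 × Bool) :
    Continuous fun x : unitInterval × unitInterval =>
      φ (disk (across (point i x.1 x.2)) (slant (point i x.1 x.2))) := by
  have hp := continuous_point i
  have ha : Continuous fun x : unitInterval × unitInterval => across (point i x.1 x.2) :=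
    continuous_across.comp hp
  have hh : Continuous fun x : unitInterval × unitInterval => height (point i x.1 x.2) :=
    continuous_height.comp hp
  have key : (Continuous fun x : unitInterval × unitInterval =>
      disk (across (point i x.1 x.2)) (slant (point i x.1 x.2))) →
      Continuous fun x : unitInterval × unitInterval =>
        φ (disk (across (point i x.1 x.2)) (slant (point i x.1 x.2))) := fun h =>
    hφ.comp_continuous h fun x => disk_mem_closedBall _ (abs_slant_le_one _)
  have hone : (∀ a b, point i a b 1 = 1 ∨ point i a b 2 = 1) →
      Continuous fun x : unitInterval × unitInterval =>
        φ (disk (across (point i x.1 x.2)) (slant (point i x.1 x.2))) := by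
    intro h
    refine key (continuous_disk ha ?_)
    simp only [fun a b => slant_of_one (h a b)]
    have h1 := (continuous_apply (1 : Fin 3)).comp hp
    have h2 := (continuous_apply (2 : Fin 3)).comp hp
    simp only [Function.comp_def] at h1 h2
    fun_prop
  obtain ⟨k, s⟩ := i
  fin_cases k
  · exact key continuous_disk_left
  · cases s
    · have : (fun x : unitInterval × unitInterval =>
          φ (disk (across (point (1, false) x.1 x.2)) (slant (point (1, false) x.1 x.2)))) =
          fun x => φ (disk (across (point (1, false) x.1 x.2))
            (-(1 - height (point (1, false) x.1 x.2) / 2))) := by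
        funext x
        by_cases h0 : height (point (1, false) x.1 x.2) = 0
        · have hl := le_across (point (1, false) x.1 x.2)
          rw [h0] at hl
          rw [slant, if_pos h0, h0, hsymm _ (by linarith [hl.1]) (by linarith [hl.2])]
          norm_num
        · rw [slant_of_zero' rfl h0]
      refine this ▸ hφ.comp_continuous (continuous_disk ha (by fun_prop)) fun x =>
        disk_mem_closedBall _ ?_
      rw [abs_neg, ← abs_slant_eq (Or.inl rfl), abs_abs]
      exact abs_slant_le_one _
    · exact hone fun _ _ => Or.inl rfl
  · cases s
    · refine key (continuous_disk ha ?_)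
      have : ∀ x : unitInterval × unitInterval, slant (point (2, false) x.1 x.2) =
        1 - height (point (2, false) x.1 x.2) / 2 := fun x => slant_of_zero rfl
      exact (funext this : (fun x : unitInterval × unitInterval =>
        slant (point (2, false) x.1 x.2)) = _) ▸ (by fun_prop)
    · exact hone fun _ _ => Or.inr rfl

end CubeFace

open CubeFace in
-- A closed walk of length two runs along an edge and back. The face map therefore folds the
-- boundary circle onto one arc by reflection, which is how the disk closes up to the surface of a
-- cube slit along an edge.
theorem GraphEmbedding.exists_cubeFaceQuad {V : Type*} {G : SimpleGraph V} {M : Type*}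
    [TopologicalSpace M] [T2Space M] (E : GraphEmbedding G M) {col : V → Bool}
    (hcol : ∀ u v, G.Adj u v → col u ≠ col v) (κ : Bool) {U : Set M} {w : ClosedWalk G}
    (hw : w.len = 2) (hU : ∀ x ∈ U, x ∉ E.image) (h : E.IsBoundaryCycle U w) :
    ∃ Q : FaceQuad E col κ U w, (letI := Q.fintype_N; Fintype.card Q.N) = 8 := by
  obtain ⟨φ, hφ, hemb, rfl, hb⟩ := h
  have hinj := injOn_ball_of_isEmbedding hemb
  obtain ⟨v₀, v₁, hadj, h0, h1⟩ : ∃ (v₀ v₁ : V) (hadj : G.Adj v₀ v₁),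
      (∀ t : unitInterval, φ (disk t 1) = E.arc hadj t) ∧
      ∀ t : unitInterval, φ (disk t (-1)) = E.arc hadj t := by
    obtain ⟨len, pos, vertex, adj⟩ := w
    obtain rfl : len = 2 := hw
    have hadj : G.Adj (vertex 0) (vertex 1) := adj 0
    refine ⟨vertex 0, vertex 1, hadj, fun t => ?_, fun t => ?_⟩
    · have e := hb 0 t
      rw [disk_one]
      refine Eq.trans (congrArg φ (congrArg Complex.exp ?_)) e
      simp
      ring
    · have e := hb 1 (unitInterval.symm t)
      have e' : E.arc (adj 1) (unitInterval.symm t) = E.arc hadj t := by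
        change E.arc hadj.symm (unitInterval.symm t) = _
        rw [E.arc_symm hadj]
        simp
      refine Eq.trans ?_ (e.trans e')
      rw [disk_neg_one]
      refine congrArg φ (Complex.exp_eq_exp_iff_exists_int.2 ⟨-1, ?_⟩)
      have : ((1 : ZMod 2).val : ℝ) = 1 := by norm_num [ZMod.val_one]
      simp only [this, unitInterval.coe_symm_eq]
      push_cast
      ring
  have hend : ∀ t y : ℝ, t = 0 ∨ t = 1 → disk t y = disk t 1 := by
    rintro t y (rfl | rfl) <;> simp [disk]
  have harc : ∀ P : Fin 3 → unitInterval, height P = 0 →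
      φ (disk (across P) (slant P)) = E.arc hadj (P 0) := by
    intro P hP
    have e : across P = P 0 := by rw [across, hP]; ring
    rw [slant, if_pos hP, e, h0]
  have hmem : ∀ P : Fin 3 → unitInterval, height P ≠ 0 →
      disk (across P) (slant P) ∈ Metric.ball (0 : ℂ) 1 := by
    intro P hP
    obtain ⟨b1, b2, b3⟩ := height_ne_zero_bounds hP
    exact disk_mem_ball b1 b2 b3
  have hne : ∀ P P' : Fin 3 → unitInterval, height P = 0 → height P' ≠ 0 →
      φ (disk (across P) (slant P)) ≠ φ (disk (across P') (slant P')) := by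
    intro P P' hP hP' h
    refine hU _ ⟨_, hmem P' hP', rfl⟩ ?_
    rw [← h, harc P hP]
    exact (E.isCarrier_arc hadj _).mem_image
  refine ⟨E.cubeFaceQuad κ w hadj (Bool.eq_not_of_ne (hcol _ _ hadj).symm)
    (fun P => φ (disk (across P) (slant P))) ?_ ?_ ?_ ?_ ?_, ?_⟩
  · refine continuous_comp_disk hφ fun t ht0 ht1 => ?_
    exact (h0 ⟨t, ht0, ht1⟩).trans (h1 ⟨t, ht0, ht1⟩).symm
  · intro i j a b a' b' h
    by_cases hP : height (point i a b) = 0 <;> by_cases hP' : height (point j a' b') = 0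
    · rw [harc _ hP, harc _ hP'] at h
      have e := E.arc_injective hadj h
      rw [height_eq_zero] at hP hP'
      funext m
      fin_cases m
      exacts [e, hP.1.trans hP'.1.symm, hP.2.trans hP'.2.symm]
    · exact absurd h (hne _ _ hP hP')
    · exact absurd h.symm (hne _ _ hP' hP)
    · obtain ⟨b1, b2, -⟩ := height_ne_zero_bounds hP
      obtain ⟨b1', b2', -⟩ := height_ne_zero_bounds hP'
      obtain ⟨e1, e2⟩ := disk_injective b1 b2 b1' b2' (hinj (hmem _ hP) (hmem _ hP') h)
      exact eq_of_height_eq (by rw [height_point, height_point, e1, e2]) hP e1 e2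
  · intro P h1 h2
    exact harc P (height_eq_zero.2 ⟨h1, h2⟩)
  · intro i a b h
    exact ⟨_, hmem _ fun h' => h (height_eq_zero.1 h'), rfl⟩
  · intro x hx
    obtain ⟨z, hz, rfl⟩ := closure_subset_image_closedBall hφ hx
    obtain ⟨t, y, ht0, ht1, hy, rfl⟩ := exists_disk hz
    by_cases hl : 0 < level t y
    · obtain ⟨i, a, b, e1, e2⟩ := exists_point_of_level hl
      exact ⟨i, a, b, by rw [e1, e2]⟩
    -- Level zero means a point of the boundary circle: an end of the diameter or one of the two
    -- half circles, and both halves trace the same arc.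
    · have hbd : φ (disk t y) = E.arc hadj ⟨t, ht0, ht1⟩ := by
        have hc : (t = 0 ∨ t = 1) ∨ |y| = 1 := by
          by_contra! hc
          refine hl (lt_min (lt_min one_pos ?_) (lt_min ?_ ?_))
          · have := lt_of_le_of_ne ht0 (Ne.symm hc.1.1); linarith
          · have := lt_of_le_of_ne ht1 hc.1.2; linarith
          · have := lt_of_le_of_ne hy hc.2; linarith
        rcases hc with hc | hc
        · rw [hend t y hc]; exact h0 ⟨t, ht0, ht1⟩
        · rcases (abs_eq zero_le_one).1 hc with rfl | rfl
          exacts [h0 ⟨t, ht0, ht1⟩, h1 ⟨t, ht0, ht1⟩]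
      refine ⟨(1, false), ⟨t, ht0, ht1⟩, 0, ?_⟩
      rw [hbd]
      exact harc _ (height_eq_zero.2 ⟨rfl, rfl⟩)
  · change Fintype.card (Fin 3 → Bool) = 8
    simp

/-! ### Choice of the cuts. -/

theorem CutSeq.exists_of_finset {L : ℕ} (hL : 0 < L) (T : Finset (ZMod L)) (hT : 3 ≤ T.card) :
    ∃ c : CutSeq L T.card, (∀ i, ((c.s i : ℤ) : ZMod L) ∈ T) ∧
      ∀ n : ℤ, (n : ZMod L) ∈ T → ∃ i, c.s i = n := by
  have : NeZero L := ⟨hL.ne'⟩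
  have hcard : (T.image ZMod.val).card = T.card :=
    Finset.card_image_of_injective _ (ZMod.val_injective L)
  obtain ⟨k, hk⟩ : ∃ k, k = T.card := ⟨_, rfl⟩
  rw [← hk] at hcard hT ⊢
  have hk0 : 0 < k := by omega
  have hkz : (0 : ℤ) < k := by exact_mod_cast hk0
  let e := (T.image ZMod.val).orderEmbOfFin hcard
  have he : ∀ r, ((e r : ℕ) : ZMod L) ∈ T ∧ e r < L := by
    intro r
    obtain ⟨x, hx, hxr⟩ := Finset.mem_image.1 ((T.image ZMod.val).orderEmbOfFin_mem hcard r)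
    change x.val = e r at hxr
    rw [← hxr]
    exact ⟨by simpa using hx, ZMod.val_lt x⟩
  let s : ℤ → ℤ := fun i => e ⟨(i % k).toNat, by
    have := Int.emod_lt_of_pos i hkz
    have := Int.emod_nonneg i hkz.ne'
    omega⟩ + L * (i / k)
  have hs : ∀ (r : Fin k) (q : ℤ), s (r + k * q) = e r + L * q := by
    intro r q
    have h1 : ((r : ℕ) + k * q : ℤ) % k = (r : ℕ) := by
      rw [Int.add_mul_emod_self_left]
      exact Int.emod_eq_of_lt (by positivity) (by exact_mod_cast r.2)
    have h2 : ((r : ℕ) + k * q : ℤ) / k = q := by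
      rw [Int.add_mul_ediv_left _ _ hkz.ne', Int.ediv_eq_zero_of_lt (by positivity)
        (by exact_mod_cast r.2), zero_add]
    simp only [s, h1, h2, Int.toNat_natCast]
  have hdiv : ∀ i : ℤ, ∃ (r : Fin k) (q : ℤ), i = r + k * q := by
    intro i
    have h1 := Int.emod_lt_of_pos i hkz
    have h2 := Int.emod_nonneg i hkz.ne'
    refine ⟨⟨(i % k).toNat, by omega⟩, i / k, ?_⟩
    have h3 := Int.emod_add_mul_ediv i k
    simp only [Int.toNat_of_nonneg h2]
    exact h3.symm
  refine ⟨⟨s, strictMono_int_of_lt_succ fun i => ?_, fun i => ?_, hT⟩, fun i => ?_,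
    fun n hn => ?_⟩
  · obtain ⟨r, q, rfl⟩ := hdiv i
    by_cases hr : (r : ℕ) + 1 < k
    · have h1 := hs ⟨r + 1, hr⟩ q
      have h2 : e r < e ⟨r + 1, hr⟩ := e.strictMono (Fin.mk_lt_mk.2 (Nat.lt_succ_self r))
      rw [show ((r : ℕ) : ℤ) + k * q + 1 = ((r + 1 : ℕ) : ℤ) + k * q by push_cast; ring, h1, hs]
      have h3 : ((e r : ℕ) : ℤ) < e ⟨r + 1, hr⟩ := by exact_mod_cast h2
      linarith
    -- From the last cut of a period the sequence passes to the first cut of the next one.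
    · have h1 := hs ⟨0, hk0⟩ (q + 1)
      have hr' : ((r : ℕ) : ℤ) + 1 = k := by
        have := r.2
        omega
      rw [show ((r : ℕ) : ℤ) + k * q + 1 = ((0 : ℕ) : ℤ) + k * (q + 1) by
        rw [mul_add, ← hr']; push_cast; ring, h1, hs]
      have h2 : ((e r : ℕ) : ℤ) < L := by exact_mod_cast (he r).2
      have h3 : (0 : ℤ) ≤ (e ⟨0, hk0⟩ : ℕ) := by positivity
      linarith
  · obtain ⟨r, q, rfl⟩ := hdiv i
    rw [show ((r : ℕ) : ℤ) + k * q + k = r + k * (q + 1) by ring, hs, hs]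
    ring
  · obtain ⟨r, q, rfl⟩ := hdiv i
    change ((s _ : ℤ) : ZMod L) ∈ T
    rw [hs]
    simpa using (he r).1
  · have h1 : (n : ZMod L).val ∈ T.image ZMod.val := Finset.mem_image_of_mem _ hn
    have h2 : (n : ZMod L).val ∈ Set.range e := by
      rw [Finset.range_orderEmbOfFin]
      exact h1
    obtain ⟨r, hr⟩ := h2
    obtain ⟨j, hj⟩ := GraphEmbedding.exists_int_cast_val hL n
    refine ⟨r + k * j, ?_⟩
    change s _ = n
    rw [hs, hr]
    conv_rhs => rw [hj]
    ring

namespace ClosedWalk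

variable {V : Type*} {G : SimpleGraph V} (w : ClosedWalk G)

theorem SimpleSubpath.eq_of_vertex_eq {w : ClosedWalk G} {i : ℤ} {m : ℕ}
    (h : w.SimpleSubpath (i : ZMod w.len) m) {a b : ℤ} (ha : i ≤ a) (ha' : a ≤ i + m)
    (hb : i ≤ b) (hb' : b ≤ i + m)
    (hab : w.vertex (a : ZMod w.len) = w.vertex (b : ZMod w.len)) : a = b := by
  obtain ⟨l, rfl⟩ := Int.le.dest ha
  obtain ⟨l', rfl⟩ := Int.le.dest hb
  have := h (show l ∈ Iic m from Set.mem_Iic.2 (by omega))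
    (show l' ∈ Iic m from Set.mem_Iic.2 (by omega)) (by push_cast at hab; exact hab)
  rw [this]

theorem exists_greatest_cut {T : Set (ZMod w.len)} (hT : T.Nonempty) (n : ℤ) :
    ∃ t : ℤ, t ≤ n ∧ (t : ZMod w.len) ∈ T ∧ ∀ t' : ℤ, t < t' → t' ≤ n → (t' : ZMod w.len) ∉ T := by
  have : NeZero w.len := ⟨w.len_pos.ne'⟩
  have hL : (1 : ℤ) ≤ w.len := by exact_mod_cast w.len_pos
  obtain ⟨x, hx⟩ := hT
  obtain ⟨t, ⟨h1, h2⟩, h3⟩ := Int.exists_greatest_of_bdd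
    (P := fun t : ℤ => t ≤ n ∧ (t : ZMod w.len) ∈ T) ⟨n, fun z hz => hz.1⟩
    -- A representative of `x` that is at most `n`, since the length is at least 1.
    ⟨x.val - w.len * (x.val + |n|), by
      have h1 := neg_abs_le n
      have h2 := abs_nonneg n
      have h3 : (0 : ℤ) ≤ x.val := by positivity
      nlinarith, by simpa using hx⟩
  exact ⟨t, h1, h2, fun t' h h' ht' => absurd (h3 t' ⟨h', ht'⟩) (by omega)⟩

variable {col : V → Bool}

theorem col_vertex_succ {w : ClosedWalk G} (hcol : ∀ u v, G.Adj u v → col u ≠ col v)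
    (i : ZMod w.len) : col (w.vertex (i + 1)) = !col (w.vertex i) :=
  Bool.eq_not_of_ne (hcol _ _ (w.adj i)).symm

theorem col_vertex_pred {w : ClosedWalk G} (hcol : ∀ u v, G.Adj u v → col u ≠ col v)
    (i : ZMod w.len) : col (w.vertex (i - 1)) = !col (w.vertex i) := by
  have := col_vertex_succ hcol (i - 1)
  rw [sub_add_cancel] at this
  rw [this, Bool.not_not]

theorem col_vertex_add_two {w : ClosedWalk G} (hcol : ∀ u v, G.Adj u v → col u ≠ col v)
    (i : ZMod w.len) : col (w.vertex (i + 2)) = col (w.vertex i) := by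
  rw [show i + 2 = i + 1 + 1 by ring, col_vertex_succ hcol, col_vertex_succ hcol, Bool.not_not]

theorem even_len {w : ClosedWalk G} (hcol : ∀ u v, G.Adj u v → col u ≠ col v) : Even w.len := by
  rw [← Nat.not_odd_iff_even]
  rintro ⟨d, hd⟩
  have key : ∀ n : ℕ, col (w.vertex ((2 * n : ℕ) : ZMod w.len)) = col (w.vertex 0) := by
    intro n
    induction n with
    | zero => simp
    | succ n ih =>
      rw [← ih, ← col_vertex_add_two hcol ((2 * n : ℕ) : ZMod w.len)]
      congr 2; push_cast; ring
  have h1 := col_vertex_succ hcol ((2 * d : ℕ) : ZMod w.len)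
  rw [key, show ((2 * d : ℕ) : ZMod w.len) + 1 = ((2 * d + 1 : ℕ) : ZMod w.len) by push_cast; ring,
    ← hd, ZMod.natCast_self] at h1
  simp at h1

theorem natCast_ne_zero {w : ClosedWalk G} {m : ℕ} (h0 : 0 < m) (h : m < w.len) :
    (m : ZMod w.len) ≠ 0 := by
  rw [Ne, ZMod.natCast_eq_zero_iff]
  exact fun hd => absurd (Nat.le_of_dvd h0 hd) (by omega)

/-- Colours alternate, so the length is even; in a cycle of length four the unordered outer pairs at
positions 0 and 2 coincide. -/
theorem len_eq_two_or {w : ClosedWalk G} (hcol : ∀ u v, G.Adj u v → col u ≠ col v)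
    (hw : Function.Injective w.outerPair) : w.len = 2 ∨ 6 ≤ w.len := by
  obtain ⟨d, hd⟩ := even_len (w := w) hcol
  have hpos := w.len_pos
  have h4 : w.len ≠ 4 := by
    intro h4
    have e4 : (2 : ZMod w.len) + 2 = 0 := by
      have : ((4 : ℕ) : ZMod w.len) = 0 := by rw [← h4]; simp
      push_cast at this
      rw [← this]; norm_num
    have h : w.outerPair 0 = w.outerPair 2 := by
      unfold outerPair
      rw [e4, zero_add, Sym2.eq_swap]
    have := natCast_ne_zero (w := w) (m := 2) (by norm_num) (by omega)
    exact this (by exact_mod_cast (hw h).symm)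
  omega

/-- The cuts of a closed walk can be moved to vertices of one colour. -/
theorem exists_cutSeq {w : ClosedWalk G} (hcol : ∀ u v, G.Adj u v → col u ≠ col v) (κ : Bool)
    (hlen : 6 ≤ w.len) (hII : ∀ i, w.SimpleSubpath i 2) (T : Finset (ZMod w.len))
    (hT : w.SplitsAt T) :
    ∃ (k : ℕ) (c : CutSeq w.len k), k ≤ 2 * T.card + 3 ∧
      (∀ i, col (w.vertex (c.s i : ℤ)) = κ) ∧
      ∀ i a b : ℤ, c.s i ≤ a → a ≤ c.s (i + 1) → c.s i ≤ b → b ≤ c.s (i + 1) →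
        w.vertex (a : ZMod w.len) = w.vertex (b : ZMod w.len) → a = b := by
  obtain ⟨c₀, hc₀⟩ : ∃ c₀, col (w.vertex c₀) = κ := by
    by_cases h : col (w.vertex 0) = κ
    · exact ⟨0, h⟩
    · refine ⟨0 + 1, ?_⟩
      rw [col_vertex_succ hcol, Bool.eq_not_of_ne h, Bool.not_not]
  -- A cut at a vertex of the wrong colour is replaced by cuts at both its neighbours, given by `f`
  -- and `g`.
  let f : ZMod w.len → ZMod w.len := fun t => if col (w.vertex t) = κ then t else t - 1
  let g : ZMod w.len → ZMod w.len := fun t => if col (w.vertex t) = κ then t else t + 1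
  -- Three extra cuts of colour `κ` guarantee `k ≥ 3`; they are distinct because the length is at
  -- least 6.
  let T₀ : Finset (ZMod w.len) := {c₀, c₀ + 2, c₀ + 4}
  have hT₀ : T₀.card = 3 := by
    have h2 := natCast_ne_zero (w := w) (m := 2) (by norm_num) (by omega)
    have h4 := natCast_ne_zero (w := w) (m := 4) (by norm_num) (by omega)
    push_cast at h2 h4
    refine Finset.card_eq_three.2 ⟨_, _, _, ?_, ?_, ?_, rfl⟩
    · simpa using h2
    · simpa using h4
    · intro h
      have h' := add_left_cancel h
      apply h2
      calc (2 : ZMod w.len) = 4 - 2 := by norm_num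
        _ = 0 := by rw [← h', sub_self]
  let T' : Finset (ZMod w.len) := (T.image f ∪ T.image g) ∪ T₀
  have hcolT' : ∀ t ∈ T', col (w.vertex t) = κ := by
    intro t ht
    rcases Finset.mem_union.1 ht with ht | ht
    · rcases Finset.mem_union.1 ht with ht | ht
      · obtain ⟨x, -, rfl⟩ := Finset.mem_image.1 ht
        simp only [f]
        split_ifs with h
        · exact h
        · rw [col_vertex_pred hcol, Bool.eq_not_of_ne h, Bool.not_not]
      · obtain ⟨x, -, rfl⟩ := Finset.mem_image.1 ht
        simp only [g]
        split_ifs with h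
        · exact h
        · rw [col_vertex_succ hcol, Bool.eq_not_of_ne h, Bool.not_not]
    · simp only [T₀, Finset.mem_insert, Finset.mem_singleton] at ht
      rcases ht with rfl | rfl | rfl
      · exact hc₀
      · rw [col_vertex_add_two hcol, hc₀]
      · rw [show c₀ + 4 = c₀ + 2 + 2 by ring, col_vertex_add_two hcol, col_vertex_add_two hcol,
          hc₀]
  have hcard : T'.card ≤ 2 * T.card + 3 := by
    have h1 : (T.image f).card ≤ T.card := Finset.card_image_le
    have h2 : (T.image g).card ≤ T.card := Finset.card_image_le
    have h3 := Finset.card_union_le (T.image f) (T.image g)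
    have h4 := Finset.card_union_le (T.image f ∪ T.image g) T₀
    change ((T.image f ∪ T.image g) ∪ T₀).card ≤ _
    omega
  have hcard3 : 3 ≤ T'.card := hT₀ ▸ Finset.card_le_card Finset.subset_union_right
  obtain ⟨c, hc, hc'⟩ := CutSeq.exists_of_finset w.len_pos T' hcard3
  refine ⟨_, c, hcard, fun i => hcolT' _ (hc i), ?_⟩
  intro i a b ha ha' hb hb' hab
  have hbetween : ∀ n : ℤ, c.s i < n → n < c.s (i + 1) → (n : ZMod w.len) ∉ T' := by
    intro n h1 h2 h
    obtain ⟨j, rfl⟩ := hc' n h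
    have h3 := c.mono.lt_iff_lt.1 h1
    have h4 := c.mono.lt_iff_lt.1 h2
    omega
  -- An old cut strictly inside a slot must have the wrong colour, so both its neighbours are cuts
  -- and the slot consists of its two edges. Without such a cut the slot is part of a single given
  -- path.
  by_cases hn : ∃ n : ℤ, c.s i < n ∧ n < c.s (i + 1) ∧ (n : ZMod w.len) ∈ T
  · obtain ⟨n, h1, h2, h3⟩ := hn
    have hfT : f n ∈ T' :=
      Finset.mem_union_left _ (Finset.mem_union_left _ (Finset.mem_image_of_mem f h3))
    have hgT : g n ∈ T' :=
      Finset.mem_union_left _ (Finset.mem_union_right _ (Finset.mem_image_of_mem g h3))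
    have hcn : ¬ col (w.vertex (n : ZMod w.len)) = κ := by
      intro h
      simp only [f, if_pos h] at hfT
      exact hbetween n h1 h2 hfT
    simp only [f, g, if_neg hcn] at hfT hgT
    have e1 : c.s i = n - 1 := by
      by_contra hne
      exact hbetween (n - 1) (by omega) (by omega) (by push_cast; exact hfT)
    have e2 : c.s (i + 1) = n + 1 := by
      by_contra hne
      exact hbetween (n + 1) (by omega) (by omega) (by push_cast; exact hgT)
    exact (hII ((n - 1 : ℤ) : ZMod w.len)).eq_of_vertex_eq (by omega) (by push_cast; omega)
      (by omega) (by push_cast; omega) hab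
  · push Not at hn
    obtain ⟨t, h1, h2, h3⟩ := w.exists_greatest_cut hT.1 (c.s i)
    have hlt := c.mono (lt_add_one i)
    have hm : ((c.s (i + 1) - t).toNat : ℤ) = c.s (i + 1) - t := Int.toNat_of_nonneg (by omega)
    have hs := hT.2 t h2 (c.s (i + 1) - t).toNat fun l hl hl' => by
      have hcast : (t : ZMod w.len) + (l : ZMod w.len) = ((t + l : ℤ) : ZMod w.len) := by
        push_cast; rfl
      rw [hcast]
      by_cases h : t + l ≤ c.s i
      · exact h3 _ (by omega) h
      · exact hn _ (by omega) (by omega)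
    exact hs.eq_of_vertex_eq (by omega) (by omega) (by omega) (by omega) hab

end ClosedWalk

/-! ### Counting new vertices and assembling the faces. -/

theorem GraphEmbedding.CutFace.card_faceQuad {V : Type*} {G : SimpleGraph V} {M : Type*}
    [TopologicalSpace M] {E : GraphEmbedding G M} {col : V → Bool} {κ : Bool} {U : Set M}
    {w : ClosedWalk G} {k : ℕ} (F : CutFace E col κ U w k) (hw : Function.Injective w.outerPair) :
    (letI := (F.faceQuad hw).fintype_N; Fintype.card (F.faceQuad hw).N) = 2 * k + 1 := by
  have : NeZero k := ⟨F.k_pos.ne'⟩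
  refine (@Nat.card_eq_fintype_card _ (F.faceQuad hw).fintype_N).symm.trans ?_
  change Nat.card (ZMod k ⊕ ZMod k ⊕ Unit) = _
  rw [Nat.card_sum, Nat.card_sum, Nat.card_zmod, Nat.card_unique]
  ring

/-- A face whose boundary cycle splits into few simple paths has a small subdivision. -/
theorem GraphEmbedding.exists_faceQuad {V : Type*} {G : SimpleGraph V} {M : Type*}
    [TopologicalSpace M] [T2Space M] (E : GraphEmbedding G M) {col : V → Bool}
    (hcol : ∀ u v, G.Adj u v → col u ≠ col v) (κ : Bool) {U : Set M} {w : ClosedWalk G}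
    (hU : ∀ x ∈ U, x ∉ E.image) (h : E.IsBoundaryCycle U w)
    (hw : Function.Injective w.outerPair) (hII : 2 < w.len → ∀ i, w.SimpleSubpath i 2)
    (T : Finset (ZMod w.len)) (hT : w.SplitsAt T) :
    ∃ Q : FaceQuad E col κ U w, (letI := Q.fintype_N; Fintype.card Q.N) ≤ 11 * T.card := by
  -- At least one cut is present, so `2 * (2 * T.card + 3) + 1 = 4 * T.card + 7` is at most `11 *
  -- T.card`, and so are the 8 labels of the cube.
  have hpos : 0 < T.card := Finset.card_pos.2 (Finset.coe_nonempty.1 hT.1)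
  rcases ClosedWalk.len_eq_two_or hcol hw with hlen | hlen
  · obtain ⟨Q, hQ⟩ := E.exists_cubeFaceQuad hcol κ hlen hU h
    exact ⟨Q, by omega⟩
  · obtain ⟨k, c, hk, hc, hs⟩ := ClosedWalk.exists_cutSeq hcol κ hlen (hII (by omega)) T hT
    obtain ⟨P⟩ := nonempty_polarFace h
    let F : CutFace E col κ U w k := ⟨P, c, hcol, hc, hs, hU⟩
    exact ⟨F.faceQuad hw, by rw [F.card_faceQuad hw]; omega⟩

theorem mainTheorem4 (c : ℝ) (hc : 0 < c) :
    ∃ C : ℝ, 0 < C ∧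
      ∀ (V : Type*) [Fintype V] (G : SimpleGraph V)
        (M : Type*) [TopologicalSpace M] [T2Space M] [CompactSpace M]
        [ChartedSpace (EuclideanSpace ℝ (Fin 2)) M]
        (E : GraphEmbedding G M) (w : E.Face → ClosedWalk G),
        G.IsBipartite →
        (∀ U : E.Face, E.IsBoundaryCycle U.1 (w U)) →
        (∃ even : Set E.Face,
          InjOn (fun p : (U : E.Face) × ZMod (w U).len => (w p.1).outerPair p.2)
            {p | p.1 ∈ even} ∧
          InjOn (fun p : (U : E.Face) × ZMod (w U).len => (w p.1).outerPair p.2)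
            {p | p.1 ∉ even}) →
        (∀ (U : E.Face) (i : ZMod (w U).len) (m : ℕ), m ≤ 10 → m < (w U).len →
          (w U).SimpleSubpath i m) →
        (∃ cuts : Finset ((U : E.Face) × ZMod (w U).len),
          (∀ U : E.Face, (w U).SplitsAt {i | (⟨U, i⟩ : (U : E.Face) × ZMod (w U).len) ∈ cuts}) ∧
          (cuts.card : ℝ) ≤ c * Fintype.card V) →
        ∃ K : CubeComplex 2 M, K.Refines E ∧
          (K.vertices.ncard : ℝ) ≤ (Fintype.card V : ℝ) * (1 + C) := by
  refine ⟨11 * c, by positivity, ?_⟩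
  intro V _ G M _ _ _ _ E w hbip hbd ⟨even, heven, hodd⟩ hII ⟨cuts, hcuts, hcard⟩
  classical
  obtain ⟨colouring⟩ := hbip
  let col : V → Bool := fun v => decide (colouring v = 0)
  have hcol : ∀ u v, G.Adj u v → col u ≠ col v := by
    intro u v huv h
    have hne := colouring.valid huv
    simp only [col, decide_eq_decide] at h
    omega
  -- Even and odd faces draw their old diagonals between vertices of different colours, so condition
  -- (I) is needed only within each parity.
  let κ : E.Face → Bool := fun U => decide (U ∈ even)
  have hpair : ∀ (U U' : E.Face) (i : ZMod (w U).len) (i' : ZMod (w U').len), κ U = κ U' →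
      (w U).outerPair i = (w U').outerPair i' →
      (⟨U, i⟩ : (U : E.Face) × ZMod (w U).len) = ⟨U', i'⟩ := by
    intro U U' i i' hκ h
    simp only [κ, decide_eq_decide] at hκ
    by_cases hU : U ∈ even
    · exact heven (x₁ := ⟨U, i⟩) (x₂ := ⟨U', i'⟩) hU (hκ.1 hU) h
    · exact hodd (x₁ := ⟨U, i⟩) (x₂ := ⟨U', i'⟩) hU (fun hU' => hU (hκ.2 hU')) h
  have hmk : ∀ U, Function.Injective
      (fun i => (⟨U, i⟩ : (U : E.Face) × ZMod (w U).len)) :=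
    fun U => sigma_mk_injective (β := fun U : E.Face => ZMod (w U).len)
  have hinj : ∀ U, Function.Injective (w U).outerPair := fun U i i' h =>
    hmk U (hpair U U i i' rfl h)
  -- Every face has at least one of the finitely many cuts.
  have hfin : Finite E.Face := by
    choose i hi using fun U => (hcuts U).1
    exact Finite.of_injective (fun U => (⟨⟨U, i U⟩, hi U⟩ : cuts)) fun U U' h =>
      congrArg (fun p : cuts => p.1.1) h
  let := Fintype.ofFinite E.Face
  let T : ∀ U, Finset (ZMod (w U).len) := fun U =>
    cuts.preimage _ (hmk U).injOn
  have hT : ∀ U, (w U).SplitsAt (T U) := by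
    intro U
    have : ((T U : Finset (ZMod (w U).len)) : Set (ZMod (w U).len)) =
        {i | (⟨U, i⟩ : (U : E.Face) × ZMod (w U).len) ∈ cuts} := by
      ext i; simp [T]
    rw [this]
    exact hcuts U
  have hsum : ∑ U, (T U).card = cuts.card := by
    rw [← Finset.card_sigma]
    congr 1
    ext ⟨U, i⟩
    simp [T]
  choose Q hQ using fun U => E.exists_faceQuad hcol (κ U) (fun x hx => U.disjoint_image hx)
    (hbd U) (hinj U) (fun hlen i => hII U i 2 (by norm_num) hlen) (T U) (hT U)
  obtain ⟨K, hK, hKcard⟩ := E.exists_cubeComplex_of_faceQuad E.iUnion_closure_face w col hcol κ Q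
    hpair
  refine ⟨K, hK, ?_⟩
  have hle : K.vertices.ncard ≤ Fintype.card V + 11 * cuts.card := by
    refine hKcard.trans (Nat.add_le_add_left ?_ _)
    rw [← hsum, Finset.mul_sum]
    exact Finset.sum_le_sum fun U _ => hQ U
  have hle' : (K.vertices.ncard : ℝ) ≤ Fintype.card V + 11 * cuts.card := by exact_mod_cast hle
  calc (K.vertices.ncard : ℝ) ≤ Fintype.card V + 11 * cuts.card := hle'
    _ ≤ Fintype.card V + 11 * (c * Fintype.card V) := by gcongr
    _ = Fintype.card V * (1 + 11 * c) := by ring
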